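/- Let $0<q<1$ and $\lambda=q-q^{-1}$. **Algebras.** $\mathcal U=\mathcal U_q(\mathrm{su}_{1,1})$ is the complex Hopf $*$-algebra with generators $E,F,K,K^{-1}$, relations $KK^{-1}=K^{-1}K=1$, $KE=qEK$, $KF=q^{-1}FK$, $EF-FE=\lambda^{-1}(K^2-K^{-2})$, involution $E^*=-F$, $K^*=K$, and $\Delta(K)=K\otimes K$, $\Delta(E)=E\otimes K+K^{-1}\otimes E$, $\Delta(F)=F\otimes K+K^{-1}\otimes F$, $\varepsilon(K)=1$, $\varepsilon(E)=\varepsilon(F)=0$, $S(K)=K^{-1}$, $S(E)=-qE$, $S(F)=-q^{-1}F$. $\mathcal O(\mathrm U_q)$ is the $*$-algebra generated by $z$ with $z^*z-q^2zz^*=1-q^2$. $\mathcal F(\mathrm U_q)$ is the $*$-algebra generated by $\mathcal O(\mathrm U_q)$ and the locally bounded Borel functions $f(y)$ on $\mathbb R\setminus\{0\}$ with $z^*z=1-y$ and $z^nz^{*k}f(y)=f(q^{2(k-n)}y)z^nz^{*k}$. The algebra $\mathcal U$ acts on $\mathcal F(\mathrm U_q)$ and on $\mathcal O(\mathrm U_q)$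 from the right by $z^nf(y)\triangleleft K=q^{-n}z^nf(y)$, $f(y)z^{*n}\triangleleft K=q^{n}f(y)z^{*n}$ and $$x\triangleleft E=q^{1/2}\lambda^{-1}\bigl(z(x\triangleleft K)-(x\triangleleft K^{-1})z\bigr),\qquad x\triangleleft F=q^{-1/2}\lambda^{-1}\bigl((x\triangleleft K^{-1})z^*-z^*(x\triangleleft K)\bigr).$$ $\mathcal F_0(\mathrm U_q)$ is the $\mathcal U$-invariant ideal spanned by the elements $z^kz^{*n}f(y)$ with $f$ of compact support in $\mathbb R\setminus\{0\}$. The cross product algebra $\mathcal U\ltimes\mathcal O(\mathrm U_q)$ is $\mathcal U\otimes\mathcal O(\mathrm U_q)$ with $(g\otimes x)(f\otimes y)=gf_{(1)}\otimes(x\triangleleft f_{(2)})y$ and the involution extending those of the factors. A linear functional $h$ on $\mathcal F_0(\mathrm U_q)$ is positive if $h(x^*x)\ge0$, and invariant if $h(x\triangleleft f)=\varepsilon(f)h(x)$ for all $x\in\mathcal F_0(\mathrm U_q)$, $f\in\mathcal U$. **Functionals.** Let $\mu_0$ be a finite Borel measure on $[-1,-q^2)$ and $\mu$ its extension to $(-\infty,0)$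 with $\mu(q^{2k}M)=q^{2k}\mu_0(M)$ for $k\in\mathbb Z$, $M\subseteq[-1,-q^2)$. Put $$h_I(z^nf(y))=h_I(f(y)z^{*n})=\delta_{n0}\sum_{k\ge1}f(q^{2k})q^{-2k},\qquad h_{\mu_0}(z^nf(y))=h_{\mu_0}(f(y)z^{*n})=\delta_{n0}\int_{-\infty}^0f(y)y^{-2}\,d\mu(y).$$ **Representations.** A $*$-representation acts on a dense linear subspace of a Hilbert space. For a positive invariant $h$, the Heisenberg representation $\pi_h$ acts on the image of $\mathcal F_0(\mathrm U_q)$ in the completion of $\mathcal F_0(\mathrm U_q)/\{x:h(x^*x)=0\}$ with respect to $\langle x,y\rangle=h(y^*x)$, by $\pi_h(f\otimes a)x=(ax)\triangleleft S^{-1}(f)$. $(I.1)_I$: on the linear span of an orthonormal basis $\eta_{nk}$, $n,k\ge0$ ($\eta_{nk}=0$ if $n<0$ or $k<0$), with $\lambda_n=(1-q^{2n})^{1/2}$: $$z\eta_{nk}=\lambda_{n+1}\eta_{n+1,k},\quad z^*\eta_{nk}=\lambda_n\eta_{n-1,k},\quad K\eta_{nk}=q^{n-k}\eta_{nk},$$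 $$F\eta_{nk}=q^{n-k-1/2}\lambda^{-1}\lambda_{k+1}\eta_{n,k+1}+q^{-(n-k)+1/2}\lambda^{-1}\lambda_n\eta_{n-1,k},$$ $$E\eta_{nk}=-q^{n-k+1/2}\lambda^{-1}\lambda_k\eta_{n,k-1}-q^{-(n-k)-1/2}\lambda^{-1}\lambda_{n+1}\eta_{n+1,k}.$$ $(II.2)_{A,A,I}$ for a bounded self-adjoint operator $A$ on a Hilbert space $\mathcal K$: on the span of the vectors $\eta_{nk}$ ($\eta\in\mathcal K$ in position $(n,k)$) in $\bigoplus_{n,k\in\mathbb Z}\mathcal K$, with $\alpha_k=(1+q^{2k}A^2)^{1/2}$: $$z\eta_{nk}=(\alpha_{n+1}\eta)_{n+1,k},\quad z^*\eta_{nk}=(\alpha_n\eta)_{n-1,k},\quad K\eta_{nk}=q^{n-k}\eta_{nk},$$ $$F\eta_{nk}=\lambda^{-1}q^{n-k-1/2}(\alpha_{k+1}\eta)_{n,k+1}+\lambda^{-1}q^{-(n-k)+1/2}(\alpha_n\eta)_{n-1,k},$$ $$E\eta_{nk}=-\lambda^{-1}q^{n-k+1/2}(\alpha_k\eta)_{n,k-1}-\lambda^{-1}q^{-(n-k)-1/2}(\alpha_{n+1}\eta)_{n+1,k}.$$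 **Proposition.** (a) A linear functional $h$ on $\mathcal F_0(\mathrm U_q)$ is invariant if and only if, for all $n\ge1$ and all $f$, $$h(z^nf(y))=h(f(y)z^{*n})=0\quad(1)\qquad\text{and}\qquad h(f(q^{-2}y)(1-q^{-2}y))=q^{-2}h(f(y)(1-y))\quad(2).$$ (b) If $h$ satisfies (1) and is given on functions by a positive, locally finite Borel measure on $\mathbb R\setminus\{0\}$ concentrated on $(-\infty,0)\cup\{q^{2n}:n=1,2,\dots\}$, then $h$ is positive. If moreover (2) holds, then $h$ is invariant and $h=r\,h_I+h_{\mu_0}$ for some $r\ge0$ and some finite Borel measure $\mu_0$ on $[-1,-q^2)$. (c) $h_I$ and, for every finite Borel measure $\mu_0$ on $[-1,-q^2)$, the functionals $h_{\mu_0}$ and $h=h_I+h_{\mu_0}$ are positive and invariant. (d) For every such $\mu_0$, the Heisenberg representation of $\mathcal U\ltimes\mathcal O(\mathrm U_q)$ associated with $h=h_I+h_{\mu_0}$ exists and is unitarily equivalent to the direct sum of the representation $(I.1)_I$, which is irreducible, and the representation $(II.2)_{Q^{1/2},Q^{1/2},I}$, where $\mathcal K=L^2((q^2,1],y^{-2}d\mu_0)$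 ($\mu_0$ transported to $(q^2,1]$ by $y\mapsto-y$) and $Q$ is the operator of multiplication by $y$ on $\mathcal K$. Here $(II.2)_{Q^{1/2},Q^{1/2},I}$ is taken on the domain $\mathrm{Lin}\{\eta_{nk}:\eta\in\mathcal K\text{ bounded}\}$, and this domain is a core for all operators of the representation on $\mathrm{Lin}\{\eta_{nk}:\eta\in\mathcal K\}$: every vector of the latter is the limit of a sequence from the former along which all operators converge. -/

import Mathlib

open scoped TensorProduct

namespace QDisc

/-- The deformation parameter as an element of the open interval `(0,1)`. -/
abbrev Param : Type := Set.Ioo (0 : ℝ) 1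

namespace Param

variable (q : Param)

theorem pos : 0 < (q : ℝ) := q.2.1
theorem lt_one : (q : ℝ) < 1 := q.2.2

/-- `q` as a complex number. -/
def c : ℂ := ((q : ℝ) : ℂ)

/-- `q^{1/2}` as a complex number. -/
noncomputable def sqrt : ℂ := ((Real.sqrt (q : ℝ) : ℝ) : ℂ)

/-- `λ = q - q⁻¹`. -/
noncomputable def lam : ℂ := q.c - q.c⁻¹

theorem c_ne : q.c ≠ 0 := by
  simpa [c] using q.pos.ne'

theorem sqrt_ne : q.sqrt ≠ 0 := by
  simpa [sqrt] using (Real.sqrt_pos.2 q.pos).ne'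

theorem lam_ne : q.lam ≠ 0 := by
  intro h
  have h1 : ((q : ℝ) - (q : ℝ)⁻¹ : ℝ) = 0 := by
    have : (((q : ℝ) - (q : ℝ)⁻¹ : ℝ) : ℂ) = 0 := by
      simpa [lam, c] using h
    exact_mod_cast this
  have h2 : 1 < (q : ℝ)⁻¹ := (one_lt_inv₀ q.pos).2 q.lt_one
  linarith [q.lt_one]

theorem conj_c : (starRingEnd ℂ) q.c = q.c := by simp [c]
theorem conj_sqrt : (starRingEnd ℂ) q.sqrt = q.sqrt := by simp [sqrt]
theorem conj_lam : (starRingEnd ℂ) q.lam = q.lam := by simp [lam, conj_c]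

end Param

/-! ### Conjugate-linear anti-endomorphisms -/

/-- The opposite algebra with complex conjugate scalar multiplication. A complex algebra
homomorphism `B → ConjOp B` is a conjugate-linear anti-endomorphism of `B`. -/
def ConjOp (B : Type) : Type := Bᵐᵒᵖ

namespace ConjOp

variable {B : Type}

/-- The element of the conjugate opposite algebra given by `b`. -/
def op (b : B) : ConjOp B := MulOpposite.op b

/-- The element of `B` underlying an element of the conjugate opposite algebra. -/
def unop (b : ConjOp B) : B := MulOpposite.unop b

@[simp] theorem unop_op (b : B) : unop (op b) = b := rfl

@[ext] theorem ext {a b : ConjOp B} (h : unop a = unop b) : a = b :=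
  MulOpposite.unop_injective h

variable [Ring B]

instance : Ring (ConjOp B) := inferInstanceAs (Ring Bᵐᵒᵖ)

@[simp] theorem unop_mul (a b : ConjOp B) : unop (a * b) = unop b * unop a := rfl
@[simp] theorem unop_add (a b : ConjOp B) : unop (a + b) = unop a + unop b := rfl
@[simp] theorem unop_sub (a b : ConjOp B) : unop (a - b) = unop a - unop b := rfl
@[simp] theorem unop_neg (a : ConjOp B) : unop (-a) = -unop a := rfl
@[simp] theorem unop_one : unop (1 : ConjOp B) = 1 := rfl
@[simp] theorem unop_pow (a : ConjOp B) (n : ℕ) : unop (a ^ n) = unop a ^ n :=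
  MulOpposite.unop_pow (α := B) a n

variable [Algebra ℂ B]

noncomputable instance : Algebra ℂ (ConjOp B) :=
  RingHom.toAlgebra' ((algebraMap ℂ Bᵐᵒᵖ).comp (starRingEnd ℂ)) fun c x =>
    Algebra.commutes (A := Bᵐᵒᵖ) (starRingEnd ℂ c) x

@[simp] theorem unop_algebraMap (c : ℂ) :
    unop (algebraMap ℂ (ConjOp B) c) = algebraMap ℂ B (starRingEnd ℂ c) := rfl

@[simp] theorem unop_smul (c : ℂ) (b : ConjOp B) :
    unop (c • b) = (starRingEnd ℂ c) • unop b := by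
  rw [Algebra.smul_def, Algebra.smul_def, unop_mul, unop_algebraMap, Algebra.commutes]

/-- The involution of `B` defined by an involutive homomorphism `φ : B → ConjOp B`. -/
noncomputable abbrev starRing (φ : B →ₐ[ℂ] ConjOp B) (h : ∀ b, unop (φ (unop (φ b))) = b) :
    StarRing B where
  star b := unop (φ b)
  star_involutive := h
  star_mul a b := by rw [map_mul, unop_mul]
  star_add a b := by rw [map_add, unop_add]

end ConjOp

/-! ### The Hopf `*`-algebra `U_q(su_{1,1})` -/

/-- Generators of `U_q(su_{1,1})`. -/
inductive UGen : Type
  | E | F | K | Kinv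

/-- Defining relations of `U_q(su_{1,1})`. -/
inductive URel (q : Param) : FreeAlgebra ℂ UGen → FreeAlgebra ℂ UGen → Prop
  | K_Kinv : URel q (FreeAlgebra.ι ℂ .K * FreeAlgebra.ι ℂ .Kinv) 1
  | Kinv_K : URel q (FreeAlgebra.ι ℂ .Kinv * FreeAlgebra.ι ℂ .K) 1
  | K_E : URel q (FreeAlgebra.ι ℂ .K * FreeAlgebra.ι ℂ .E)
      (q.c • (FreeAlgebra.ι ℂ .E * FreeAlgebra.ι ℂ .K))
  | K_F : URel q (FreeAlgebra.ι ℂ .K * FreeAlgebra.ι ℂ .F)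
      (q.c⁻¹ • (FreeAlgebra.ι ℂ .F * FreeAlgebra.ι ℂ .K))
  | E_F : URel q (FreeAlgebra.ι ℂ .E * FreeAlgebra.ι ℂ .F
        - FreeAlgebra.ι ℂ .F * FreeAlgebra.ι ℂ .E)
      (q.lam⁻¹ • (FreeAlgebra.ι ℂ .K ^ 2 - FreeAlgebra.ι ℂ .Kinv ^ 2))

/-- The algebra `U_q(su_{1,1})`, i.e. `U_q(sl_2)` with the real form given below. -/
def Uq (q : Param) : Type := RingQuot (URel q)

namespace Uq

variable {q : Param}

noncomputable instance : Ring (Uq q) := inferInstanceAs (Ring (RingQuot (URel q)))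
noncomputable instance : Algebra ℂ (Uq q) := inferInstanceAs (Algebra ℂ (RingQuot (URel q)))

/-- The image of a generator. -/
noncomputable def gen (g : UGen) : Uq q := RingQuot.mkAlgHom ℂ (URel q) (FreeAlgebra.ι ℂ g)

noncomputable def E : Uq q := gen .E
noncomputable def F : Uq q := gen .F
noncomputable def K : Uq q := gen .K
noncomputable def Kinv : Uq q := gen .Kinv

theorem mkHom_rel {x y : FreeAlgebra ℂ UGen} (h : URel q x y) :
    RingQuot.mkAlgHom ℂ (URel q) x = RingQuot.mkAlgHom ℂ (URel q) y :=
  RingQuot.mkAlgHom_rel ℂ h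

theorem K_Kinv : (K : Uq q) * Kinv = 1 := by
  have h := mkHom_rel (URel.K_Kinv (q := q))
  rw [map_mul, map_one] at h; exact h
theorem Kinv_K : (Kinv : Uq q) * K = 1 := by
  have h := mkHom_rel (URel.Kinv_K (q := q))
  rw [map_mul, map_one] at h; exact h
theorem K_E : (K : Uq q) * E = q.c • (E * K) := by
  have h := mkHom_rel (URel.K_E (q := q))
  rw [map_mul, map_smul, map_mul] at h; exact h
theorem K_F : (K : Uq q) * F = q.c⁻¹ • (F * K) := by
  have h := mkHom_rel (URel.K_F (q := q))
  rw [map_mul, map_smul, map_mul] at h; exact h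
theorem E_F : (E : Uq q) * F - F * E = q.lam⁻¹ • (K ^ 2 - Kinv ^ 2) := by
  have h := mkHom_rel (URel.E_F (q := q))
  rw [map_sub, map_mul, map_mul, map_smul, map_sub, map_pow, map_pow] at h; exact h

/-- Values on the generators. -/
def UGen.elim {B : Type} (e f k k' : B) : UGen → B
  | .E => e
  | .F => f
  | .K => k
  | .Kinv => k'

/-- The algebra homomorphism out of `U_q(su_{1,1})` with prescribed values on generators. -/
noncomputable def lift {B : Type} [Ring B] [Algebra ℂ B] (e f k k' : B)
    (h1 : k * k' = 1) (h2 : k' * k = 1) (h3 : k * e = q.c • (e * k))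
    (h4 : k * f = q.c⁻¹ • (f * k)) (h5 : e * f - f * e = q.lam⁻¹ • (k ^ 2 - k' ^ 2)) :
    Uq q →ₐ[ℂ] B :=
  RingQuot.liftAlgHom ℂ ⟨FreeAlgebra.lift ℂ (UGen.elim e f k k'), by
    intro x y h
    cases h <;> simp only [map_mul, map_smul, map_sub, map_pow, map_one, FreeAlgebra.lift_ι_apply,
      UGen.elim] <;> assumption⟩

section lift
variable {B : Type} [Ring B] [Algebra ℂ B] (e f k k' : B)
    (h1 : k * k' = 1) (h2 : k' * k = 1) (h3 : k * e = q.c • (e * k))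
    (h4 : k * f = q.c⁻¹ • (f * k)) (h5 : e * f - f * e = q.lam⁻¹ • (k ^ 2 - k' ^ 2))

theorem lift_gen (g : UGen) : lift e f k k' h1 h2 h3 h4 h5 (gen g) = UGen.elim e f k k' g := by
  unfold lift gen
  exact (RingQuot.liftAlgHom_mkAlgHom_apply ℂ _ _ _).trans (FreeAlgebra.lift_ι_apply _ _)
@[simp] theorem lift_E : lift e f k k' h1 h2 h3 h4 h5 E = e := lift_gen ..
@[simp] theorem lift_F : lift e f k k' h1 h2 h3 h4 h5 F = f := lift_gen ..
@[simp] theorem lift_K : lift e f k k' h1 h2 h3 h4 h5 K = k := lift_gen ..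
@[simp] theorem lift_Kinv : lift e f k k' h1 h2 h3 h4 h5 Kinv = k' := lift_gen ..
end lift

theorem induction {P : Uq q → Prop} (h0 : ∀ r : ℂ, P (algebraMap ℂ _ r)) (hE : P E) (hF : P F)
    (hK : P K) (hK' : P Kinv) (hmul : ∀ a b, P a → P b → P (a * b))
    (hadd : ∀ a b, P a → P b → P (a + b)) (x : Uq q) : P x := by
  obtain ⟨x, rfl⟩ := RingQuot.mkAlgHom_surjective ℂ (URel q) x
  refine FreeAlgebra.induction ℂ UGen (motive := fun x => P (RingQuot.mkAlgHom ℂ (URel q) x))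
    ?_ ?_ ?_ ?_ x
  · intro r
    rw [AlgHom.commutes]; exact h0 r
  · rintro (_ | _ | _ | _) <;> assumption
  · intro a b ha hb; rw [map_mul]; exact hmul _ _ ha hb
  · intro a b ha hb; rw [map_add]; exact hadd _ _ ha hb

theorem hom_ext {B : Type} [Ring B] [Algebra ℂ B] {φ ψ : Uq q →ₐ[ℂ] B} (hE : φ E = ψ E)
    (hF : φ F = ψ F) (hK : φ K = ψ K) (hK' : φ Kinv = ψ Kinv) : φ = ψ := by
  ext x
  refine induction (P := fun x => φ x = ψ x) ?_ hE hF hK hK' ?_ ?_ x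
  · intro r; rw [AlgHom.commutes, AlgHom.commutes]
  · intro a b ha hb; rw [map_mul, map_mul, ha, hb]
  · intro a b ha hb; rw [map_add, map_add, ha, hb]

theorem E_K : (E : Uq q) * K = q.c⁻¹ • (K * E) := by
  rw [K_E, smul_smul, inv_mul_cancel₀ q.c_ne, one_smul]
theorem F_K : (F : Uq q) * K = q.c • (K * F) := by
  rw [K_F, smul_smul, mul_inv_cancel₀ q.c_ne, one_smul]
theorem E_Kinv : (E : Uq q) * Kinv = q.c • (Kinv * E) := by
  calc (E : Uq q) * Kinv = Kinv * (K * E) * Kinv := by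
        rw [← mul_assoc, Kinv_K, one_mul]
    _ = _ := by
        rw [K_E, mul_smul_comm, smul_mul_assoc, mul_assoc, mul_assoc, K_Kinv, mul_one]
theorem F_Kinv : (F : Uq q) * Kinv = q.c⁻¹ • (Kinv * F) := by
  calc (F : Uq q) * Kinv = Kinv * (K * F) * Kinv := by
        rw [← mul_assoc, Kinv_K, one_mul]
    _ = _ := by
        rw [K_F, mul_smul_comm, smul_mul_assoc, mul_assoc, mul_assoc, K_Kinv, mul_one]

/-- The comultiplication: `Δ(K) = K ⊗ K`, `Δ(E) = E ⊗ K + K⁻¹ ⊗ E`, `Δ(F) = F ⊗ K + K⁻¹ ⊗ F`. -/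
noncomputable def comul : Uq q →ₐ[ℂ] Uq q ⊗[ℂ] Uq q :=
  lift (E ⊗ₜ K + Kinv ⊗ₜ E) (F ⊗ₜ K + Kinv ⊗ₜ F) (K ⊗ₜ K) (Kinv ⊗ₜ Kinv)
    (by rw [Algebra.TensorProduct.tmul_mul_tmul, K_Kinv, Algebra.TensorProduct.one_def])
    (by rw [Algebra.TensorProduct.tmul_mul_tmul, Kinv_K, Algebra.TensorProduct.one_def])
    (by simp only [mul_add, add_mul, Algebra.TensorProduct.tmul_mul_tmul, K_E, K_Kinv, Kinv_K,
          TensorProduct.tmul_smul, TensorProduct.smul_tmul', smul_add])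
    (by simp only [mul_add, add_mul, Algebra.TensorProduct.tmul_mul_tmul, K_F, K_Kinv, Kinv_K,
          TensorProduct.tmul_smul, TensorProduct.smul_tmul', smul_add])
    (by
      have h : ((E : Uq q) * F - F * E) ⊗ₜ[ℂ] ((K : Uq q) * K)
          + ((Kinv : Uq q) * Kinv) ⊗ₜ[ℂ] ((E : Uq q) * F - F * E)
          = q.lam⁻¹ • ((K * K) ⊗ₜ (K * K) - (Kinv * Kinv) ⊗ₜ (Kinv * Kinv)) := by
        rw [E_F]
        simp only [TensorProduct.tmul_smul, ← TensorProduct.smul_tmul', pow_two,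
          TensorProduct.sub_tmul, TensorProduct.tmul_sub, smul_sub]
        abel
      simp only [TensorProduct.sub_tmul, TensorProduct.tmul_sub] at h
      simp only [pow_two, Algebra.TensorProduct.tmul_mul_tmul]
      rw [← h]
      simp only [mul_add, add_mul, Algebra.TensorProduct.tmul_mul_tmul, K_F, K_E, E_Kinv, F_Kinv,
        TensorProduct.tmul_smul, ← TensorProduct.smul_tmul', smul_smul, mul_inv_cancel₀ q.c_ne,
        inv_mul_cancel₀ q.c_ne, one_smul]
      abel)

/-- The counit: `ε(K) = 1`, `ε(E) = ε(F) = 0`. -/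
noncomputable def counit : Uq q →ₐ[ℂ] ℂ :=
  lift 0 0 1 1 (by simp) (by simp) (by simp) (by simp) (by simp)

/-- The antipode, as a homomorphism to the opposite algebra:
`S(K) = K⁻¹`, `S(E) = -qE`, `S(F) = -q⁻¹F`. -/
noncomputable def antipodeHom : Uq q →ₐ[ℂ] (Uq q)ᵐᵒᵖ :=
  lift (MulOpposite.op (-(q.c • E))) (MulOpposite.op (-(q.c⁻¹ • F))) (MulOpposite.op Kinv)
    (MulOpposite.op K)
    (by rw [← MulOpposite.op_mul, K_Kinv, MulOpposite.op_one])
    (by rw [← MulOpposite.op_mul, Kinv_K, MulOpposite.op_one])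
    (by simp only [← MulOpposite.op_mul, ← MulOpposite.op_smul, neg_mul, mul_neg, smul_mul_assoc,
          mul_smul_comm, E_Kinv, smul_neg, smul_smul])
    (by simp only [← MulOpposite.op_mul, ← MulOpposite.op_smul, neg_mul, mul_neg, smul_mul_assoc,
          mul_smul_comm, F_Kinv, smul_neg, smul_smul])
    (by
      simp only [← MulOpposite.op_mul, ← MulOpposite.op_smul, ← MulOpposite.op_pow,
        ← MulOpposite.op_sub, neg_mul, mul_neg, smul_mul_assoc,
          mul_smul_comm, smul_neg, smul_smul, neg_neg, mul_inv_cancel₀ q.c_ne,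
        inv_mul_cancel₀ q.c_ne, one_smul]
      congr 1
      rw [← neg_sub, E_F, ← smul_neg, neg_sub])

/-- The inverse of the antipode, as a homomorphism to the opposite algebra. -/
noncomputable def antipodeInvHom : Uq q →ₐ[ℂ] (Uq q)ᵐᵒᵖ :=
  lift (MulOpposite.op (-(q.c⁻¹ • E))) (MulOpposite.op (-(q.c • F))) (MulOpposite.op Kinv)
    (MulOpposite.op K)
    (by rw [← MulOpposite.op_mul, K_Kinv, MulOpposite.op_one])
    (by rw [← MulOpposite.op_mul, Kinv_K, MulOpposite.op_one])
    (by simp only [← MulOpposite.op_mul, ← MulOpposite.op_smul, neg_mul, mul_neg, smul_mul_assoc,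
          mul_smul_comm, E_Kinv, smul_neg, smul_smul, mul_comm])
    (by simp only [← MulOpposite.op_mul, ← MulOpposite.op_smul, neg_mul, mul_neg, smul_mul_assoc,
          mul_smul_comm, F_Kinv, smul_neg, smul_smul, mul_comm])
    (by
      simp only [← MulOpposite.op_mul, ← MulOpposite.op_smul, ← MulOpposite.op_pow,
        ← MulOpposite.op_sub, neg_mul, mul_neg, smul_mul_assoc,
          mul_smul_comm, smul_neg, smul_smul, neg_neg, mul_inv_cancel₀ q.c_ne,
        inv_mul_cancel₀ q.c_ne, one_smul]
      congr 1
      rw [← neg_sub, E_F, ← smul_neg, neg_sub])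

/-- The antipode `S`. -/
noncomputable def antipode (f : Uq q) : Uq q := MulOpposite.unop (antipodeHom f)

/-- The inverse `S⁻¹` of the antipode. -/
noncomputable def antipodeInv (f : Uq q) : Uq q := MulOpposite.unop (antipodeInvHom f)

theorem antipode_antipodeInv (f : Uq q) : antipode (antipodeInv f) = f := by
  refine induction (P := fun f => antipode (antipodeInv f) = f) ?_ ?_ ?_ ?_ ?_ ?_ ?_ f
  · intro r; simp [antipode, antipodeInv]
  · simp [antipode, antipodeInv, antipodeHom, antipodeInvHom, smul_smul, q.c_ne]
  · simp [antipode, antipodeInv, antipodeHom, antipodeInvHom, smul_smul, q.c_ne]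
  · simp [antipode, antipodeInv, antipodeHom, antipodeInvHom]
  · simp [antipode, antipodeInv, antipodeHom, antipodeInvHom]
  · intro a b ha hb
    simp only [antipode, antipodeInv, map_mul, MulOpposite.unop_mul] at *
    rw [ha, hb]
  · intro a b ha hb
    simp only [antipode, antipodeInv, map_add, MulOpposite.unop_add] at *
    rw [ha, hb]

theorem antipodeInv_antipode (f : Uq q) : antipodeInv (antipode f) = f := by
  refine induction (P := fun f => antipodeInv (antipode f) = f) ?_ ?_ ?_ ?_ ?_ ?_ ?_ f
  · intro r; simp [antipode, antipodeInv]
  · simp [antipode, antipodeInv, antipodeHom, antipodeInvHom, smul_smul, q.c_ne]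
  · simp [antipode, antipodeInv, antipodeHom, antipodeInvHom, smul_smul, q.c_ne]
  · simp [antipode, antipodeInv, antipodeHom, antipodeInvHom]
  · simp [antipode, antipodeInv, antipodeHom, antipodeInvHom]
  · intro a b ha hb
    simp only [antipode, antipodeInv, map_mul, MulOpposite.unop_mul] at *
    rw [ha, hb]
  · intro a b ha hb
    simp only [antipode, antipodeInv, map_add, MulOpposite.unop_add] at *
    rw [ha, hb]

/-- The involution: `E* = -F`, `F* = -E`, `K* = K`. -/
noncomputable def starHom : Uq q →ₐ[ℂ] ConjOp (Uq q) :=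
  lift (ConjOp.op (-F)) (ConjOp.op (-E)) (ConjOp.op K) (ConjOp.op Kinv)
    (by ext; simp [Kinv_K])
    (by ext; simp [K_Kinv])
    (by ext; simp [F_K, q.conj_c])
    (by ext; simp [E_K, q.conj_c])
    (by ext; simp [E_F, q.conj_lam])

theorem starHom_invol (f : Uq q) : ConjOp.unop (starHom (ConjOp.unop (starHom f))) = f := by
  refine induction (P := fun f => ConjOp.unop (starHom (ConjOp.unop (starHom f))) = f)
    ?_ ?_ ?_ ?_ ?_ ?_ ?_ f
  · intro r; simp
  · simp [starHom]
  · simp [starHom]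
  · simp [starHom]
  · simp [starHom]
  · intro a b ha hb; simp [ha, hb]
  · intro a b ha hb; simp [ha, hb]

noncomputable instance : StarRing (Uq q) := ConjOp.starRing starHom starHom_invol

theorem star_def (f : Uq q) : star f = ConjOp.unop (starHom f) := rfl

instance : StarModule ℂ (Uq q) where
  star_smul r a := by simp [star_def]

end Uq

end QDisc

namespace QDisc

/-! ### The right action of `U_q(su_{1,1})` -/

/-- The data from which the right action of `U_q(su_{1,1})` on an algebra `A` containing the
generators `z`, `zs = z*` of the quantum disc is built: the automorphism `k = (· ◁ K)` and its
inverse, with `z ◁ K^{±1} = q^{∓1} z`, `z* ◁ K^{±1} = q^{±1} z*`, `z* z - q² z z* = 1 - q²`. -/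
structure DiscDatum (q : Param) (A : Type) [Ring A] [Algebra ℂ A] where
  k : A →ₐ[ℂ] A
  kinv : A →ₐ[ℂ] A
  k_kinv : ∀ x, k (kinv x) = x
  kinv_k : ∀ x, kinv (k x) = x
  z : A
  zs : A
  k_z : k z = q.c⁻¹ • z
  k_zs : k zs = q.c • zs
  rel : zs * z - q.c ^ 2 • (z * zs) = (1 - q.c ^ 2) • (1 : A)

namespace DiscDatum

variable {q : Param} {A : Type} [Ring A] [Algebra ℂ A] (D : DiscDatum q A)

theorem kinv_z : D.kinv D.z = q.c • D.z := by
  have h := congrArg D.kinv D.k_z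
  rw [D.kinv_k, map_smul] at h
  rw [h, smul_smul, mul_inv_cancel₀ q.c_ne, one_smul, ← h]

theorem kinv_zs : D.kinv D.zs = q.c⁻¹ • D.zs := by
  have h := congrArg D.kinv D.k_zs
  rw [D.kinv_k, map_smul] at h
  rw [h, smul_smul, inv_mul_cancel₀ q.c_ne, one_smul, ← h]

/-- `x ◁ E = q^{1/2} λ⁻¹ (z (x ◁ K) - (x ◁ K⁻¹) z)`. -/
noncomputable def opE : Module.End ℂ A :=
  (q.sqrt * q.lam⁻¹) • (LinearMap.mulLeft ℂ D.z ∘ₗ D.k.toLinearMap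
    - LinearMap.mulRight ℂ D.z ∘ₗ D.kinv.toLinearMap)

/-- `x ◁ F = q^{-1/2} λ⁻¹ ((x ◁ K⁻¹) z* - z* (x ◁ K))`. -/
noncomputable def opF : Module.End ℂ A :=
  (q.sqrt⁻¹ * q.lam⁻¹) • (LinearMap.mulRight ℂ D.zs ∘ₗ D.kinv.toLinearMap
    - LinearMap.mulLeft ℂ D.zs ∘ₗ D.k.toLinearMap)

theorem opE_apply (x : A) :
    D.opE x = (q.sqrt * q.lam⁻¹) • (D.z * D.k x - D.kinv x * D.z) := rfl

theorem opF_apply (x : A) :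
    D.opF x = (q.sqrt⁻¹ * q.lam⁻¹) • (D.kinv x * D.zs - D.zs * D.k x) := rfl

theorem opF_opE_sub (x : A) :
    D.opF (D.opE x) - D.opE (D.opF x) = q.lam⁻¹ • (D.k (D.k x) - D.kinv (D.kinv x)) := by
  have hs : q.sqrt * q.sqrt⁻¹ = 1 := mul_inv_cancel₀ q.sqrt_ne
  have hq := q.c_ne
  have hrel : D.zs * D.z = q.c ^ 2 • (D.z * D.zs) + (1 - q.c ^ 2) • (1 : A) := by
    rw [← D.rel]; abel
  have key : (D.kinv (D.z * D.k x - D.kinv x * D.z) * D.zs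
        - D.zs * D.k (D.z * D.k x - D.kinv x * D.z))
      - (D.z * D.k (D.kinv x * D.zs - D.zs * D.k x)
        - D.kinv (D.kinv x * D.zs - D.zs * D.k x) * D.z)
      = q.lam • (D.k (D.k x) - D.kinv (D.kinv x)) := by
    simp only [map_sub, map_mul, D.k_kinv, D.kinv_k, D.k_z, D.k_zs, D.kinv_z, D.kinv_zs]
    have e1 : D.zs * (q.c⁻¹ • D.z * D.k (D.k x)) = q.c⁻¹ • ((D.zs * D.z) * D.k (D.k x)) := by
      simp only [smul_mul_assoc, mul_smul_comm, mul_assoc]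
    have e2 : D.kinv (D.kinv x) * (q.c⁻¹ • D.zs) * D.z
        = q.c⁻¹ • (D.kinv (D.kinv x) * (D.zs * D.z)) := by
      simp only [smul_mul_assoc, mul_smul_comm, mul_assoc]
    simp only [sub_mul, mul_sub, e1, e2]
    rw [hrel]
    simp only [smul_mul_assoc, mul_smul_comm, add_mul, mul_add, one_mul, mul_one, mul_assoc,
      smul_add, smul_sub, smul_smul]
    have e3 : q.c⁻¹ * q.c ^ 2 = q.c := by field_simp
    have e4 : q.c⁻¹ * (1 - q.c ^ 2) = - q.lam := by unfold Param.lam; field_simp; ring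
    rw [e3, e4]
    simp only [neg_smul]
    abel
  have h1 : D.opF (D.opE x) = q.lam⁻¹ • q.lam⁻¹ • (D.kinv (D.z * D.k x - D.kinv x * D.z) * D.zs
        - D.zs * D.k (D.z * D.k x - D.kinv x * D.z)) := by
    rw [D.opF_apply, D.opE_apply, map_smul, map_smul, smul_mul_assoc, mul_smul_comm, ← smul_sub,
      smul_smul, smul_smul]
    congr 1
    calc _ = (q.sqrt * q.sqrt⁻¹) * (q.lam⁻¹ * q.lam⁻¹) := by ring
      _ = _ := by rw [hs, one_mul]
  have h2 : D.opE (D.opF x) = q.lam⁻¹ • q.lam⁻¹ • (D.z * D.k (D.kinv x * D.zs - D.zs * D.k x)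
        - D.kinv (D.kinv x * D.zs - D.zs * D.k x) * D.z) := by
    rw [D.opE_apply, D.opF_apply, map_smul, map_smul, smul_mul_assoc, mul_smul_comm, ← smul_sub,
      smul_smul, smul_smul]
    congr 1
    calc _ = (q.sqrt * q.sqrt⁻¹) * (q.lam⁻¹ * q.lam⁻¹) := by ring
      _ = _ := by rw [hs, one_mul]
  rw [h1, h2, ← smul_sub, ← smul_sub, key, smul_smul (q.lam⁻¹) q.lam,
    inv_mul_cancel₀ q.lam_ne, one_smul]

/-- The right action as an algebra homomorphism `f ↦ (x ↦ x ◁ f)` to the opposite of the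
endomorphism algebra. -/
noncomputable def actHom : Uq q →ₐ[ℂ] (Module.End ℂ A)ᵐᵒᵖ :=
  Uq.lift (MulOpposite.op D.opE) (MulOpposite.op D.opF) (MulOpposite.op D.k.toLinearMap)
    (MulOpposite.op D.kinv.toLinearMap)
    (by rw [← MulOpposite.op_mul, ← MulOpposite.op_one]
        congr 1; ext x; exact D.kinv_k x)
    (by rw [← MulOpposite.op_mul, ← MulOpposite.op_one]
        congr 1; ext x; exact D.k_kinv x)
    (by rw [← MulOpposite.op_mul, ← MulOpposite.op_mul, ← MulOpposite.op_smul]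
        congr 1; ext x
        show D.opE (D.k x) = q.c • D.k (D.opE x)
        rw [D.opE_apply, D.opE_apply, map_smul, smul_comm, map_sub, map_mul, map_mul, D.k_z,
          D.kinv_k, D.k_kinv, smul_mul_assoc, mul_smul_comm, ← smul_sub,
          smul_smul (q.c) (q.c⁻¹), mul_inv_cancel₀ q.c_ne, one_smul])
    (by rw [← MulOpposite.op_mul, ← MulOpposite.op_mul, ← MulOpposite.op_smul]
        congr 1; ext x
        show D.opF (D.k x) = q.c⁻¹ • D.k (D.opF x)
        rw [D.opF_apply, D.opF_apply, map_smul, smul_comm, map_sub, map_mul, map_mul, D.k_zs,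
          D.kinv_k, D.k_kinv, smul_mul_assoc, mul_smul_comm, ← smul_sub,
          smul_smul (q.c⁻¹) (q.c), inv_mul_cancel₀ q.c_ne, one_smul])
    (by simp only [← MulOpposite.op_mul, ← MulOpposite.op_smul, ← MulOpposite.op_pow,
          ← MulOpposite.op_sub]
        congr 1; ext x
        exact D.opF_opE_sub x)

/-- The right action `(x, f) ↦ x ◁ f`, linear in both variables. -/
noncomputable def act : A →ₗ[ℂ] Uq q →ₗ[ℂ] A :=
  LinearMap.flip ((MulOpposite.opLinearEquiv ℂ).symm.toLinearMap ∘ₗ D.actHom.toLinearMap)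

theorem act_apply (x : A) (f : Uq q) : D.act x f = (MulOpposite.unop (D.actHom f)) x := rfl

theorem act_mul (x : A) (f g : Uq q) : D.act x (f * g) = D.act (D.act x f) g := by
  simp only [act_apply, map_mul]; rfl

theorem act_algebraMap (x : A) (r : ℂ) : D.act x (algebraMap ℂ (Uq q) r) = r • x := by
  rw [act_apply, AlgHom.commutes]; rfl

theorem act_E (x : A) : D.act x Uq.E = D.opE x := by simp [act_apply, actHom]
theorem act_F (x : A) : D.act x Uq.F = D.opF x := by simp [act_apply, actHom]
theorem act_K (x : A) : D.act x Uq.K = D.k x := by simp [act_apply, actHom]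
theorem act_Kinv (x : A) : D.act x Uq.Kinv = D.kinv x := by simp [act_apply, actHom]

/-- A subspace stable under multiplication by `z`, `z*` from both sides and under `K^{±1}` is
stable under the action of `U_q(su_{1,1})`. -/
theorem act_mem (S : Submodule ℂ A) (h1 : ∀ x ∈ S, D.z * x ∈ S) (h2 : ∀ x ∈ S, x * D.z ∈ S)
    (h3 : ∀ x ∈ S, D.zs * x ∈ S) (h4 : ∀ x ∈ S, x * D.zs ∈ S) (h5 : ∀ x ∈ S, D.k x ∈ S)
    (h6 : ∀ x ∈ S, D.kinv x ∈ S) (f : Uq q) : ∀ x ∈ S, D.act x f ∈ S := by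
  refine Uq.induction (P := fun f => ∀ x ∈ S, D.act x f ∈ S) ?_ ?_ ?_ ?_ ?_ ?_ ?_ f
  · intro r x hx; rw [act_algebraMap]; exact S.smul_mem _ hx
  · intro x hx; rw [act_E, opE_apply]
    exact S.smul_mem _ (S.sub_mem (h1 _ (h5 _ hx)) (h2 _ (h6 _ hx)))
  · intro x hx; rw [act_F, opF_apply]
    exact S.smul_mem _ (S.sub_mem (h4 _ (h6 _ hx)) (h3 _ (h5 _ hx)))
  · intro x hx; rw [act_K]; exact h5 _ hx
  · intro x hx; rw [act_Kinv]; exact h6 _ hx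
  · intro a b ha hb x hx; rw [act_mul]; exact hb _ (ha _ hx)
  · intro a b ha hb x hx; rw [map_add]; exact S.add_mem (ha _ hx) (hb _ hx)

end DiscDatum

/-! ### The quantum disc algebra `O(U_q)` -/

/-- Generators of the quantum disc algebra. -/
inductive DGen : Type
  | z | zs

/-- The defining relation `z* z - q² z z* = 1 - q²` of the quantum disc algebra. -/
inductive DRel (q : Param) : FreeAlgebra ℂ DGen → FreeAlgebra ℂ DGen → Prop
  | rel : DRel q (FreeAlgebra.ι ℂ .zs * FreeAlgebra.ι ℂ .z
      - q.c ^ 2 • (FreeAlgebra.ι ℂ .z * FreeAlgebra.ι ℂ .zs)) ((1 - q.c ^ 2) • 1)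

/-- The quantum disc algebra `O(U_q)`. -/
def Disc (q : Param) : Type := RingQuot (DRel q)

namespace Disc

variable {q : Param}

noncomputable instance : Ring (Disc q) := inferInstanceAs (Ring (RingQuot (DRel q)))
noncomputable instance : Algebra ℂ (Disc q) := inferInstanceAs (Algebra ℂ (RingQuot (DRel q)))

noncomputable def z : Disc q := RingQuot.mkAlgHom ℂ (DRel q) (FreeAlgebra.ι ℂ .z)
noncomputable def zs : Disc q := RingQuot.mkAlgHom ℂ (DRel q) (FreeAlgebra.ι ℂ .zs)

theorem rel : (zs : Disc q) * z - q.c ^ 2 • (z * zs) = (1 - q.c ^ 2) • 1 := by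
  have h := RingQuot.mkAlgHom_rel ℂ (DRel.rel (q := q))
  rw [map_sub, map_smul, map_smul, map_mul, map_mul, map_one] at h; exact h

/-- Values on the generators. -/
def DGen.elim {B : Type} (a b : B) : DGen → B
  | .z => a
  | .zs => b

/-- The algebra homomorphism out of `O(U_q)` with prescribed values on `z`, `z*`. -/
noncomputable def lift {B : Type} [Ring B] [Algebra ℂ B] (a b : B)
    (h : b * a - q.c ^ 2 • (a * b) = (1 - q.c ^ 2) • (1 : B)) : Disc q →ₐ[ℂ] B :=
  RingQuot.liftAlgHom ℂ ⟨FreeAlgebra.lift ℂ (DGen.elim a b), by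
    intro x y hxy
    cases hxy
    simp only [map_mul, map_smul, map_sub, map_one, FreeAlgebra.lift_ι_apply, DGen.elim]
    exact h⟩

section lift
variable {B : Type} [Ring B] [Algebra ℂ B] (a b : B)
    (h : b * a - q.c ^ 2 • (a * b) = (1 - q.c ^ 2) • (1 : B))
@[simp] theorem lift_z : lift a b h (z : Disc q) = a := by
  unfold lift z
  exact (RingQuot.liftAlgHom_mkAlgHom_apply ℂ _ _ _).trans (FreeAlgebra.lift_ι_apply _ _)
@[simp] theorem lift_zs : lift a b h (zs : Disc q) = b := by
  unfold lift zs
  exact (RingQuot.liftAlgHom_mkAlgHom_apply ℂ _ _ _).trans (FreeAlgebra.lift_ι_apply _ _)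
end lift

theorem induction {P : Disc q → Prop} (h0 : ∀ r : ℂ, P (algebraMap ℂ _ r)) (hz : P z)
    (hzs : P zs) (hmul : ∀ a b, P a → P b → P (a * b))
    (hadd : ∀ a b, P a → P b → P (a + b)) (x : Disc q) : P x := by
  obtain ⟨x, rfl⟩ := RingQuot.mkAlgHom_surjective ℂ (DRel q) x
  refine FreeAlgebra.induction ℂ DGen (motive := fun x => P (RingQuot.mkAlgHom ℂ (DRel q) x))
    ?_ ?_ ?_ ?_ x
  · intro r
    rw [AlgHom.commutes]; exact h0 r
  · rintro (_ | _) <;> assumption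
  · intro a b ha hb; rw [map_mul]; exact hmul _ _ ha hb
  · intro a b ha hb; rw [map_add]; exact hadd _ _ ha hb

/-- The involution exchanging `z` and `z*`. -/
noncomputable def starHom : Disc q →ₐ[ℂ] ConjOp (Disc q) :=
  lift (ConjOp.op zs) (ConjOp.op z) (by ext; simpa [q.conj_c] using rel)

theorem starHom_invol (x : Disc q) : ConjOp.unop (starHom (ConjOp.unop (starHom x))) = x := by
  refine induction (P := fun x => ConjOp.unop (starHom (ConjOp.unop (starHom x))) = x)
    ?_ ?_ ?_ ?_ ?_ x
  · intro r; simp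
  · simp [starHom]
  · simp [starHom]
  · intro a b ha hb; simp [ha, hb]
  · intro a b ha hb; simp [ha, hb]

noncomputable instance : StarRing (Disc q) := ConjOp.starRing starHom starHom_invol

theorem star_def (x : Disc q) : star x = ConjOp.unop (starHom x) := rfl

theorem star_z : star (z : Disc q) = zs := by simp [star_def, starHom]

instance : StarModule ℂ (Disc q) where
  star_smul r a := by simp [star_def]

theorem scale_rel (c : ℂ) (hc : c ≠ 0) : (c • (zs : Disc q)) * (c⁻¹ • z)
    - q.c ^ 2 • ((c⁻¹ • z) * (c • zs)) = (1 - q.c ^ 2) • 1 := by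
  simpa [smul_smul, hc] using rel

/-- The automorphism `z ↦ c⁻¹ z`, `z* ↦ c z*`. -/
noncomputable def scaleHom (c : ℂ) (hc : c ≠ 0) : Disc q →ₐ[ℂ] Disc q :=
  lift (c⁻¹ • z) (c • zs) (scale_rel c hc)

theorem scaleHom_comp (c d : ℂ) (hc : c ≠ 0) (hd : d ≠ 0) (h : c * d = 1) (x : Disc q) :
    scaleHom c hc (scaleHom d hd x) = x := by
  have hd' : d = c⁻¹ := eq_inv_of_mul_eq_one_right h
  subst hd'
  refine induction (P := fun x => scaleHom c hc (scaleHom c⁻¹ hd x) = x) ?_ ?_ ?_ ?_ ?_ x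
  · intro r; simp
  · simp [scaleHom, smul_smul, hc]
  · simp [scaleHom, smul_smul, hc]
  · intro a b ha hb; simp [ha, hb]
  · intro a b ha hb; simp [ha, hb]

/-- The data of the right action of `U_q(su_{1,1})` on `O(U_q)`. -/
noncomputable def datum : DiscDatum q (Disc q) where
  k := scaleHom q.c q.c_ne
  kinv := scaleHom q.c⁻¹ (inv_ne_zero q.c_ne)
  k_kinv := scaleHom_comp _ _ _ _ (mul_inv_cancel₀ q.c_ne)
  kinv_k := scaleHom_comp _ _ _ _ (inv_mul_cancel₀ q.c_ne)
  z := z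
  zs := zs
  k_z := by simp [scaleHom]
  k_zs := by simp [scaleHom]
  rel := rel

/-- The right action `x ◁ f` of `U_q(su_{1,1})` on `O(U_q)`. -/
noncomputable def act : Disc q →ₗ[ℂ] Uq q →ₗ[ℂ] Disc q := datum.act

theorem z_act_K : act (z : Disc q) Uq.K = q.c⁻¹ • z := datum.act_K z |>.trans datum.k_z
theorem zs_act_K : act (zs : Disc q) Uq.K = q.c • zs := datum.act_K zs |>.trans datum.k_zs

theorem z_act_E : act (z : Disc q) Uq.E = -(q.sqrt • z ^ 2) := by
  have h : q.sqrt * q.lam⁻¹ * (q.c⁻¹ - q.c) = -q.sqrt := by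
    have h1 : q.c⁻¹ - q.c = -q.lam := by unfold Param.lam; ring
    rw [h1, mul_neg, mul_assoc, inv_mul_cancel₀ q.lam_ne, mul_one]
  refine (datum.act_E z).trans ?_
  rw [DiscDatum.opE_apply]
  show (q.sqrt * q.lam⁻¹) • (z * datum.k datum.z - datum.kinv datum.z * z) = _
  rw [datum.k_z, datum.kinv_z]
  show (q.sqrt * q.lam⁻¹) • (z * (q.c⁻¹ • z) - (q.c • z) * z) = _
  rw [mul_smul_comm, smul_mul_assoc, ← sub_smul, smul_smul, h, neg_smul, pow_two]

theorem z_act_F : act (z : Disc q) Uq.F = q.sqrt⁻¹ • 1 := by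
  have h : q.sqrt⁻¹ * q.lam⁻¹ * (-q.c⁻¹ * (1 - q.c ^ 2)) = q.sqrt⁻¹ := by
    have h1 : -q.c⁻¹ * (1 - q.c ^ 2) = q.lam := by
      have := q.c_ne
      unfold Param.lam; field_simp; ring
    rw [h1, mul_assoc, inv_mul_cancel₀ q.lam_ne, mul_one]
  refine (datum.act_F z).trans ?_
  rw [DiscDatum.opF_apply]
  show (q.sqrt⁻¹ * q.lam⁻¹) • (datum.kinv datum.z * zs - zs * datum.k datum.z) = _
  rw [datum.k_z, datum.kinv_z]
  show (q.sqrt⁻¹ * q.lam⁻¹) • ((q.c • z) * zs - zs * (q.c⁻¹ • z)) = _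
  have h2 : (q.c • (z : Disc q)) * zs - zs * (q.c⁻¹ • z)
      = (-q.c⁻¹) • (zs * z - q.c ^ 2 • (z * zs)) := by
    rw [smul_sub, smul_smul, mul_smul_comm, smul_mul_assoc, neg_smul]
    have : -q.c⁻¹ * q.c ^ 2 = -q.c := by have := q.c_ne; field_simp
    rw [this, neg_smul]; abel
  rw [h2, rel, smul_smul, smul_smul, mul_assoc (q.sqrt⁻¹ * q.lam⁻¹), h]

end Disc

/-! ### The cross product algebra -/

/-- The underlying linear space `U ⊗ O(U_q)` of the right cross product algebra
`U_q(su_{1,1}) ⋉ O(U_q)`. -/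
abbrev CrossSpace (q : Param) : Type := Uq q ⊗[ℂ] Disc q

namespace CrossSpace

variable {q : Param}

/-- The map `f ⊗ y ↦ g f₍₁₎ ⊗ (x ◁ f₍₂₎) y`. -/
noncomputable def mulAux (g : Uq q) (x : Disc q) : CrossSpace q →ₗ[ℂ] CrossSpace q :=
  TensorProduct.lift (LinearMap.mk₂ ℂ
    (fun f y => TensorProduct.map (LinearMap.mulLeft ℂ g)
      (LinearMap.mulRight ℂ y ∘ₗ Disc.act x) (Uq.comul f))
    (fun f f' y => by rw [map_add, map_add])
    (fun c f y => by rw [map_smul, map_smul])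
    (fun f y y' => by
      have : LinearMap.mulRight ℂ (y + y') ∘ₗ Disc.act x
          = LinearMap.mulRight ℂ y ∘ₗ Disc.act x + LinearMap.mulRight ℂ y' ∘ₗ Disc.act x := by
        ext; simp [mul_add]
      rw [this, TensorProduct.map_add_right, LinearMap.add_apply])
    (fun c f y => by
      have : LinearMap.mulRight ℂ (c • y) ∘ₗ Disc.act x
          = c • (LinearMap.mulRight ℂ y ∘ₗ Disc.act x) := by
        ext; simp
      rw [this, TensorProduct.map_smul_right, LinearMap.smul_apply]))

/-- The product of the cross product algebra:
`(g ⊗ x)(f ⊗ y) = g f₍₁₎ ⊗ (x ◁ f₍₂₎) y`. -/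
noncomputable def mul : CrossSpace q →ₗ[ℂ] CrossSpace q →ₗ[ℂ] CrossSpace q :=
  TensorProduct.lift (LinearMap.mk₂ ℂ mulAux
    (fun g g' x => by
      ext f y
      have : LinearMap.mulLeft ℂ (g + g') = LinearMap.mulLeft ℂ g + LinearMap.mulLeft ℂ g' := by
        ext; simp [add_mul]
      simp [mulAux, this, TensorProduct.map_add_left])
    (fun c g x => by
      ext f y
      have : LinearMap.mulLeft ℂ (c • g) = c • LinearMap.mulLeft ℂ g := by
        ext; simp
      simp [mulAux, this, TensorProduct.map_smul_left])
    (fun g x x' => by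
      ext f y
      simp [mulAux, LinearMap.comp_add, TensorProduct.map_add_right])
    (fun c g x => by
      ext f y
      simp [mulAux, LinearMap.comp_smul, TensorProduct.map_smul_right]))

theorem mul_tmul_tmul (g f : Uq q) (x y : Disc q) :
    mul (g ⊗ₜ x) (f ⊗ₜ y) = TensorProduct.map (LinearMap.mulLeft ℂ g)
      (LinearMap.mulRight ℂ y ∘ₗ Disc.act x) (Uq.comul f) := rfl

/-- The involution of the cross product algebra:
`(f ⊗ x)* = (f*)₍₁₎ ⊗ (x* ◁ (f*)₍₂₎)`. -/
noncomputable def conj : CrossSpace q →+ CrossSpace q :=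
  TensorProduct.liftAddHom
    (AddMonoidHom.mk' (fun f => AddMonoidHom.mk'
        (fun x => TensorProduct.map LinearMap.id (Disc.act (star x)) (Uq.comul (star f)))
        (fun x x' => by
          rw [star_add, map_add, TensorProduct.map_add_right, LinearMap.add_apply]))
      (fun f f' => by
        ext x; simp [star_add, map_add]))
    (fun r f x => by
      simp [star_smul, TensorProduct.map_smul_right])

theorem conj_tmul (f : Uq q) (x : Disc q) : conj (f ⊗ₜ x)
    = TensorProduct.map LinearMap.id (Disc.act (star x)) (Uq.comul (star f)) := rfl

end CrossSpace

end QDisc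

namespace QDisc

/-! ### The function algebra `F(U_q)` -/

/-- The punctured line `ℝ \ {0}`. -/
abbrev PLine : Type := {y : ℝ // y ≠ 0}

/-- The `*`-algebra `F(ℝ \ {0})` of locally bounded complex Borel functions: Borel functions
which are bounded on every compact subset of `ℝ \ {0}`. -/
def LBorel : StarSubalgebra ℂ (PLine → ℂ) where
  carrier := {f | Measurable f ∧ ∀ C : Set PLine, IsCompact C → ∃ M : ℝ, ∀ y ∈ C, ‖f y‖ ≤ M}
  mul_mem' := by
    rintro f g ⟨hf, hf'⟩ ⟨hg, hg'⟩
    refine ⟨hf.mul hg, fun C hC => ?_⟩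
    obtain ⟨M, hM⟩ := hf' C hC
    obtain ⟨N, hN⟩ := hg' C hC
    refine ⟨M * N, fun y hy => ?_⟩
    rw [Pi.mul_apply, norm_mul]
    exact mul_le_mul (hM y hy) (hN y hy) (norm_nonneg _) ((norm_nonneg _).trans (hM y hy))
  add_mem' := by
    rintro f g ⟨hf, hf'⟩ ⟨hg, hg'⟩
    refine ⟨hf.add hg, fun C hC => ?_⟩
    obtain ⟨M, hM⟩ := hf' C hC
    obtain ⟨N, hN⟩ := hg' C hC
    exact ⟨M + N, fun y hy => (norm_add_le _ _).trans (add_le_add (hM y hy) (hN y hy))⟩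
  algebraMap_mem' := fun c => ⟨measurable_const, fun C _ => ⟨‖c‖, fun _ _ => le_rfl⟩⟩
  star_mem' := by
    rintro f ⟨hf, hf'⟩
    refine ⟨Complex.continuous_conj.measurable.comp hf, fun C hC => ?_⟩
    obtain ⟨M, hM⟩ := hf' C hC
    exact ⟨M, fun y hy => by simpa using hM y hy⟩

section shift

variable (q : Param)

theorem scale_ne (n : ℤ) : (q : ℝ) ^ (2 * n) ≠ 0 := zpow_ne_zero _ q.pos.ne'

/-- The homeomorphism `y ↦ q^{2n} y` of `ℝ \ {0}`. -/
noncomputable def scale (n : ℤ) : PLine ≃ₜ PLine where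
  toFun y := ⟨(q : ℝ) ^ (2 * n) * y.1, mul_ne_zero (scale_ne q n) y.2⟩
  invFun y := ⟨(q : ℝ) ^ (2 * -n) * y.1, mul_ne_zero (scale_ne q _) y.2⟩
  left_inv y := by
    ext
    show (q : ℝ) ^ (2 * -n) * ((q : ℝ) ^ (2 * n) * y.1) = y.1
    rw [← mul_assoc, ← zpow_add₀ q.pos.ne']; simp
  right_inv y := by
    ext
    show (q : ℝ) ^ (2 * n) * ((q : ℝ) ^ (2 * -n) * y.1) = y.1
    rw [← mul_assoc, ← zpow_add₀ q.pos.ne']; simp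
  continuous_toFun := by fun_prop
  continuous_invFun := by fun_prop

theorem scale_coe (n : ℤ) (y : PLine) : ((scale q n y : PLine) : ℝ) = (q : ℝ) ^ (2 * n) * y := rfl

theorem scale_scale (m n : ℤ) (y : PLine) : scale q m (scale q n y) = scale q (m + n) y := by
  ext
  rw [scale_coe, scale_coe, scale_coe, ← mul_assoc, ← zpow_add₀ q.pos.ne', mul_add]

theorem scale_zero (y : PLine) : scale q 0 y = y := by
  ext; rw [scale_coe]; simp

/-- The `*`-endomorphism `f(y) ↦ f(q^{2n} y)` of the algebra of locally bounded functions. -/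
noncomputable def shift (n : ℤ) : LBorel →⋆ₐ[ℂ] LBorel where
  toFun f := ⟨fun y => f.1 (scale q n y), f.2.1.comp (scale q n).measurable, fun C hC => by
    obtain ⟨M, hM⟩ := f.2.2 _ (hC.image (scale q n).continuous)
    exact ⟨M, fun y hy => hM _ (Set.mem_image_of_mem _ hy)⟩⟩
  map_one' := rfl
  map_mul' _ _ := rfl
  map_zero' := rfl
  map_add' _ _ := rfl
  commutes' _ := rfl
  map_star' _ := rfl

theorem shift_coe (n : ℤ) (f : LBorel) (y : PLine) :
    (shift q n f : PLine → ℂ) y = (f : PLine → ℂ) (scale q n y) := rfl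

theorem LBorel.ext {f g : LBorel} (h : ∀ y, (f : PLine → ℂ) y = (g : PLine → ℂ) y) : f = g :=
  Subtype.ext (funext h)

theorem shift_shift (m n : ℤ) (f : LBorel) : shift q m (shift q n f) = shift q (m + n) f := by
  refine LBorel.ext fun y => ?_
  rw [shift_coe, shift_coe, shift_coe, scale_scale, add_comm]

theorem shift_zero (f : LBorel) : shift q 0 f = f := by
  refine LBorel.ext fun y => ?_
  rw [shift_coe, scale_zero]

/-- The coordinate function `y` on `ℝ \ {0}`. -/
noncomputable def coordY : LBorel :=
  ⟨fun y => ((y : ℝ) : ℂ), Complex.measurable_ofReal.comp measurable_subtype_coe, fun C hC => by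
    have h : Continuous fun y : PLine => ((y : ℝ) : ℂ) := by fun_prop
    exact hC.exists_bound_of_continuousOn h.continuousOn⟩

/-- The function `1 - q^{2j} y`. -/
noncomputable def lin (j : ℤ) : LBorel := 1 - (q.c ^ (2 * j)) • coordY

theorem lin_coe (j : ℤ) (y : PLine) :
    (lin q j : PLine → ℂ) y = 1 - q.c ^ (2 * j) * ((y : ℝ) : ℂ) := rfl

theorem shift_lin (n j : ℤ) : shift q n (lin q j) = lin q (j + n) := by
  refine LBorel.ext fun y => ?_
  rw [shift_coe, lin_coe, lin_coe, scale_coe, mul_add, zpow_add₀ q.c_ne]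
  simp only [Param.c]
  push_cast
  ring

theorem star_lin (j : ℤ) : star (lin q j) = lin q j := by
  refine LBorel.ext fun y => ?_
  show (starRingEnd ℂ) (1 - q.c ^ (2 * j) * ((y : ℝ) : ℂ)) = _
  rw [map_sub, map_one, map_mul, map_zpow₀, q.conj_c, Complex.conj_ofReal]; rfl

/-- The index set of the structure function of `F(U_q)`. -/
noncomputable def cocSet (m n : ℤ) : Finset ℤ :=
  if 0 ≤ m then Finset.Ico n (min 0 (m + n)) else Finset.Ico (max 0 (m + n)) n

/-- The functions `c_{m,n}(y)` with `X_m X_n = X_{m+n} c_{m,n}(y)`, where `X_n = z^n` for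
`n ≥ 0` and `X_n = (z*)^{-n}` for `n < 0`. They are the products of the factors
`z^n (z*)^n = ∏_{l=1}^n (1 - q^{-2l} y)` and `(z*)^n z^n = ∏_{l=0}^{n-1} (1 - q^{2l} y)` which
arise when `z` meets `z*`; in particular `c_{-1,1} = 1 - y` and `c_{1,-1} = 1 - q^{-2} y`. -/
noncomputable def coc (m n : ℤ) : LBorel := ∏ j ∈ cocSet m n, lin q j

theorem shift_prod (p : ℤ) (s : Finset ℤ) :
    shift q p (∏ j ∈ s, lin q j) = ∏ j ∈ s.map (addRightEmbedding p), lin q j := by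
  rw [map_prod, Finset.prod_map]
  exact Finset.prod_congr rfl fun j _ => shift_lin q p j

theorem coc_cocycle (m n p : ℤ) :
    coc q (m + n) p * shift q p (coc q m n) = coc q m (n + p) * coc q n p := by
  have key : (cocSet (m + n) p).val + ((cocSet m n).map (addRightEmbedding p)).val
      = (cocSet m (n + p)).val + (cocSet n p).val := by
    ext j
    rw [Multiset.count_add, Multiset.count_add,
      Multiset.count_eq_of_nodup (Finset.nodup _), Multiset.count_eq_of_nodup (Finset.nodup _),
      Multiset.count_eq_of_nodup (Finset.nodup _), Multiset.count_eq_of_nodup (Finset.nodup _)]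
    have hmap : j ∈ ((cocSet m n).map (addRightEmbedding p)).val ↔ j - p ∈ cocSet m n := by
      rw [Finset.mem_val, Finset.mem_map]
      constructor
      · rintro ⟨a, ha, rfl⟩; simpa using ha
      · intro h; exact ⟨j - p, h, by simp⟩
    simp only [hmap, Finset.mem_val]
    have hmem : ∀ a b i : ℤ, i ∈ cocSet a b ↔
        (0 ≤ a ∧ b ≤ i ∧ i < 0 ∧ i < a + b) ∨ (a < 0 ∧ 0 ≤ i ∧ a + b ≤ i ∧ i < b) := by
      intro a b i
      unfold cocSet
      split_ifs <;> simp only [Finset.mem_Ico] <;> omega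
    simp only [hmem]
    split_ifs <;> omega
  have h := congrArg (fun s : Multiset ℤ => (s.map (lin q)).prod) key
  simp only [Multiset.map_add, Multiset.prod_add] at h
  unfold coc
  rw [shift_prod]
  exact h

theorem coc_star (m n : ℤ) : shift q (-(m + n)) (coc q m n) = coc q (-n) (-m) := by
  unfold coc
  rw [shift_prod]
  congr 1
  ext j
  rw [Finset.mem_map]
  have : (∃ a ∈ cocSet m n, (addRightEmbedding (-(m + n))) a = j) ↔ j + (m + n) ∈ cocSet m n := by
    constructor
    · rintro ⟨a, ha, rfl⟩
      show a + -(m + n) + (m + n) ∈ _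
      rwa [neg_add_cancel_right]
    · intro h; exact ⟨j + (m + n), h, add_neg_cancel_right j (m + n)⟩
  rw [this]
  unfold cocSet
  split_ifs <;> simp only [Finset.mem_Ico] <;> omega

theorem coc_zero_left (n : ℤ) : coc q 0 n = 1 := by
  have : cocSet 0 n = ∅ := by
    unfold cocSet; rw [if_pos le_rfl, Finset.Ico_eq_empty_iff]; omega
  rw [coc, this, Finset.prod_empty]

theorem coc_zero_right (m : ℤ) : coc q m 0 = 1 := by
  have : cocSet m 0 = ∅ := by
    unfold cocSet
    split_ifs <;> rw [Finset.Ico_eq_empty_iff] <;> omega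
  rw [coc, this, Finset.prod_empty]

theorem star_coc (m n : ℤ) : star (coc q m n) = coc q m n := by
  unfold coc
  rw [← starRingEnd_apply, map_prod]
  exact Finset.prod_congr rfl fun j _ => star_lin q j

end shift

/-- The `*`-algebra `F(U_q)`, generated by `z`, `z*` and the locally bounded Borel functions
`f(y)` on `ℝ \ {0}` with relations `z* z = 1 - y`, `z* z - q² z z* = 1 - q²`,
`z f(y) = f(q^{-2} y) z`, `z* f(y) = f(q² y) z*`. Every element has a unique expansion
`∑_n X_n g_n(y)` with `X_n = z^n` for `n ≥ 0` and `X_n = (z*)^{-n}` for `n < 0`; it is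
represented by its coefficients `n ↦ g_n`. (Note `f(y) (z*)^k = (z*)^k f(q^{-2k} y)`.) -/
def FU (_q : Param) : Type := ℤ →₀ LBorel

namespace FU

variable {q : Param}

noncomputable instance : AddCommGroup (FU q) := inferInstanceAs (AddCommGroup (ℤ →₀ LBorel))
noncomputable instance : Module ℂ (FU q) := inferInstanceAs (Module ℂ (ℤ →₀ LBorel))

/-- The element `X_n f(y)`. -/
noncomputable def mono (n : ℤ) : LBorel →ₗ[ℂ] FU q := Finsupp.lsingle n

/-- The coefficient `g_n` in `x = ∑ X_n g_n(y)`. -/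
noncomputable def coeff (n : ℤ) : FU q →ₗ[ℂ] LBorel := Finsupp.lapply n

theorem coeff_mono (m n : ℤ) (f : LBorel) :
    coeff n (mono m f : FU q) = if m = n then f else 0 := by
  classical
  exact Finsupp.single_apply

theorem ext {x y : FU q} (h : ∀ n, coeff n x = coeff n y) : x = y := Finsupp.ext h

theorem induction {P : FU q → Prop} (h0 : P 0) (hadd : ∀ x y, P x → P y → P (x + y))
    (hmono : ∀ n f, P (mono n f)) (x : FU q) : P x :=
  Finsupp.induction_linear x h0 (fun _ _ => hadd _ _) hmono

/-- The product, `(X_m f(y)) (X_n g(y)) = X_{m+n} c_{m,n}(y) f(q^{2n} y) g(y)`, as a bilinear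
map. -/
noncomputable def mulLin : FU q →ₗ[ℂ] FU q →ₗ[ℂ] FU q :=
  Finsupp.lsum ℂ fun m => LinearMap.flip (Finsupp.lsum ℂ fun n => LinearMap.flip
    (LinearMap.mk₂ ℂ (fun f g => mono (m + n) (coc q m n * shift q n f * g))
      (fun f f' g => by rw [map_add, mul_add, add_mul, map_add])
      (fun c f g => by rw [map_smul, mul_smul_comm, smul_mul_assoc, map_smul])
      (fun f g g' => by rw [mul_add, map_add])
      (fun c f g => by rw [mul_smul_comm, map_smul])))

theorem mulLin_mono (m n : ℤ) (f g : LBorel) :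
    mulLin (mono m f : FU q) (mono n g) = mono (m + n) (coc q m n * shift q n f * g) := by
  refine (LinearMap.congr_fun (Finsupp.lsum_single ℂ _ m f) _).trans ?_
  exact LinearMap.congr_fun (Finsupp.lsum_single ℂ _ n g) f

noncomputable instance : Mul (FU q) := ⟨fun x y => mulLin x y⟩
noncomputable instance : One (FU q) := ⟨mono 0 1⟩

theorem mul_def (x y : FU q) : x * y = mulLin x y := rfl
theorem one_def : (1 : FU q) = mono 0 1 := rfl

theorem mono_mul_mono (m n : ℤ) (f g : LBorel) :
    (mono m f : FU q) * mono n g = mono (m + n) (coc q m n * shift q n f * g) :=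
  mulLin_mono m n f g

theorem mul_assoc' (x y w : FU q) : x * y * w = x * (y * w) := by
  refine induction (P := fun x => x * y * w = x * (y * w)) ?_ ?_ ?_ x
  · simp only [mul_def, map_zero, LinearMap.zero_apply]
  · intro a b ha hb
    simp only [mul_def, map_add, LinearMap.add_apply] at *
    rw [ha, hb]
  intro m f
  refine induction (P := fun y => mono m f * y * w = mono m f * (y * w)) ?_ ?_ ?_ y
  · simp only [mul_def, map_zero, LinearMap.zero_apply]
  · intro a b ha hb
    simp only [mul_def, map_add, LinearMap.add_apply] at *
    rw [ha, hb]
  intro n g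
  refine induction (P := fun w => mono m f * mono n g * w = mono m f * (mono n g * w)) ?_ ?_ ?_ w
  · simp only [mul_def, map_zero]
  · intro a b ha hb
    simp only [mul_def, map_add] at *
    rw [ha, hb]
  intro p k
  rw [mono_mul_mono, mono_mul_mono, mono_mul_mono, mono_mul_mono, add_assoc]
  congr 1
  rw [map_mul, map_mul, shift_shift, add_comm p n]
  calc coc q (m + n) p * (shift q p (coc q m n) * shift q (n + p) f * shift q p g) * k
      = (coc q (m + n) p * shift q p (coc q m n)) * (shift q (n + p) f * shift q p g * k) := by ring
    _ = (coc q m (n + p) * coc q n p) * (shift q (n + p) f * shift q p g * k) := by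
        rw [coc_cocycle]
    _ = _ := by ring

theorem one_mul' (x : FU q) : 1 * x = x := by
  refine induction (P := fun x => 1 * x = x) ?_ ?_ ?_ x
  · simp only [mul_def, map_zero]
  · intro a b ha hb
    simp only [mul_def, map_add] at *
    rw [ha, hb]
  intro n f
  rw [one_def, mono_mul_mono, coc_zero_left, map_one, one_mul, one_mul, zero_add]

theorem mul_one' (x : FU q) : x * 1 = x := by
  refine induction (P := fun x => x * 1 = x) ?_ ?_ ?_ x
  · simp only [mul_def, map_zero, LinearMap.zero_apply]
  · intro a b ha hb
    simp only [mul_def, map_add, LinearMap.add_apply] at *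
    rw [ha, hb]
  intro n f
  rw [one_def, mono_mul_mono, coc_zero_right, shift_zero, one_mul, mul_one, add_zero]

noncomputable instance : Ring (FU q) :=
  { (inferInstance : AddCommGroup (FU q)) with
    mul := fun x y => mulLin x y
    one := mono 0 1
    left_distrib := fun x y w => map_add (mulLin x) y w
    right_distrib := fun x y w => by
      show mulLin (x + y) w = _
      rw [map_add]; rfl
    zero_mul := fun x => by
      show mulLin 0 x = 0
      rw [map_zero]; rfl
    mul_zero := fun x => map_zero (mulLin x)
    mul_assoc := mul_assoc'
    one_mul := one_mul'
    mul_one := mul_one' }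

noncomputable instance : Algebra ℂ (FU q) :=
  Algebra.ofModule
    (fun r x y => by
      show mulLin (r • x) y = r • mulLin x y
      rw [map_smul]; rfl)
    (fun r x y => map_smul (mulLin x) r y)

/-- The involution, `(X_n f(y))* = X_{-n} \bar f(q^{-2n} y)`, as an additive map. -/
noncomputable def starAdd : FU q →+ FU q :=
  Finsupp.liftAddHom fun n =>
    (mono (-n) : LBorel →ₗ[ℂ] FU q).toAddMonoidHom.comp
      ((shift q (-n) : LBorel →⋆ₐ[ℂ] LBorel).toAlgHom.toLinearMap.toAddMonoidHom.comp
        (starAddEquiv : LBorel ≃+ LBorel).toAddMonoidHom)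

theorem starAdd_mono (n : ℤ) (f : LBorel) :
    starAdd (mono n f : FU q) = mono (-n) (shift q (-n) (star f)) := by
  unfold starAdd
  exact Finsupp.liftAddHom_apply_single _ _ _

noncomputable instance : StarRing (FU q) where
  star := starAdd
  star_involutive x := by
    refine induction (P := fun x => starAdd (starAdd x) = x) ?_ ?_ ?_ x
    · simp
    · intro a b ha hb; rw [map_add, map_add, ha, hb]
    intro n f
    rw [starAdd_mono, starAdd_mono, neg_neg, ← map_star, shift_shift, star_star, add_neg_cancel,
      shift_zero]
  star_mul x y := by
    show starAdd (x * y) = starAdd y * starAdd x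
    refine induction (P := fun x => starAdd (x * y) = starAdd y * starAdd x) ?_ ?_ ?_ x
    · simp
    · intro a b ha hb; rw [add_mul, map_add, map_add, mul_add, ha, hb]
    intro m f
    refine induction (P := fun y => starAdd (mono m f * y) = starAdd y * starAdd (mono m f))
      ?_ ?_ ?_ y
    · simp
    · intro a b ha hb; rw [mul_add, map_add, map_add, add_mul, ha, hb]
    intro n g
    rw [mono_mul_mono, starAdd_mono, starAdd_mono, starAdd_mono, mono_mul_mono, neg_add_rev]
    congr 1
    have e0 : -n + -m = -(m + n) := by ring
    have e1 : -(m + n) + n = -m := by ring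
    have e2 : -m + -n = -(m + n) := by ring
    rw [star_mul', star_mul', star_coc, e0, map_mul, map_mul, coc_star, ← map_star, shift_shift,
      shift_shift, e1, e2]
    ring
  star_add x y := map_add starAdd x y

theorem star_mono (n : ℤ) (f : LBorel) :
    star (mono n f : FU q) = mono (-n) (shift q (-n) (star f)) := starAdd_mono n f

instance : StarModule ℂ (FU q) where
  star_smul r x := by
    refine induction (P := fun x => star (r • x) = star r • star x) ?_ ?_ ?_ x
    · simp
    · intro a b ha hb; rw [smul_add, star_add, star_add, smul_add, ha, hb]
    intro n f
    rw [← map_smul, star_mono, star_mono, star_smul, map_smul, map_smul]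

/-- The function `f(y)` as an element of `F(U_q)`. -/
noncomputable def ofFun (f : LBorel) : FU q := mono 0 f

/-- The generator `z`. -/
noncomputable def z : FU q := mono 1 1

theorem star_z : star (z : FU q) = mono (-1) 1 := by
  rw [z, star_mono, star_one, map_one]

theorem coc_one_left {n : ℤ} (hn : 0 ≤ n) : coc q 1 n = 1 := by
  have : cocSet 1 n = ∅ := by
    unfold cocSet; rw [if_pos zero_le_one, Finset.Ico_eq_empty_iff]; omega
  rw [coc, this, Finset.prod_empty]

theorem coc_neg_one_left {n : ℤ} (hn : n ≤ 0) : coc q (-1) n = 1 := by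
  have : cocSet (-1) n = ∅ := by
    unfold cocSet; rw [if_neg (by omega), Finset.Ico_eq_empty_iff]; omega
  rw [coc, this, Finset.prod_empty]

theorem z_pow (n : ℕ) : (z : FU q) ^ n = mono n 1 := by
  induction n with
  | zero => rw [pow_zero]; rfl
  | succ n ih =>
    have h : (1 + n : ℤ) = ((n + 1 : ℕ) : ℤ) := by push_cast; ring
    rw [pow_succ', ih, z, mono_mul_mono, coc_one_left (by omega), map_one, one_mul, one_mul, h]

theorem star_z_pow (n : ℕ) : (star (z : FU q)) ^ n = mono (-n) 1 := by
  induction n with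
  | zero => rw [pow_zero]; simp [one_def]
  | succ n ih =>
    have h : (-1 + -n : ℤ) = -((n + 1 : ℕ) : ℤ) := by push_cast; ring
    rw [pow_succ', ih, star_z, mono_mul_mono, coc_neg_one_left (by omega), map_one, one_mul,
      one_mul, h]

/-- `z^n f(y)` is the basis element `X_n f(y)`. -/
theorem z_pow_mul_ofFun (n : ℕ) (f : LBorel) : (z : FU q) ^ n * ofFun f = mono n f := by
  rw [z_pow, ofFun, mono_mul_mono, coc_zero_right, map_one, one_mul, one_mul, add_zero]

/-- `f(y) (z*)^k` is `X_{-k} f(q^{-2k} y)`. -/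
theorem ofFun_mul_star_z_pow (k : ℕ) (f : LBorel) :
    (ofFun f : FU q) * star z ^ k = mono (-k) (shift q (-k) f) := by
  rw [star_z_pow, ofFun, mono_mul_mono, coc_zero_left, one_mul, mul_one, zero_add]

theorem star_z_mul_z : star (z : FU q) * z = ofFun (1 - coordY) := by
  have h : cocSet (-1) 1 = {0} := by decide
  rw [star_z, z, mono_mul_mono, map_one, mul_one, mul_one, coc, h, Finset.prod_singleton]
  congr 1
  simp [lin]

theorem z_mul_star_z : (z : FU q) * star z = ofFun (1 - (q.c ^ (-2 : ℤ)) • coordY) := by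
  have h : cocSet 1 (-1) = {-1} := by decide
  rw [star_z, z, mono_mul_mono, map_one, mul_one, mul_one, coc, h, Finset.prod_singleton]
  congr 1

theorem disc_rel : star (z : FU q) * z - q.c ^ 2 • (z * star z) = (1 - q.c ^ 2) • 1 := by
  have h : q.c ^ 2 * q.c ^ (-2 : ℤ) = 1 := by
    have := q.c_ne
    rw [zpow_neg]; field_simp
  rw [star_z_mul_z, z_mul_star_z, one_def]
  unfold ofFun
  rw [← map_smul, ← map_sub, ← map_smul]
  congr 1
  rw [smul_sub, smul_smul, h, one_smul, sub_smul, one_smul]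
  abel

theorem z_mul_ofFun (f : LBorel) : (z : FU q) * ofFun f = ofFun (shift q (-1) f) * z := by
  rw [z, ofFun, ofFun, mono_mul_mono, mono_mul_mono, coc_zero_right, coc_zero_left, shift_shift]
  simp [shift_zero]

theorem star_z_mul_ofFun (f : LBorel) :
    star (z : FU q) * ofFun f = ofFun (shift q 1 f) * star z := by
  rw [star_z, ofFun, ofFun, mono_mul_mono, mono_mul_mono, coc_zero_right, coc_zero_left,
    shift_shift]
  simp [shift_zero]

/-- The automorphism `X_n f(y) ↦ c^n X_n f(y)`. -/
noncomputable def gradeLin (c : ℂ) : FU q →ₗ[ℂ] FU q :=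
  Finsupp.lsum ℂ fun n => (c ^ n) • mono n

theorem gradeLin_mono (c : ℂ) (n : ℤ) (f : LBorel) :
    gradeLin c (mono n f : FU q) = c ^ n • mono n f := by
  unfold gradeLin
  exact Finsupp.lsum_single ..

/-- The automorphism `X_n f(y) ↦ c^n X_n f(y)`, as an algebra homomorphism. -/
noncomputable def grade (c : ℂ) (hc : c ≠ 0) : FU q →ₐ[ℂ] FU q :=
  AlgHom.ofLinearMap (gradeLin c)
    (by rw [one_def, gradeLin_mono, zpow_zero, one_smul])
    (by
      intro x y
      refine induction (P := fun x => gradeLin c (x * y) = gradeLin c x * gradeLin c y)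
        ?_ ?_ ?_ x
      · simp
      · intro a b ha hb; rw [add_mul, map_add, map_add, add_mul, ha, hb]
      intro m f
      refine induction (P := fun y => gradeLin c (mono m f * y)
        = gradeLin c (mono m f) * gradeLin c y) ?_ ?_ ?_ y
      · simp
      · intro a b ha hb; rw [mul_add, map_add, map_add, mul_add, ha, hb]
      intro n g
      rw [gradeLin_mono, gradeLin_mono, smul_mul_smul_comm, mono_mul_mono, gradeLin_mono,
        zpow_add₀ hc])

theorem grade_mono (c : ℂ) (hc : c ≠ 0) (n : ℤ) (f : LBorel) :
    grade c hc (mono n f : FU q) = c ^ n • mono n f := gradeLin_mono c n f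

theorem grade_comp (c d : ℂ) (hc : c ≠ 0) (hd : d ≠ 0) (h : c * d = 1) (x : FU q) :
    grade c hc (grade d hd x) = x := by
  refine induction (P := fun x => grade c hc (grade d hd x) = x) ?_ ?_ ?_ x
  · simp
  · intro a b ha hb; rw [map_add, map_add, ha, hb]
  intro n f
  rw [grade_mono, map_smul, grade_mono, smul_smul, ← mul_zpow, mul_comm d c, h, one_zpow, one_smul]

/-- The data of the right action of `U_q(su_{1,1})` on `F(U_q)`. -/
noncomputable def datum : DiscDatum q (FU q) where
  k := grade q.c⁻¹ (inv_ne_zero q.c_ne)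
  kinv := grade q.c q.c_ne
  k_kinv := grade_comp _ _ _ _ (inv_mul_cancel₀ q.c_ne)
  kinv_k := grade_comp _ _ _ _ (mul_inv_cancel₀ q.c_ne)
  z := z
  zs := star z
  k_z := by rw [z, grade_mono, zpow_one]
  k_zs := by rw [star_z, grade_mono, zpow_neg_one, inv_inv]
  rel := disc_rel

/-- The right action `x ◁ f` of `U_q(su_{1,1})` on `F(U_q)`. -/
noncomputable def act : FU q →ₗ[ℂ] Uq q →ₗ[ℂ] FU q := datum.act

end FU

end QDisc

namespace QDisc

namespace FU

variable {q : Param}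

theorem coc_neg_one_right {n : ℤ} (hn : 1 ≤ n) : coc q n (-1) = lin q (-1) := by
  have : cocSet n (-1) = {-1} := by
    unfold cocSet; rw [if_pos (by omega)]; ext j
    simp only [Finset.mem_Ico, Finset.mem_singleton]; omega
  rw [coc, this, Finset.prod_singleton]

theorem coc_neg_one_pos {n : ℤ} (hn : 1 ≤ n) : coc q (-1) n = lin q (n - 1) := by
  have : cocSet (-1) n = {n - 1} := by
    unfold cocSet; rw [if_neg (by omega)]; ext j
    simp only [Finset.mem_Ico, Finset.mem_singleton]; omega
  rw [coc, this, Finset.prod_singleton]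

theorem act_E (x : FU q) : act x Uq.E = (q.sqrt * q.lam⁻¹) •
    (z * grade q.c⁻¹ (inv_ne_zero q.c_ne) x - grade q.c q.c_ne x * z) := datum.act_E x

theorem act_F (x : FU q) : act x Uq.F = (q.sqrt⁻¹ * q.lam⁻¹) •
    (grade q.c q.c_ne x * star z - star z * grade q.c⁻¹ (inv_ne_zero q.c_ne) x) := datum.act_F x

theorem act_K (x : FU q) : act x Uq.K = grade q.c⁻¹ (inv_ne_zero q.c_ne) x := datum.act_K x

theorem mono_mul_ofFun (n : ℤ) (f g : LBorel) : (mono n f : FU q) * ofFun g = mono n (f * g) := by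
  rw [ofFun, mono_mul_mono, coc_zero_right, shift_zero, one_mul, add_zero]

theorem ofFun_mul_mono (n : ℤ) (f g : LBorel) :
    (ofFun f : FU q) * mono n g = mono n (shift q n f * g) := by
  rw [ofFun, mono_mul_mono, coc_zero_left, one_mul, zero_add]

/-- `z^n f(y) ◁ K = q^{-n} z^n f(y)`. -/
theorem z_pow_act_K (n : ℕ) (f : LBorel) :
    act ((z : FU q) ^ n * ofFun f) Uq.K = q.c⁻¹ ^ n • (z ^ n * ofFun f) := by
  rw [act_K, z_pow_mul_ofFun, grade_mono, zpow_natCast]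

/-- `f(y) (z*)^n ◁ K = q^n f(y) (z*)^n`. -/
theorem star_z_pow_act_K (n : ℕ) (f : LBorel) :
    act ((ofFun f : FU q) * star z ^ n) Uq.K = q.c ^ n • (ofFun f * star z ^ n) := by
  rw [act_K, ofFun_mul_star_z_pow, grade_mono, zpow_neg, zpow_natCast, inv_pow, inv_inv]

/-- `z^n f(y) ◁ E = q^{1/2} λ⁻¹ z^{n+1} (q^{-n} f(y) - q^n f(q² y))`. -/
theorem z_pow_act_E (n : ℕ) (f : LBorel) :
    act ((z : FU q) ^ n * ofFun f) Uq.E = (q.sqrt * q.lam⁻¹) •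
      (z ^ (n + 1) * ofFun (q.c⁻¹ ^ n • f - q.c ^ n • shift q 1 f)) := by
  have h1 : (ofFun f : FU q) * z = z * ofFun (shift q 1 f) := by
    rw [z_mul_ofFun, shift_shift, neg_add_cancel, shift_zero]
  have h2 : ofFun (q.c⁻¹ ^ n • f - q.c ^ n • shift q 1 f)
      = q.c⁻¹ ^ n • (ofFun f : FU q) - q.c ^ n • ofFun (shift q 1 f) := by
    simp [ofFun]
  rw [act_E, z_pow_mul_ofFun, grade_mono, grade_mono, ← z_pow_mul_ofFun, zpow_natCast,
    zpow_natCast, h2, mul_sub, mul_smul_comm, mul_smul_comm, smul_mul_assoc, mul_assoc _ _ z, h1,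
    pow_succ, mul_assoc, ← mul_assoc z, ← pow_succ', pow_succ, mul_assoc, mul_assoc]
  simp only [mul_smul_comm]

/-- `f(y) (z*)^n ◁ F = q^{-1/2} λ⁻¹ (q^{-n} f(y) - q^n f(q² y)) (z*)^{n+1}`. -/
theorem star_z_pow_act_F (n : ℕ) (f : LBorel) :
    act ((ofFun f : FU q) * star z ^ n) Uq.F = (q.sqrt⁻¹ * q.lam⁻¹) •
      (ofFun (q.c⁻¹ ^ n • f - q.c ^ n • shift q 1 f) * star z ^ (n + 1)) := by
  have h2 : ofFun (q.c⁻¹ ^ n • f - q.c ^ n • shift q 1 f)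
      = q.c⁻¹ ^ n • (ofFun f : FU q) - q.c ^ n • ofFun (shift q 1 f) := by
    simp [ofFun]
  rw [act_F, ofFun_mul_star_z_pow, grade_mono, grade_mono, ← ofFun_mul_star_z_pow, zpow_neg,
    zpow_neg, zpow_natCast, zpow_natCast, h2, sub_mul, mul_smul_comm, smul_mul_assoc,
    smul_mul_assoc, smul_mul_assoc, ← mul_assoc (star z), star_z_mul_ofFun, inv_pow, inv_inv,
    mul_assoc (ofFun f), mul_assoc (ofFun (shift q 1 f)), ← pow_succ, ← pow_succ']

/-- `f(y) (z*)^k ◁ E = q^{1/2} λ⁻¹ (z q^k (f(y) - f(q² y)) (z*)^k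
+ (q^k - q^{-k}) f(y) (z*)^{k-1})` for `k ≥ 1` (here `k = m + 1`). -/
theorem star_z_pow_act_E (m : ℕ) (f : LBorel) :
    act ((ofFun f : FU q) * star z ^ (m + 1)) Uq.E = (q.sqrt * q.lam⁻¹) •
      (z * (q.c ^ (m + 1) • (ofFun (f - shift q 1 f) * star z ^ (m + 1)))
        + (q.c ^ (m + 1) - q.c⁻¹ ^ (m + 1)) • (ofFun f * star z ^ m)) := by
  have hz : (z : FU q) * mono (-((m + 1 : ℕ) : ℤ)) 1
      = mono (-(m : ℤ)) (lin q (-((m + 1 : ℕ) : ℤ))) := by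
    rw [← star_z_pow, pow_succ', ← mul_assoc, z_mul_star_z, star_z_pow, ofFun_mul_mono, mul_one]
    have : (1 - q.c ^ (-2 : ℤ) • coordY) = lin q (-1) := rfl
    have h : (-1 + -(m : ℤ)) = -((m + 1 : ℕ) : ℤ) := by push_cast; ring
    rw [this, shift_lin, h]
  have hz2 : mono (-((m + 1 : ℕ) : ℤ)) 1 * (z : FU q) = mono (-(m : ℤ)) (lin q 0) := by
    rw [← star_z_pow, pow_succ, mul_assoc, star_z_mul_z, star_z_pow, mono_mul_ofFun, one_mul]
    congr 1; simp [lin]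
  have hf : ∀ g : LBorel, (mono (-((m + 1 : ℕ) : ℤ)) g : FU q)
      = mono (-((m + 1 : ℕ) : ℤ)) 1 * ofFun g := by
    intro g; rw [mono_mul_ofFun, one_mul]
  rw [act_E, ofFun_mul_star_z_pow, ofFun_mul_star_z_pow, ofFun_mul_star_z_pow, grade_mono,
    grade_mono]
  congr 1
  have h3 : ∀ g : LBorel, (z : FU q) * mono (-((m + 1 : ℕ) : ℤ)) g
      = mono (-(m : ℤ)) (lin q (-((m + 1 : ℕ) : ℤ)) * g) := by
    intro g; rw [hf, ← mul_assoc, hz, mono_mul_ofFun]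
  have h0' : -((m + 1 : ℕ) : ℤ) + 1 = -(m : ℤ) := by push_cast; ring
  have h1 : (ofFun (shift q (-((m + 1 : ℕ) : ℤ)) f) : FU q) * z
      = z * ofFun (shift q (-(m : ℤ)) f) := by
    have h : -1 + -(m : ℤ) = -((m + 1 : ℕ) : ℤ) := by push_cast; ring
    rw [z_mul_ofFun, shift_shift, h]
  have h4 : (mono (-((m + 1 : ℕ) : ℤ)) (shift q (-((m + 1 : ℕ) : ℤ)) f) : FU q) * z
      = mono (-(m : ℤ)) (lin q 0 * shift q (-(m : ℤ)) f) := by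
    rw [hf, mul_assoc, h1, ← mul_assoc, hz2, mono_mul_ofFun]
  rw [mul_smul_comm, mul_smul_comm, smul_mul_assoc, h3, h3, h4, ← map_smul, ← map_smul,
    ← map_smul, ← map_smul, ← map_sub, ← map_add]
  congr 1
  refine LBorel.ext fun y => ?_
  have hs : shift q (-((m + 1 : ℕ) : ℤ)) (f - shift q 1 f)
      = shift q (-((m + 1 : ℕ) : ℤ)) f - shift q (-(m : ℤ)) f := by
    rw [map_sub, shift_shift, h0']
  rw [hs]
  show q.c⁻¹ ^ (-((m + 1 : ℕ) : ℤ)) * ((lin q _ : PLine → ℂ) y * (shift q _ f : PLine → ℂ) y)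
    - q.c ^ (-((m + 1 : ℕ) : ℤ)) * ((lin q _ : PLine → ℂ) y * (shift q _ f : PLine → ℂ) y)
    = q.c ^ (m + 1) * ((lin q _ : PLine → ℂ) y *
      ((shift q _ f : PLine → ℂ) y - (shift q _ f : PLine → ℂ) y))
      + (q.c ^ (m + 1) - q.c⁻¹ ^ (m + 1)) * (shift q _ f : PLine → ℂ) y
  rw [lin_coe, lin_coe]
  have hq := q.c_ne
  have e1 : q.c⁻¹ ^ (-((m + 1 : ℕ) : ℤ)) = q.c ^ (m + 1) := by
    rw [zpow_neg, zpow_natCast, inv_pow, inv_inv]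
  have e2 : q.c ^ (-((m + 1 : ℕ) : ℤ)) = q.c⁻¹ ^ (m + 1) := by
    rw [zpow_neg, zpow_natCast, inv_pow]
  have e3 : q.c ^ (2 * -((m + 1 : ℕ) : ℤ)) = q.c⁻¹ ^ (m + 1) * q.c⁻¹ ^ (m + 1) := by
    rw [two_mul, zpow_add₀ hq, e2]
  have e4 : q.c ^ (m + 1) * q.c⁻¹ ^ (m + 1) = 1 := by rw [← mul_pow, mul_inv_cancel₀ hq, one_pow]
  rw [e1, e2, e3, mul_zero, zpow_zero]
  linear_combination (-(q.c⁻¹ ^ (m + 1)) * ((y : ℝ) : ℂ) *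
    (shift q (-(m : ℤ)) f : PLine → ℂ) y) * e4

/-- `z^k f(y) ◁ F = q^{-1/2} λ⁻¹ (z^k q^k (f(y) - f(q² y)) z* + (q^k - q^{-k}) z^{k-1} f(y))`
for `k ≥ 1` (here `k = m + 1`). -/
theorem z_pow_act_F (m : ℕ) (f : LBorel) :
    act ((z : FU q) ^ (m + 1) * ofFun f) Uq.F = (q.sqrt⁻¹ * q.lam⁻¹) •
      (z ^ (m + 1) * (q.c ^ (m + 1) • ofFun (f - shift q 1 f)) * star z
        + (q.c ^ (m + 1) - q.c⁻¹ ^ (m + 1)) • (z ^ m * ofFun f)) := by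
  have e0 : ((m + 1 : ℕ) : ℤ) + -1 = (m : ℤ) := by push_cast; ring
  have e0' : -1 + ((m + 1 : ℕ) : ℤ) = (m : ℤ) := by push_cast; ring
  have e0'' : ((m + 1 : ℕ) : ℤ) - 1 = (m : ℤ) := by push_cast; ring
  have hm : (1 : ℤ) ≤ ((m + 1 : ℕ) : ℤ) := by push_cast; omega
  rw [act_F, mul_smul_comm, z_pow_mul_ofFun, z_pow_mul_ofFun, z_pow_mul_ofFun, grade_mono,
    grade_mono, smul_mul_assoc, smul_mul_assoc, mul_smul_comm, star_z, mono_mul_mono,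
    mono_mul_mono, mono_mul_mono, coc_neg_one_right hm, coc_neg_one_pos hm, e0, e0', e0'']
  congr 1
  rw [← map_smul, ← map_smul, ← map_smul, ← map_smul, ← map_sub, ← map_add]
  congr 1
  have hs : shift q (-1) (f - shift q 1 f) = shift q (-1) f - f := by
    rw [map_sub, shift_shift, neg_add_cancel, shift_zero]
  rw [hs, map_one, mul_one, mul_one, mul_one]
  refine LBorel.ext fun y => ?_
  show q.c ^ ((m + 1 : ℕ) : ℤ) * ((lin q _ : PLine → ℂ) y * (shift q _ f : PLine → ℂ) y)
    - q.c⁻¹ ^ ((m + 1 : ℕ) : ℤ) * ((lin q _ : PLine → ℂ) y * (f : PLine → ℂ) y)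
    = q.c ^ (m + 1) * ((lin q _ : PLine → ℂ) y *
      ((shift q _ f : PLine → ℂ) y - (f : PLine → ℂ) y))
      + (q.c ^ (m + 1) - q.c⁻¹ ^ (m + 1)) * (f : PLine → ℂ) y
  rw [lin_coe, lin_coe]
  have hq := q.c_ne
  have e3 : q.c ^ (2 * (m : ℤ)) = q.c ^ m * q.c ^ m := by
    rw [two_mul, zpow_add₀ hq, zpow_natCast]
  have e5 : q.c ^ (2 * (-1 : ℤ)) = q.c⁻¹ * q.c⁻¹ := by
    rw [two_mul, zpow_add₀ hq, zpow_neg_one]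
  have e4 : q.c ^ m * q.c⁻¹ ^ m = 1 := by rw [← mul_pow, mul_inv_cancel₀ hq, one_pow]
  have e6 : q.c * q.c⁻¹ = 1 := mul_inv_cancel₀ hq
  rw [zpow_natCast, zpow_natCast, e3, e5, pow_succ, pow_succ]
  linear_combination (q.c⁻¹ * q.c ^ m * ((y : ℝ) : ℂ) * (f : PLine → ℂ) y) * e4
    - (q.c⁻¹ * q.c ^ m * ((y : ℝ) : ℂ) * (f : PLine → ℂ) y) * e6

end FU

/-! ### The ideal `F_0(U_q)` and its functionals -/

/-- `F_0(U_q)`: the elements of `F(U_q)` all of whose coefficients have compact support in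
`ℝ \ {0}`, that is, the linear span of the elements `z^k (z*)^n f(y)` with `f` of compact
support. -/
def F0 (q : Param) : Submodule ℂ (FU q) where
  carrier := {x | ∀ n, HasCompactSupport (FU.coeff n x : PLine → ℂ)}
  add_mem' := by
    intro x y hx hy n
    rw [map_add]
    exact (hx n).add (hy n)
  zero_mem' := by
    intro n
    rw [map_zero]
    exact HasCompactSupport.zero
  smul_mem' := by
    intro c x hx n
    rw [map_smul]
    exact (hx n).smul_left (f := fun _ => c)

namespace F0

variable {q : Param}

theorem hcs_shift (n : ℤ) {f : LBorel} (hf : HasCompactSupport (f : PLine → ℂ)) :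
    HasCompactSupport (shift q n f : PLine → ℂ) :=
  hf.comp_homeomorph (scale q n)

theorem mono_mem (n : ℤ) {f : LBorel} (hf : HasCompactSupport (f : PLine → ℂ)) :
    (FU.mono n f : FU q) ∈ F0 q := by
  intro m
  rw [FU.coeff_mono]
  split_ifs
  · exact hf
  · exact HasCompactSupport.zero

theorem sum_mono (x : FU q) :
    x = ∑ n ∈ Finsupp.support (x : ℤ →₀ LBorel), FU.mono n (FU.coeff n x) :=
  (Finsupp.sum_single (x : ℤ →₀ LBorel)).symm

theorem mul_left_mem (x : FU q) {y : FU q} (hy : y ∈ F0 q) : x * y ∈ F0 q := by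
  refine FU.induction (P := fun x => x * y ∈ F0 q) ?_ ?_ ?_ x
  · simp
  · intro a b ha hb; rw [add_mul]; exact (F0 q).add_mem ha hb
  intro m f
  rw [sum_mono y, Finset.mul_sum]
  refine Submodule.sum_mem _ fun n _ => ?_
  rw [FU.mono_mul_mono]
  exact mono_mem _ ((hy n).mul_left)

theorem mul_right_mem {x : FU q} (hx : x ∈ F0 q) (y : FU q) : x * y ∈ F0 q := by
  refine FU.induction (P := fun y => x * y ∈ F0 q) ?_ ?_ ?_ y
  · simp
  · intro a b ha hb; rw [mul_add]; exact (F0 q).add_mem ha hb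
  intro m f
  rw [sum_mono x, Finset.sum_mul]
  refine Submodule.sum_mem _ fun n _ => ?_
  rw [FU.mono_mul_mono]
  exact mono_mem _ ((hcs_shift m (hx n)).mul_left.mul_right)

theorem grade_mem (c : ℂ) (hc : c ≠ 0) {x : FU q} (hx : x ∈ F0 q) :
    FU.grade c hc x ∈ F0 q := by
  rw [sum_mono x, map_sum]
  refine Submodule.sum_mem _ fun n _ => ?_
  rw [FU.grade_mono]
  exact (F0 q).smul_mem _ (mono_mem _ (hx n))

theorem act_mem {x : FU q} (hx : x ∈ F0 q) (f : Uq q) : FU.act x f ∈ F0 q :=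
  FU.datum.act_mem (F0 q) (fun _ h => mul_left_mem _ h) (fun _ h => mul_right_mem h _)
    (fun _ h => mul_left_mem _ h) (fun _ h => mul_right_mem h _)
    (fun _ h => grade_mem _ (inv_ne_zero q.c_ne) h) (fun _ h => grade_mem _ q.c_ne h) f x hx

/-- The right action `x ◁ f` on `F_0(U_q)`. -/
noncomputable def act : F0 q →ₗ[ℂ] Uq q →ₗ[ℂ] F0 q :=
  LinearMap.mk₂ ℂ (fun x f => ⟨FU.act x.1 f, act_mem x.2 f⟩)
    (fun x x' f => by ext1; simp)
    (fun c x f => by ext1; simp)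
    (fun x f f' => by ext1; simp)
    (fun c x f => by ext1; simp)

/-- The inclusion `O(U_q) → F(U_q)`, `z ↦ z`, `z* ↦ z*`. -/
noncomputable def incl : Disc q →ₐ[ℂ] FU q := Disc.lift FU.z (star FU.z) FU.disc_rel

/-- The left action `a . x = a x` of `O(U_q)` on `F_0(U_q)`. -/
noncomputable def lmul (a : Disc q) (x : F0 q) : F0 q := ⟨incl a * x.1, mul_left_mem _ x.2⟩

/-- The element `y* x` of `F_0(U_q)`. -/
noncomputable def starMul (y x : F0 q) : F0 q := ⟨star y.1 * x.1, mul_left_mem _ x.2⟩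

/-- A linear functional on `F_0(U_q)` is positive if `h(x* x) ≥ 0` for all `x`. -/
def IsPositive (h : F0 q →ₗ[ℂ] ℂ) : Prop := ∀ x : F0 q, ∃ r : ℝ, 0 ≤ r ∧ h (starMul x x) = r

/-- A linear functional `h` on `F_0(U_q)` is invariant if `h(x ◁ f) = ε(f) h(x)`. -/
def IsInvariant (h : F0 q →ₗ[ℂ] ℂ) : Prop :=
  ∀ (x : F0 q) (f : Uq q), h (act x f) = Uq.counit f * h x

/-- `h(z^n f(y)) = h(f(y) (z*)^n) = 0` for all `n = 1, 2, …`. -/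
def VanishesOffDiagonal (h : F0 q →ₗ[ℂ] ℂ) : Prop :=
  ∀ n : ℕ, 1 ≤ n → ∀ (f : LBorel) (x : F0 q),
    ((x : FU q) = FU.z ^ n * FU.ofFun f ∨ (x : FU q) = FU.ofFun f * star FU.z ^ n) → h x = 0

/-- The function `f(y)` with compact support as an element of `F_0(U_q)`. -/
noncomputable def ofFun (f : LBorel) (hf : HasCompactSupport (f : PLine → ℂ)) : F0 q :=
  ⟨FU.ofFun f, mono_mem 0 hf⟩

/-- `h(f(q^{-2} y) (1 - q^{-2} y)) = q^{-2} h(f(y) (1 - y))` for all `f` of compact support. -/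
def ScalingCondition (h : F0 q →ₗ[ℂ] ℂ) : Prop :=
  ∀ (f : LBorel) (hf : HasCompactSupport (f : PLine → ℂ)),
    h (ofFun (shift q (-1) (f * (1 - coordY))) (hcs_shift (-1) hf.mul_right))
      = q.c ^ (-2 : ℤ) * h (ofFun (f * (1 - coordY)) hf.mul_right)

/-- The restriction of `h` to functions is integration with respect to the measure `ν`. -/
def IsGivenBy (h : F0 q →ₗ[ℂ] ℂ) (ν : MeasureTheory.Measure PLine) : Prop :=
  ∀ (f : LBorel) (hf : HasCompactSupport (f : PLine → ℂ)),
    h (ofFun f hf) = ∫ y, (f : PLine → ℂ) y ∂ν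

end F0

end QDisc

namespace QDisc

open MeasureTheory

/-! ### Measures and the functionals `h_I`, `h_{μ₀}` -/

section measures

variable (q : Param)

theorem exists_abs_bounds {C : Set PLine} (hC : IsCompact C) :
    ∃ a b : ℝ, 0 < a ∧ ∀ y ∈ C, a ≤ |(y : ℝ)| ∧ |(y : ℝ)| ≤ b := by
  have h1 : Continuous fun y : PLine => ((y : ℝ))⁻¹ :=
    continuous_subtype_val.inv₀ fun y => y.2
  obtain ⟨M, hM⟩ := hC.exists_bound_of_continuousOn h1.continuousOn
  obtain ⟨b, hb⟩ := hC.exists_bound_of_continuousOn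
    (continuous_subtype_val (p := fun y : ℝ => y ≠ 0)).continuousOn
  refine ⟨(max M 1)⁻¹, b, inv_pos.2 (lt_max_of_lt_right one_pos), fun y hy => ⟨?_, hb y hy⟩⟩
  have h2 := hM y hy
  rw [norm_inv, Real.norm_eq_abs] at h2
  rw [inv_le_comm₀ (lt_max_of_lt_right one_pos) (abs_pos.2 y.2)]
  exact h2.trans (le_max_left _ _)

theorem finite_scales {a b : ℝ} (ha : 0 < a) :
    {k : ℤ | a ≤ (q : ℝ) ^ (2 * k) ∧ (q : ℝ) ^ (2 * k) ≤ b}.Finite := by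
  obtain ⟨N, hN⟩ := exists_pow_lt_of_lt_one ha q.lt_one
  have hb : 0 < (max b 1)⁻¹ := inv_pos.2 (lt_max_of_lt_right one_pos)
  obtain ⟨M, hM⟩ := exists_pow_lt_of_lt_one hb q.lt_one
  refine (Set.finite_Icc (-(M : ℤ)) N).subset fun k hk => ⟨?_, ?_⟩
  · by_contra hlt
    have h1 : (M : ℤ) ≤ -(2 * k) := by omega
    have h2 : ((q : ℝ) ^ (2 * k))⁻¹ ≤ (q : ℝ) ^ (M : ℤ) := by
      rw [← zpow_neg]
      exact zpow_le_zpow_right_of_le_one₀ q.pos q.lt_one.le h1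
    rw [zpow_natCast] at h2
    have h3 := (h2.trans_lt hM)
    rw [inv_lt_inv₀ (zpow_pos q.pos _) (lt_max_of_lt_right one_pos)] at h3
    exact absurd (hk.2.trans (le_max_left b 1)) (not_le.2 h3)
  · by_contra hlt
    have h1 : (N : ℤ) ≤ 2 * k := by omega
    have h2 : (q : ℝ) ^ (2 * k) ≤ (q : ℝ) ^ (N : ℤ) :=
      zpow_le_zpow_right_of_le_one₀ q.pos q.lt_one.le h1
    rw [zpow_natCast] at h2
    exact absurd hk.1 (not_le.2 (h2.trans_lt hN))

/-- The interval `[-1, -q²)`. -/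
abbrev NegCell : Type := Set.Ico (-1 : ℝ) (-(q : ℝ) ^ 2)

/-- The interval `(q², 1]`. -/
abbrev PosCell : Type := Set.Ioc ((q : ℝ) ^ 2) 1

variable {q}

/-- The inclusion of `[-1, -q²)` into `ℝ \ {0}`. -/
def NegCell.toPLine (y : NegCell q) : PLine :=
  ⟨y.1, (y.2.2.trans_le (neg_nonpos.2 (sq_nonneg _))).ne⟩

/-- The reflection `y ↦ -y` from `[-1, -q²)` to `(q², 1]`. -/
def NegCell.reflect (y : NegCell q) : PosCell q :=
  ⟨-y.1, lt_neg.1 y.2.2, neg_le.1 y.2.1⟩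

theorem NegCell.continuous_toPLine : Continuous (NegCell.toPLine (q := q)) := by
  unfold NegCell.toPLine; fun_prop

/-- The extension of a measure `μ₀` on `[-1, -q²)` to the measure `μ` on `(-∞, 0)` with
`μ(q^{2k} M) = q^{2k} μ₀(M)` for `k ∈ ℤ` and `M ⊆ [-1, -q²)`; it is regarded as a measure on
`ℝ \ {0}` concentrated on `(-∞, 0)`. -/
noncomputable def extMeasure (μ₀ : Measure (NegCell q)) : Measure PLine :=
  Measure.sum fun k : ℤ => ENNReal.ofReal ((q : ℝ) ^ (2 * k)) •
    μ₀.map fun y => scale q k y.toPLine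

theorem measurable_cell (k : ℤ) : Measurable fun y : NegCell q => scale q k y.toPLine :=
  ((scale q k).continuous.comp NegCell.continuous_toPLine).measurable

instance (μ₀ : Measure (NegCell q)) [IsFiniteMeasure μ₀] :
    IsFiniteMeasureOnCompacts (extMeasure μ₀) where
  lt_top_of_isCompact := by
    intro C hC
    obtain ⟨a, b, ha, hab⟩ := exists_abs_bounds hC
    have hfin := finite_scales q (b := b / (q : ℝ) ^ 2) ha
    have hq2 : 0 < (q : ℝ) ^ 2 := pow_pos q.pos 2
    rw [extMeasure, Measure.sum_apply _ hC.measurableSet]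
    rw [tsum_eq_sum (s := hfin.toFinset)]
    · refine ENNReal.sum_lt_top.2 fun k _ => ?_
      rw [Measure.smul_apply, smul_eq_mul, Measure.map_apply (measurable_cell k) hC.measurableSet]
      exact ENNReal.mul_lt_top ENNReal.ofReal_lt_top (measure_lt_top _ _)
    · intro k hk
      have hempty : (fun y : NegCell q => scale q k y.toPLine) ⁻¹' C = ∅ := by
        refine Set.eq_empty_of_forall_notMem fun y hy => hk ?_
        rw [Set.Finite.mem_toFinset]
        obtain ⟨h1, h2⟩ := hab _ hy
        have hpos : 0 < (q : ℝ) ^ (2 * k) := zpow_pos q.pos _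
        have habs : |((scale q k y.toPLine : PLine) : ℝ)| = (q : ℝ) ^ (2 * k) * |y.1| := by
          rw [scale_coe, abs_mul, abs_of_pos hpos]; rfl
        have hy0 : y.1 < 0 := y.2.2.trans_le (neg_nonpos.2 (sq_nonneg _))
        have hy1 : |y.1| ≤ 1 := by rw [abs_of_neg hy0]; linarith [y.2.1]
        have hy2 : (q : ℝ) ^ 2 ≤ |y.1| := by rw [abs_of_neg hy0]; linarith [y.2.2]
        rw [habs] at h1 h2
        refine ⟨h1.trans (mul_le_of_le_one_right hpos.le hy1), ?_⟩
        rw [le_div_iff₀ hq2]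
        exact (mul_le_mul_of_nonneg_left hy2 hpos.le).trans h2
      rw [Measure.smul_apply, smul_eq_mul, Measure.map_apply (measurable_cell k) hC.measurableSet,
        hempty, measure_empty, mul_zero]

/-- A locally bounded function with compact support is integrable for every measure that is
finite on compact sets. -/
theorem LBorel.integrable (f : LBorel) (hf : HasCompactSupport (f : PLine → ℂ))
    (ν : Measure PLine) [IsFiniteMeasureOnCompacts ν] : Integrable (f : PLine → ℂ) ν := by
  obtain ⟨M, hM⟩ := f.2.2 _ hf.isCompact
  have h : IntegrableOn (f : PLine → ℂ) (tsupport (f : PLine → ℂ)) ν :=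
    Measure.integrableOn_of_bounded (M := M) hf.isCompact.measure_lt_top.ne
      f.2.1.aestronglyMeasurable
      ((ae_restrict_iff' (isClosed_tsupport _).measurableSet).2 (ae_of_all _ hM))
  exact (integrableOn_iff_integrable_of_support_subset (subset_tsupport _)).1 h

/-- The function `y^{-2}`. -/
noncomputable def invSq : LBorel :=
  ⟨fun y => ((y : ℝ) : ℂ) ^ (-2 : ℤ), by
    exact (Complex.measurable_ofReal.comp measurable_subtype_coe).pow_const _, fun C hC => by
    have h : Continuous fun y : PLine => ((y : ℝ) : ℂ) ^ (-2 : ℤ) :=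
      (Complex.continuous_ofReal.comp continuous_subtype_val).zpow₀ _ fun y =>
        Or.inl (Complex.ofReal_ne_zero.2 y.2)
    exact hC.exists_bound_of_continuousOn h.continuousOn⟩

/-- The functional `h_{μ₀}` given by
`h_{μ₀}(z^n f(y)) = h_{μ₀}(f(y) (z*)^n) = δ_{n0} ∫_{(-∞,0)} f(y) y^{-2} dμ(y)`. -/
noncomputable def hMu (μ₀ : Measure (NegCell q)) [IsFiniteMeasure μ₀] : F0 q →ₗ[ℂ] ℂ where
  toFun x := ∫ y, (FU.coeff 0 x.1 : PLine → ℂ) y * ((y : ℝ) : ℂ) ^ (-2 : ℤ) ∂(extMeasure μ₀)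
  map_add' x y := by
    have hx := LBorel.integrable (FU.coeff 0 x.1 * invSq) ((x.2 0).mul_right) (extMeasure μ₀)
    have hy := LBorel.integrable (FU.coeff 0 y.1 * invSq) ((y.2 0).mul_right) (extMeasure μ₀)
    refine Eq.trans ?_ (integral_add hx hy)
    congr 1
    ext t
    have : (FU.coeff 0 (x + y).1 : PLine → ℂ) t
        = (FU.coeff 0 x.1 : PLine → ℂ) t + (FU.coeff 0 y.1 : PLine → ℂ) t := by
      rw [Submodule.coe_add, map_add]; rfl
    exact (congrArg (· * _) this).trans (add_mul _ _ _)
  map_smul' c x := by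
    rw [RingHom.id_apply, smul_eq_mul, ← integral_const_mul]
    congr 1
    ext t
    have : (FU.coeff 0 (c • x).1 : PLine → ℂ) t = c * (FU.coeff 0 x.1 : PLine → ℂ) t := by
      rw [Submodule.coe_smul, map_smul]; rfl
    rw [this, mul_assoc]

variable (q) in
/-- The point `q^{2k}` of `ℝ \ {0}`. -/
noncomputable def qPoint (k : ℕ) : PLine := ⟨(q : ℝ) ^ (2 * k), pow_ne_zero _ q.pos.ne'⟩

theorem summable_qPoint (f : LBorel) (hf : HasCompactSupport (f : PLine → ℂ)) :
    Summable fun k : ℕ => (f : PLine → ℂ) (qPoint q (k + 1)) * q.c⁻¹ ^ (2 * (k + 1)) := by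
  obtain ⟨a, b, ha, hab⟩ := exists_abs_bounds hf.isCompact
  have hfin := finite_scales q (b := b) ha
  have hinj : Function.Injective fun k : ℕ => ((k + 1 : ℕ) : ℤ) := by
    intro i j h; simp only at h; omega
  refine summable_of_hasFiniteSupport ((hfin.preimage hinj.injOn).subset fun k hk => ?_)
  have hk1 : (f : PLine → ℂ) (qPoint q (k + 1)) ≠ 0 := left_ne_zero_of_mul hk
  have h := hab _ (subset_tsupport _ hk1)
  have habs : |((qPoint q (k + 1) : PLine) : ℝ)| = (q : ℝ) ^ (2 * ((k + 1 : ℕ) : ℤ)) := by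
    show |(q : ℝ) ^ (2 * (k + 1))| = _
    rw [abs_of_pos (pow_pos q.pos _)]
    norm_cast
  rw [habs] at h
  exact h

variable (q) in
/-- The functional `h_I` given by
`h_I(z^n f(y)) = h_I(f(y) (z*)^n) = δ_{n0} ∑_{k=1}^∞ f(q^{2k}) q^{-2k}`. -/
noncomputable def hI : F0 q →ₗ[ℂ] ℂ where
  toFun x := ∑' k : ℕ, (FU.coeff 0 x.1 : PLine → ℂ) (qPoint q (k + 1)) * q.c⁻¹ ^ (2 * (k + 1))
  map_add' x y := by
    rw [← (summable_qPoint _ (x.2 0)).tsum_add (summable_qPoint _ (y.2 0))]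
    congr 1
    ext k
    rw [← add_mul, Submodule.coe_add, map_add]; rfl
  map_smul' c x := by
    rw [RingHom.id_apply, smul_eq_mul, ← tsum_mul_left]
    congr 1
    ext k
    rw [← mul_assoc, Submodule.coe_smul, map_smul]; rfl

variable (q) in
/-- The set `(-∞, 0) ∪ {q^{2n} ; n = 1, 2, …}`. -/
def posSupport : Set PLine := {y | (y : ℝ) < 0 ∨ ∃ n : ℕ, 1 ≤ n ∧ (y : ℝ) = (q : ℝ) ^ (2 * n)}

end measures

/-! ### `*`-representations of the cross product algebra -/

section reps

open scoped TensorProduct InnerProductSpace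

/-- A `*`-representation of the cross product algebra `U_q(su_{1,1}) ⋉ O(U_q)`: a unital
homomorphism `π` into the algebra of endomorphisms of a dense linear subspace of the Hilbert
space `H` such that `⟪π(x) ξ, ζ⟫ = ⟪ξ, π(x*) ζ⟫`. -/
structure StarRep (q : Param) (H : Type) [NormedAddCommGroup H] [InnerProductSpace ℂ H] where
  dom : Submodule ℂ H
  dense : Dense (dom : Set H)
  op : CrossSpace q →ₗ[ℂ] Module.End ℂ dom
  op_one : op (1 ⊗ₜ 1) = 1
  op_mul : ∀ a b, op (CrossSpace.mul a b) = op a * op b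
  op_star : ∀ (a : CrossSpace q) (ξ ζ : dom),
    ⟪((op a ξ : dom) : H), (ζ : H)⟫_ℂ = ⟪(ξ : H), ((op (CrossSpace.conj a) ζ : dom) : H)⟫_ℂ

variable {q : Param}

namespace StarRep

variable {H H₁ H₂ : Type} [NormedAddCommGroup H] [InnerProductSpace ℂ H]
  [NormedAddCommGroup H₁] [InnerProductSpace ℂ H₁] [NormedAddCommGroup H₂]
  [InnerProductSpace ℂ H₂]

/-- The action of an element of `O(U_q)`. -/
noncomputable def disc (π : StarRep q H) (a : Disc q) : Module.End ℂ π.dom := π.op (1 ⊗ₜ a)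

/-- The action of an element of `U_q(su_{1,1})`. -/
noncomputable def uq (π : StarRep q H) (f : Uq q) : Module.End ℂ π.dom := π.op (f ⊗ₜ 1)

/-- Unitary equivalence of `*`-representations: a unitary operator which maps the domain of `π`
onto the domain of `ρ` and intertwines the actions of all elements. -/
def UnitarilyEquivalent (π : StarRep q H₁) (ρ : StarRep q H₂) : Prop :=
  ∃ W : H₁ ≃ₗᵢ[ℂ] H₂, (∀ ξ, W ξ ∈ ρ.dom ↔ ξ ∈ π.dom) ∧
    ∀ (a : CrossSpace q) (ξ : π.dom) (ζ : ρ.dom), (ζ : H₂) = W ξ →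
      ((ρ.op a ζ : ρ.dom) : H₂) = W (π.op a ξ : π.dom)

/-- Irreducibility: the representation is not a direct sum of two `*`-representations on nonzero
Hilbert spaces, that is, every projection which maps the domain into itself and commutes with the
action is trivial. -/
def IsIrreducible [CompleteSpace H] (π : StarRep q H) : Prop :=
  Nontrivial H ∧ ∀ P : H →L[ℂ] H, IsStarProjection P →
    (∀ ξ : π.dom, ∃ ζ : π.dom, (ζ : H) = P ξ ∧
      ∀ a : CrossSpace q, ((π.op a ζ : π.dom) : H) = P (π.op a ξ : π.dom)) →
    P = 0 ∨ P = 1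

/-- `ρ` is a restriction of `ρ'` to a smaller domain with the same closure: every vector of the
domain of `ρ'` is the limit of a sequence of vectors in the domain of `ρ` along which all
operators converge. -/
def HasCoreIn (ρ ρ' : StarRep q H) : Prop :=
  (∀ ξ : ρ.dom, ∃ ζ : ρ'.dom, (ζ : H) = ξ ∧
    ∀ a : CrossSpace q, ((ρ'.op a ζ : ρ'.dom) : H) = (ρ.op a ξ : ρ.dom)) ∧
  ∀ ζ : ρ'.dom, ∃ ξ : ℕ → ρ.dom, ∀ a : CrossSpace q,
    Filter.Tendsto (fun j => ((ρ.op a (ξ j) : ρ.dom) : H)) Filter.atTop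
      (nhds ((ρ'.op a ζ : ρ'.dom) : H))

/-- The domain of a direct sum. -/
def sumDom (D₁ : Submodule ℂ H₁) (D₂ : Submodule ℂ H₂) : Submodule ℂ (WithLp 2 (H₁ × H₂)) where
  carrier := {x | x.fst ∈ D₁ ∧ x.snd ∈ D₂}
  add_mem' := fun hx hy => ⟨D₁.add_mem hx.1 hy.1, D₂.add_mem hx.2 hy.2⟩
  zero_mem' := ⟨D₁.zero_mem, D₂.zero_mem⟩
  smul_mem' := fun c _ hx => ⟨D₁.smul_mem c hx.1, D₂.smul_mem c hx.2⟩

/-- The direct sum of two endomorphisms. -/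
noncomputable def sumEnd {D₁ : Submodule ℂ H₁} {D₂ : Submodule ℂ H₂} (S : Module.End ℂ D₁)
    (T : Module.End ℂ D₂) : Module.End ℂ (sumDom D₁ D₂) where
  toFun x := ⟨WithLp.toLp 2 ((S ⟨x.1.fst, x.2.1⟩ : H₁), (T ⟨x.1.snd, x.2.2⟩ : H₂)),
    (S ⟨x.1.fst, x.2.1⟩).2, (T ⟨x.1.snd, x.2.2⟩).2⟩
  map_add' x y := by
    have h1 : (⟨(x + y).1.fst, (x + y).2.1⟩ : D₁) = ⟨x.1.fst, x.2.1⟩ + ⟨y.1.fst, y.2.1⟩ := rfl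
    have h2 : (⟨(x + y).1.snd, (x + y).2.2⟩ : D₂) = ⟨x.1.snd, x.2.2⟩ + ⟨y.1.snd, y.2.2⟩ := rfl
    rw [Subtype.ext_iff]
    show WithLp.toLp 2 _ = WithLp.toLp 2 _ + WithLp.toLp 2 _
    rw [h1, h2, map_add, map_add]; rfl
  map_smul' c x := by
    have h1 : (⟨(c • x).1.fst, (c • x).2.1⟩ : D₁) = c • ⟨x.1.fst, x.2.1⟩ := rfl
    have h2 : (⟨(c • x).1.snd, (c • x).2.2⟩ : D₂) = c • ⟨x.1.snd, x.2.2⟩ := rfl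
    rw [Subtype.ext_iff]
    show WithLp.toLp 2 _ = c • WithLp.toLp 2 _
    rw [h1, h2, map_smul, map_smul]; rfl

/-- The (orthogonal) direct sum of two `*`-representations. -/
noncomputable def directSum (ρ₁ : StarRep q H₁) (ρ₂ : StarRep q H₂) :
    StarRep q (WithLp 2 (H₁ × H₂)) where
  dom := sumDom ρ₁.dom ρ₂.dom
  dense := by
    have h : Dense ((ρ₁.dom : Set H₁) ×ˢ (ρ₂.dom : Set H₂)) := ρ₁.dense.prod ρ₂.dense
    exact h.preimage (WithLp.prodContinuousLinearEquiv 2 ℂ H₁ H₂).toHomeomorph.isOpenMap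
  op :=
    { toFun := fun a => sumEnd (ρ₁.op a) (ρ₂.op a)
      map_add' := fun a b => by rw [map_add, map_add]; rfl
      map_smul' := fun c a => by rw [map_smul, map_smul]; rfl }
  op_one := by
    show sumEnd (ρ₁.op (1 ⊗ₜ 1)) (ρ₂.op (1 ⊗ₜ 1)) = 1
    rw [ρ₁.op_one, ρ₂.op_one]; rfl
  op_mul a b := by
    show sumEnd (ρ₁.op _) (ρ₂.op _) = sumEnd _ _ * sumEnd _ _
    rw [ρ₁.op_mul, ρ₂.op_mul]; rfl
  op_star a ξ ζ := by
    rw [WithLp.prod_inner_apply, WithLp.prod_inner_apply]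
    exact congrArg₂ (· + ·) (ρ₁.op_star a ⟨ξ.1.fst, ξ.2.1⟩ ⟨ζ.1.fst, ζ.2.1⟩)
      (ρ₂.op_star a ⟨ξ.1.snd, ξ.2.2⟩ ⟨ζ.1.snd, ζ.2.2⟩)

end StarRep

/-! ### Heisenberg representations -/

/-- The space `F_0(U_q)` with the semi-inner product `⟨x, y⟩ = h(y* x)` of a positive linear
functional `h`. -/
def PreHeis (h : F0 q →ₗ[ℂ] ℂ) (_hp : F0.IsPositive h) : Type := F0 q

section heis

variable (h : F0 q →ₗ[ℂ] ℂ) (hp : F0.IsPositive h)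

noncomputable instance : AddCommGroup (PreHeis h hp) := inferInstanceAs (AddCommGroup (F0 q))
noncomputable instance : Module ℂ (PreHeis h hp) := inferInstanceAs (Module ℂ (F0 q))

theorem starMul_add_left (x y w : F0 q) :
    F0.starMul (x + y) w = F0.starMul x w + F0.starMul y w := by
  ext1; show star (x.1 + y.1) * w.1 = star x.1 * w.1 + star y.1 * w.1
  rw [star_add, add_mul]

theorem starMul_add_right (x y w : F0 q) :
    F0.starMul x (y + w) = F0.starMul x y + F0.starMul x w := by
  ext1; exact mul_add _ _ _

theorem starMul_smul_left (c : ℂ) (x y : F0 q) :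
    F0.starMul (c • x) y = (starRingEnd ℂ c) • F0.starMul x y := by
  ext1; show star (c • x.1) * y.1 = (starRingEnd ℂ c) • (star x.1 * y.1)
  rw [star_smul, smul_mul_assoc]; rfl

theorem starMul_smul_right (c : ℂ) (x y : F0 q) :
    F0.starMul x (c • y) = c • F0.starMul x y := by
  ext1; exact mul_smul_comm _ _ _

theorem positive_hermitian (h : F0 q →ₗ[ℂ] ℂ) (hp : F0.IsPositive h) (x y : F0 q) :
    (starRingEnd ℂ) (h (F0.starMul y x)) = h (F0.starMul x y) := by
  have hreal : ∀ w : F0 q, (h (F0.starMul w w)).im = 0 := by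
    intro w
    obtain ⟨r, -, hr⟩ := hp w
    rw [hr, Complex.ofReal_im]
  have h1 := hreal (x + y)
  have h2 := hreal (x + Complex.I • y)
  simp only [starMul_add_left, starMul_add_right, starMul_smul_left, starMul_smul_right, map_add,
    map_smul, smul_eq_mul, Complex.add_im, Complex.mul_im, Complex.conj_I, Complex.I_re,
    Complex.I_im, Complex.neg_re, Complex.neg_im, hreal, Complex.mul_re, Complex.add_re] at h1 h2
  apply Complex.ext
  · rw [Complex.conj_re]; linarith
  · rw [Complex.conj_im]; linarith

noncomputable instance : PreInnerProductSpace.Core ℂ (PreHeis h hp) where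
  inner x y := h (F0.starMul x y)
  conj_inner_symm x y := positive_hermitian h hp x y
  re_inner_nonneg x := by
    obtain ⟨r, hr, hr'⟩ := hp x
    show 0 ≤ (h (F0.starMul x x)).re
    rw [hr', Complex.ofReal_re]; exact hr
  add_left x y w := by
    exact (congrArg h (starMul_add_left (q := q) x y w)).trans (map_add h _ _)
  smul_left x y c := by
    exact (congrArg h (starMul_smul_left (q := q) c x y)).trans (map_smul h _ _)

noncomputable instance : SeminormedAddCommGroup (PreHeis h hp) :=
  InnerProductSpace.Core.toSeminormedAddCommGroup (𝕜 := ℂ)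

noncomputable instance : InnerProductSpace ℂ (PreHeis h hp) := InnerProductSpace.ofCore _

/-- The Hilbert space of the Heisenberg representation: the completion of
`F_0(U_q) / {x ; h(x* x) = 0}` with the inner product induced by `⟨x, y⟩ = h(y* x)`. -/
abbrev HeisSpace : Type := UniformSpace.Completion (PreHeis h hp)

/-- The class of `x ∈ F_0(U_q)` in the Hilbert space of the Heisenberg representation. -/
noncomputable def heisClass : F0 q →ₗ[ℂ] HeisSpace h hp :=
  (UniformSpace.Completion.toComplₗᵢ (𝕜 := ℂ) (E := PreHeis h hp)).toLinearMap

theorem inner_heisClass (x y : F0 q) :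
    ⟪heisClass h hp x, heisClass h hp y⟫_ℂ = h (F0.starMul x y) :=
  UniformSpace.Completion.inner_coe (𝕜 := ℂ) (E := PreHeis h hp) x y

variable {h hp} in
/-- `π` is the Heisenberg representation associated with `h`: its domain is the image of
`F_0(U_q)` and `π(f ⊗ a) x = (a . x) ◁ S⁻¹(f)`. -/
def IsHeisenberg (π : StarRep q (HeisSpace h hp)) : Prop :=
  π.dom = LinearMap.range (heisClass h hp) ∧
  ∀ (f : Uq q) (a : Disc q) (x : F0 q) (ξ : π.dom), (ξ : HeisSpace h hp) = heisClass h hp x →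
    ((π.op (f ⊗ₜ a) ξ : π.dom) : HeisSpace h hp)
      = heisClass h hp (F0.act (F0.lmul a x) (Uq.antipodeInv f))

end heis

/-! ### The series `(I.1)` and `(II.2)` -/

/-- `λ_n = (1 - q^{2n})^{1/2}`. -/
noncomputable def lamN (q : Param) (n : ℕ) : ℂ := ((Real.sqrt (1 - (q : ℝ) ^ (2 * n)) : ℝ) : ℂ)

/-- `α_k(A) = (1 + q^{2k} A²)^{1/2}` for a bounded self-adjoint operator `A`. -/
noncomputable def alpha (q : Param) {𝒦 : Type} [NormedAddCommGroup 𝒦] [InnerProductSpace ℂ 𝒦]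
    [CompleteSpace 𝒦] (k : ℤ) (A : 𝒦 →L[ℂ] 𝒦) : 𝒦 →L[ℂ] 𝒦 :=
  cfc (fun t : ℝ => Real.sqrt (1 + (q : ℝ) ^ (2 * k) * t ^ 2)) A

/-- The Hilbert space `⊕_{n,k=0}^∞ ℂ` of the representation `(I.1)_I` with `𝒦 = ℂ`. -/
abbrev SpaceI : Type := lp (fun _ : ℕ × ℕ => ℂ) 2

/-- The base vectors `η_{nk}` of `SpaceI`, with `η_{nk} = 0` if `n < 0` or `k < 0`. -/
noncomputable def etaI (n k : ℤ) : SpaceI :=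
  if 0 ≤ n ∧ 0 ≤ k then lp.single 2 (n.toNat, k.toNat) 1 else 0

/-- The irreducible representation `(I.1)_I` (`H₁ = I` on `𝒦 = ℂ`), on the linear span of the
base vectors. -/
def IsSeriesI1 (ρ : StarRep q SpaceI) : Prop :=
  ρ.dom = Submodule.span ℂ (Set.range fun p : ℕ × ℕ => etaI p.1 p.2) ∧
  ∀ (n k : ℕ) (ξ : ρ.dom), (ξ : SpaceI) = etaI n k →
    ((ρ.disc Disc.z ξ : ρ.dom) : SpaceI) = lamN q (n + 1) • etaI (n + 1) k ∧
    ((ρ.disc Disc.zs ξ : ρ.dom) : SpaceI) = lamN q n • etaI (n - 1) k ∧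
    ((ρ.uq Uq.K ξ : ρ.dom) : SpaceI) = q.c ^ ((n : ℤ) - k) • etaI n k ∧
    ((ρ.uq Uq.F ξ : ρ.dom) : SpaceI)
      = (q.c ^ ((n : ℤ) - k) * q.sqrt⁻¹ * q.lam⁻¹ * lamN q (k + 1)) • etaI n (k + 1)
        + (q.c ^ (-((n : ℤ) - k)) * q.sqrt * q.lam⁻¹ * lamN q n) • etaI (n - 1) k ∧
    ((ρ.uq Uq.E ξ : ρ.dom) : SpaceI)
      = -(q.c ^ ((n : ℤ) - k) * q.sqrt * q.lam⁻¹ * lamN q k) • etaI n (k - 1)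
        - (q.c ^ (-((n : ℤ) - k)) * q.sqrt⁻¹ * q.lam⁻¹ * lamN q (n + 1)) • etaI (n + 1) k

section seriesII

variable {𝒦 : Type} [NormedAddCommGroup 𝒦] [InnerProductSpace ℂ 𝒦]

/-- The Hilbert space `⊕_{n,k=-∞}^∞ 𝒦` of the representation `(II.2)`. -/
abbrev SpaceII (𝒦 : Type) [NormedAddCommGroup 𝒦] [InnerProductSpace ℂ 𝒦] : Type :=
  lp (fun _ : ℤ × ℤ => 𝒦) 2

/-- The vector `η_{nk}` with `η` in the position `(n,k)` and zero elsewhere. -/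
noncomputable def etaII (n k : ℤ) (η : 𝒦) : SpaceII 𝒦 := lp.single 2 (n, k) η

/-- The representation `(II.2)_{A₁,A₂,I}` (i.e. `H₁ = I`), on the domain
`Lin {η_{nk} ; η ∈ D₀, n, k ∈ ℤ}`. -/
def IsSeriesII2 [CompleteSpace 𝒦] (A₁ A₂ : 𝒦 →L[ℂ] 𝒦) (D₀ : Submodule ℂ 𝒦)
    (ρ : StarRep q (SpaceII 𝒦)) : Prop :=
  ρ.dom = Submodule.span ℂ {ξ | ∃ (n k : ℤ) (η : 𝒦), η ∈ D₀ ∧ ξ = etaII n k η} ∧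
  ∀ (n k : ℤ) (η : 𝒦) (ξ : ρ.dom), (ξ : SpaceII 𝒦) = etaII n k η →
    ((ρ.disc Disc.z ξ : ρ.dom) : SpaceII 𝒦) = etaII (n + 1) k (alpha q (n + 1) A₁ η) ∧
    ((ρ.disc Disc.zs ξ : ρ.dom) : SpaceII 𝒦) = etaII (n - 1) k (alpha q n A₁ η) ∧
    ((ρ.uq Uq.K ξ : ρ.dom) : SpaceII 𝒦) = q.c ^ (n - k) • etaII n k η ∧
    ((ρ.uq Uq.F ξ : ρ.dom) : SpaceII 𝒦)
      = (q.lam⁻¹ * q.c ^ (n - k) * q.sqrt⁻¹) • etaII n (k + 1) (alpha q (k + 1) A₂ η)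
        + (q.lam⁻¹ * q.c ^ (-(n - k)) * q.sqrt) • etaII (n - 1) k (alpha q n A₁ η) ∧
    ((ρ.uq Uq.E ξ : ρ.dom) : SpaceII 𝒦)
      = -(q.lam⁻¹ * q.c ^ (n - k) * q.sqrt) • etaII n (k - 1) (alpha q k A₂ η)
        - (q.lam⁻¹ * q.c ^ (-(n - k)) * q.sqrt⁻¹) • etaII (n + 1) k (alpha q (n + 1) A₁ η)

end seriesII

open MeasureTheory

/-- The measure `y^{-2} dμ₀(y)` on `(q², 1]`, where `μ₀` on `[-1, -q²)` is transported to
`(q², 1]` by `y ↦ -y`. -/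
noncomputable def cellMeasure (μ₀ : Measure (NegCell q)) : Measure (PosCell q) :=
  (μ₀.map NegCell.reflect).withDensity fun y => ENNReal.ofReal ((y : ℝ) ^ (-2 : ℤ))

/-- The Hilbert space `𝒦 = L²((q², 1], y^{-2} dμ₀)`. -/
abbrev CellL2 (μ₀ : Measure (NegCell q)) : Type := Lp ℂ 2 (cellMeasure μ₀)

theorem memLp_mul_coord (m : Measure (PosCell q)) (ζ : Lp ℂ 2 m) :
    MemLp (fun y : PosCell q => ((y : ℝ) : ℂ) * ζ y) 2 m := by
  refine (Lp.memLp ζ).of_le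
    ((Complex.continuous_ofReal.comp continuous_subtype_val).aestronglyMeasurable.mul
      (Lp.aestronglyMeasurable ζ)) (ae_of_all _ fun y => ?_)
  have h0 : (0 : ℝ) ≤ y := (sq_nonneg _).trans y.2.1.le
  rw [norm_mul, Complex.norm_real, Real.norm_of_nonneg h0]
  exact mul_le_of_le_one_left (norm_nonneg _) y.2.2

/-- The operator `Q` of multiplication by the variable, `(Q ζ)(y) = y ζ(y)`, on
`L²((q², 1], m)`. -/
noncomputable def mulQ (m : Measure (PosCell q)) : Lp ℂ 2 m →L[ℂ] Lp ℂ 2 m :=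
  LinearMap.mkContinuous
    { toFun := fun ζ => (memLp_mul_coord m ζ).toLp _
      map_add' := fun ζ ζ' => by
        rw [← MemLp.toLp_add]
        refine MemLp.toLp_congr _ _ ?_
        filter_upwards [Lp.coeFn_add ζ ζ'] with y hy
        rw [hy, Pi.add_apply, Pi.add_apply, mul_add]
      map_smul' := fun c ζ => by
        rw [RingHom.id_apply, ← MemLp.toLp_const_smul]
        refine MemLp.toLp_congr _ _ ?_
        filter_upwards [Lp.coeFn_smul c ζ] with y hy
        rw [hy, Pi.smul_apply, Pi.smul_apply, mul_smul_comm] }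
    1
    (fun ζ => by
      rw [one_mul]
      refine Lp.norm_le_norm_of_ae_le ?_
      filter_upwards [MemLp.coeFn_toLp (memLp_mul_coord m ζ)] with y hy
      have h0 : (0 : ℝ) ≤ y := (sq_nonneg _).trans y.2.1.le
      show ‖(MemLp.toLp _ (memLp_mul_coord m ζ)) y‖ ≤ _
      rw [hy, norm_mul, Complex.norm_real, Real.norm_of_nonneg h0]
      exact mul_le_of_le_one_left (norm_nonneg _) y.2.2)

/-- The subspace of (classes of) bounded functions in `L²`. -/
def bddFunctions (m : Measure (PosCell q)) : Submodule ℂ (Lp ℂ 2 m) where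
  carrier := {ζ | ∃ C : ℝ, ∀ᵐ y ∂m, ‖ζ y‖ ≤ C}
  add_mem' := by
    rintro ζ ζ' ⟨C, hC⟩ ⟨C', hC'⟩
    refine ⟨C + C', ?_⟩
    filter_upwards [hC, hC', Lp.coeFn_add ζ ζ'] with y h h' hy
    rw [hy, Pi.add_apply]
    exact (norm_add_le _ _).trans (add_le_add h h')
  zero_mem' := ⟨0, by
    filter_upwards [Lp.coeFn_zero ℂ 2 m] with y hy
    rw [hy, Pi.zero_apply, norm_zero]⟩
  smul_mem' := by
    rintro c ζ ⟨C, hC⟩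
    refine ⟨‖c‖ * C, ?_⟩
    filter_upwards [hC, Lp.coeFn_smul c ζ] with y h hy
    rw [hy, Pi.smul_apply, norm_smul]
    exact mul_le_mul_of_nonneg_left h (norm_nonneg _)

/-- The positive square root `A^{1/2}` of a bounded positive operator `A`. -/
noncomputable def sqrtOp {𝒦 : Type} [NormedAddCommGroup 𝒦] [InnerProductSpace ℂ 𝒦]
    [CompleteSpace 𝒦] (A : 𝒦 →L[ℂ] 𝒦) : 𝒦 →L[ℂ] 𝒦 :=
  cfc Real.sqrt A

/-- The positive square root `Q^{1/2}` of the multiplication operator `Q` on `𝒦`. -/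
noncomputable def sqrtQ (μ₀ : Measure (NegCell q)) : CellL2 μ₀ →L[ℂ] CellL2 μ₀ :=
  sqrtOp (mulQ (cellMeasure μ₀))

end reps

end QDisc

open QDisc

/-!
The algebra `F_0(U_q)` has the elements `X_n f(y)` as spanning set, where `X_n = z^n` for `n ≥ 0` and
`X_n = (z*)^{-n}` for `n < 0`, so that a functional which vanishes off the diagonal is determined by
its values on functions of `y`.

*Invariance.* Invariance under `K` says that `h` lives on the diagonal, and given this, invariance
under `E` and `F` amounts to the two exchange rules `h(x z*) = q^{-2} h(z* x)` and
`h(x z) = q² h(z x)`, which are the scaling condition (`F0.isInvariant_iff`).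

*The Heisenberg action.* The assignment `f ⊗ a ↦ (x ↦ (a x) ◁ S⁻¹(f))` is a representation `F0.cross`
of the cross product algebra on `F_0(U_q)` (`F0.cross_mul`), and it is a `*`-representation for the
form `h(x* y)` of an invariant functional (`F0.starMul_cross`). Hence it descends to the range of any
linear map `φ` into a Hilbert space with dense range and `⟪φ x, φ y⟫ = h(x* y)`
(`StarRep.exists_isImage`), and two such images for the same `h` are unitarily equivalent
(`StarRep.IsImage.unitarilyEquivalent`). It remains to find good maps `φ`.

*Coordinates.* Let `T` be a space of representatives of orbits of the scaling `y ↦ q² y` (a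
`Fibre`). The value of the coefficient of `X_{n-k}` of `x` at the points `q^{2(k+1)} t`, multiplied by
the weight `∏ (1 - q^{2i} t)^{1/2}` over the indices `i` between `n` and `k`, is taken as the coordinate
of `x` at the position `(n, k)`. In these coordinates left and right multiplication by `z` and `z*`
are weighted shifts in `n` and in `k` with the weights of the series `(I.1)` and `(II.2)`
(`Fibre.coord_z_mul` and the three lemmas after it), and the form `h(x* y)` is the sum over all
positions of the inner products in `L²(T)` (`Fibre.Represents.hasSum_pair`). The functional `h_I`
is represented by the one-point fibre `{1}`, where the factor `1 - q^0` cuts the positions down to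
`n, k ≥ 0`, and `h_{μ₀}` is represented by the fibre `[-1, -q²)`. This gives positivity, scaling, and the
identification of the two Heisenberg representations with `(I.1)` and `(II.2)`. Since the points of
the two fibres lie on different sides of `0`, the two coordinate maps are jointly surjective
(`exists_toHilbert_eq`), so that the representation for `h_I + h_{μ₀}` is the direct sum.

*Passage to all of* `𝒦`. Each operator of the action is a linear combination of weighted shifts with
bounded weights (`Fibre.cross_mem_span`), so all operators converge along `(b_j)_{nk} → η_{nk}` if
`b_j → η` in `𝒦` with bounded `b_j`; by `StarRep.exists_extension` the representation extends.

*Measures.* If `h` is given by a measure `ν` on `(-∞, 0) ∪ {q^{2n} ; n ≥ 1}`, then `h(x* x)` is a sum of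
integrals of `|f_m|²` times a function which is nonnegative on this set
(`coc_nonneg_of_mem_posSupport`). The scaling condition transports `ν` from one cell
`q^{2k} [-1, -q²)` or point `q^{2k}` to the next, since `1 - y` is invertible there; this shows that `ν`
is determined by `y² dν` on `[-1, -q²)` and by `ν {q²}` (`eq_smul_hI_add_hMu`).
-/

open QDisc

namespace QDisc

/-! ### Coefficients of products -/

namespace FU

variable {q : Param}

theorem coeff_mono_mul (n m : ℤ) (f : LBorel) (x : FU q) :
    coeff n (mono m f * x) = coc q m (n - m) * shift q (n - m) f * coeff (n - m) x := by
  refine induction (P := fun x => coeff n (mono m f * x)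
    = coc q m (n - m) * shift q (n - m) f * coeff (n - m) x) (by simp) ?_ ?_ x
  · intro a b ha hb
    rw [mul_add, map_add, ha, hb, map_add, mul_add]
  · intro p g
    rw [mono_mul_mono, coeff_mono, coeff_mono]
    by_cases h : m + p = n
    · obtain rfl : p = n - m := by omega
      rw [if_pos h, if_pos rfl]
    · rw [if_neg h, if_neg (by omega), mul_zero]

theorem coeff_mul_mono (n m : ℤ) (g : LBorel) (x : FU q) :
    coeff n (x * mono m g) = coc q (n - m) m * shift q m (coeff (n - m) x) * g := by
  refine induction (P := fun x => coeff n (x * mono m g)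
    = coc q (n - m) m * shift q m (coeff (n - m) x) * g) (by simp) ?_ ?_ x
  · intro a b ha hb
    rw [add_mul, map_add, ha, hb, map_add, map_add, mul_add, add_mul]
  · intro p f
    rw [mono_mul_mono, coeff_mono, coeff_mono]
    by_cases h : p + m = n
    · obtain rfl : p = n - m := by omega
      rw [if_pos h, if_pos rfl]
    · rw [if_neg h, if_neg (by omega), map_zero, mul_zero, zero_mul]

theorem coeff_star (n : ℤ) (x : FU q) :
    coeff n (star x) = shift q n (star (coeff (-n) x)) := by
  refine induction (P := fun x => coeff n (star x) = shift q n (star (coeff (-n) x)))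
    (by simp) ?_ ?_ x
  · intro a b ha hb
    rw [star_add, map_add, ha, hb, map_add, star_add, map_add]
  · intro p f
    rw [star_mono, coeff_mono, coeff_mono]
    by_cases h : -p = n
    · subst h; simp
    · rw [if_neg h, if_neg (by omega), star_zero, map_zero]

theorem coeff_grade (c : ℂ) (hc : c ≠ 0) (n : ℤ) (x : FU q) :
    coeff n (grade c hc x) = c ^ n • coeff n x := by
  refine induction (P := fun x => coeff n (grade c hc x) = c ^ n • coeff n x) (by simp) ?_ ?_ x
  · intro a b ha hb
    rw [map_add, map_add, ha, hb, map_add, smul_add]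
  · intro p f
    rw [grade_mono, map_smul, coeff_mono]
    by_cases h : p = n
    · subst h; rfl
    · rw [if_neg h, smul_zero, smul_zero]

theorem star_grade (c : ℂ) (hc : c ≠ 0) (hr : (starRingEnd ℂ) c = c) (x : FU q) :
    star (grade c hc x) = grade c⁻¹ (inv_ne_zero hc) (star x) := by
  refine ext fun n => ?_
  rw [coeff_star, coeff_grade, coeff_grade, coeff_star, star_smul, map_smul, inv_zpow',
    ← starRingEnd_apply, map_zpow₀, hr]

end FU

namespace F0

variable {q : Param}

/-- The part of degree zero of an element of `F_0(U_q)`. -/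
noncomputable def diag (x : F0 q) : F0 q := ofFun (FU.coeff 0 x.1) (x.2 0)

theorem act_mul (x : F0 q) (f g : Uq q) : act x (f * g) = act (act x f) g :=
  Subtype.ext (FU.datum.act_mul x.1 f g)

theorem act_algebraMap (x : F0 q) (r : ℂ) : act x (algebraMap ℂ (Uq q) r) = r • x :=
  Subtype.ext (FU.datum.act_algebraMap x.1 r)

/-- An arbitrary linear extension of a functional on `F_0(U_q)` to `F(U_q)`. It is only evaluated
on `F_0(U_q)` and serves to avoid membership proofs. -/
noncomputable def extend (h : F0 q →ₗ[ℂ] ℂ) : FU q →ₗ[ℂ] ℂ := (LinearMap.exists_extend h).choose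

theorem extend_coe (h : F0 q →ₗ[ℂ] ℂ) (x : F0 q) : extend h x.1 = h x :=
  LinearMap.congr_fun (LinearMap.exists_extend h).choose_spec x

theorem extend_eq (h : F0 q →ₗ[ℂ] ℂ) {x : FU q} (hx : x ∈ F0 q) : extend h x = h ⟨x, hx⟩ :=
  extend_coe h ⟨x, hx⟩

theorem vanishesOffDiagonal_iff (h : F0 q →ₗ[ℂ] ℂ) :
    VanishesOffDiagonal h ↔ ∀ x : F0 q, FU.coeff 0 x.1 = 0 → h x = 0 := by
  constructor
  · intro hv x hx
    rw [← extend_coe, sum_mono x.1, map_sum]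
    refine Finset.sum_eq_zero fun n _ => ?_
    rw [extend_eq h (mono_mem n (x.2 n))]
    obtain ⟨k, rfl | rfl⟩ := n.eq_nat_or_neg
    · obtain rfl | hk := Nat.eq_zero_or_pos k
      · refine Eq.trans (congrArg h (Subtype.ext ?_)) (map_zero h)
        show FU.mono 0 (FU.coeff 0 x.1) = 0
        rw [hx, map_zero]
      · exact hv k hk (FU.coeff k x.1) _ (Or.inl (FU.z_pow_mul_ofFun _ _).symm)
    · obtain rfl | hk := Nat.eq_zero_or_pos k
      · refine Eq.trans (congrArg h (Subtype.ext ?_)) (map_zero h)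
        show FU.mono 0 (FU.coeff 0 x.1) = 0
        rw [hx, map_zero]
      · refine hv k hk (shift q k (FU.coeff (-k) x.1)) _ (Or.inr ?_)
        rw [FU.ofFun_mul_star_z_pow, shift_shift, neg_add_cancel, shift_zero]
  · rintro hv n hn f x (hx | hx)
    · refine hv x ?_
      rw [hx, FU.z_pow_mul_ofFun, FU.coeff_mono, if_neg (by omega)]
    · refine hv x ?_
      rw [hx, FU.ofFun_mul_star_z_pow, FU.coeff_mono, if_neg (by omega)]

theorem coeff_ofFun (f : LBorel) (hf : HasCompactSupport (f : PLine → ℂ)) :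
    FU.coeff 0 (ofFun f hf : F0 q).1 = f := by
  show FU.coeff 0 (FU.mono 0 f) = f
  rw [FU.coeff_mono, if_pos rfl]

theorem ofFun_congr {f g : LBorel} (hfg : f = g) (hf : HasCompactSupport (f : PLine → ℂ)) :
    (ofFun f hf : F0 q) = ofFun g (hfg ▸ hf) := by subst hfg; rfl

theorem map_diag {h : F0 q →ₗ[ℂ] ℂ} (hv : VanishesOffDiagonal h) (x : F0 q) : h x = h (diag x) := by
  rw [← sub_eq_zero, ← map_sub]
  refine (vanishesOffDiagonal_iff h).1 hv _ ?_
  rw [Submodule.coe_sub, map_sub, diag, coeff_ofFun, sub_self]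

theorem extend_eq_diag {h : F0 q →ₗ[ℂ] ℂ} (hv : VanishesOffDiagonal h) {x : FU q} (hx : x ∈ F0 q) :
    extend h x = h (ofFun (FU.coeff 0 x) (hx 0)) := by
  rw [extend_eq h hx, map_diag hv]; rfl

theorem extend_grade {h : F0 q →ₗ[ℂ] ℂ} (hv : VanishesOffDiagonal h) (c : ℂ) (hc : c ≠ 0)
    {x : FU q} (hx : x ∈ F0 q) : extend h (FU.grade c hc x) = extend h x := by
  rw [extend_eq_diag hv (grade_mem c hc hx), extend_eq_diag hv hx]
  congr 1
  refine ofFun_congr ?_ _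
  rw [FU.coeff_grade, zpow_zero, one_smul]

theorem lin_zero : lin q 0 = 1 - coordY := by simp [lin]

/-- In terms of `z`, the scaling condition says that `h(x z*) = q⁻² h(z* x)`. -/
theorem extend_mul_star_z {h : F0 q →ₗ[ℂ] ℂ} (hv : VanishesOffDiagonal h) (hs : ScalingCondition h)
    {x : FU q} (hx : x ∈ F0 q) :
    extend h (x * star FU.z) = q.c ^ (-2 : ℤ) * extend h (star FU.z * x) := by
  rw [extend_eq_diag hv (mul_right_mem hx _), extend_eq_diag hv (mul_left_mem _ hx)]
  have h1 : FU.coeff 0 (x * star FU.z) = shift q (-1) (FU.coeff 1 x * (1 - coordY)) := by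
    rw [FU.star_z, FU.coeff_mul_mono]
    show coc q 1 (-1) * shift q (-1) (FU.coeff 1 x) * 1 = _
    rw [FU.coc_neg_one_right le_rfl, map_mul, ← lin_zero (q := q), shift_lin, mul_one, mul_comm,
      zero_add]
  have h2 : FU.coeff 0 (star FU.z * x) = FU.coeff 1 x * (1 - coordY) := by
    rw [FU.star_z, FU.coeff_mono_mul]
    show coc q (-1) 1 * shift q 1 1 * FU.coeff 1 x = _
    rw [FU.coc_neg_one_pos le_rfl, map_one, mul_one, sub_self, ← lin_zero (q := q), mul_comm]
  rw [ofFun_congr h1, ofFun_congr h2]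
  exact hs _ (hx 1)

/-- In terms of `z`, the scaling condition says that `h(x z) = q² h(z x)`. -/
theorem extend_mul_z {h : F0 q →ₗ[ℂ] ℂ} (hv : VanishesOffDiagonal h) (hs : ScalingCondition h)
    {x : FU q} (hx : x ∈ F0 q) :
    extend h (x * FU.z) = q.c ^ (2 : ℤ) * extend h (FU.z * x) := by
  rw [extend_eq_diag hv (mul_right_mem hx _), extend_eq_diag hv (mul_left_mem _ hx)]
  have hc1 : coc q (-1) 1 = lin q 0 := by rw [FU.coc_neg_one_pos le_rfl, sub_self]
  have h1 : FU.coeff 0 (x * FU.z) = shift q 1 (FU.coeff (-1) x) * (1 - coordY) := by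
    rw [FU.z, FU.coeff_mul_mono]
    show coc q (-1) 1 * shift q 1 (FU.coeff (-1) x) * 1 = _
    rw [hc1, ← lin_zero (q := q), mul_one, mul_comm]
  have h2 : FU.coeff 0 (FU.z * x)
      = shift q (-1) (shift q 1 (FU.coeff (-1) x) * (1 - coordY)) := by
    rw [FU.z, FU.coeff_mono_mul]
    show coc q 1 (-1) * shift q (-1) 1 * FU.coeff (-1) x = _
    rw [FU.coc_neg_one_right le_rfl, map_mul, ← lin_zero (q := q), shift_lin, map_one, mul_one,
      mul_comm, zero_add, shift_shift, neg_add_cancel, shift_zero]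
  rw [ofFun_congr h1, ofFun_congr h2]
  rw [hs _ (hcs_shift (q := q) 1 (hx (-1))), ← mul_assoc, ← zpow_add₀ q.c_ne]
  simp

theorem grade_z (c : ℂ) (hc : c ≠ 0) : FU.grade c hc (FU.z : FU q) = c • FU.z := by
  rw [FU.z, FU.grade_mono, zpow_one]

theorem grade_star_z (c : ℂ) (hc : c ≠ 0) :
    FU.grade c hc (star FU.z : FU q) = c⁻¹ • star FU.z := by
  rw [FU.star_z, FU.grade_mono, zpow_neg_one]

theorem grade_grade_inv (c : ℂ) (hc : c ≠ 0) (x : FU q) :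
    FU.grade c hc (FU.grade c⁻¹ (inv_ne_zero hc) x) = x :=
  FU.grade_comp _ _ _ _ (mul_inv_cancel₀ hc) x

theorem grade_mul (c : ℂ) (hc : c ≠ 0) (x y : FU q) :
    FU.grade c hc (x * y) = FU.grade c hc x * FU.grade c hc y := map_mul _ x y

theorem extend_mul_grade {h : F0 q →ₗ[ℂ] ℂ} (hv : VanishesOffDiagonal h) (c : ℂ) (hc : c ≠ 0)
    (x : FU q) {y : FU q} (hy : y ∈ F0 q) :
    extend h (x * FU.grade c hc y) = extend h (FU.grade c⁻¹ (inv_ne_zero hc) x * y) := by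
  rw [← extend_grade hv c hc (x := FU.grade c⁻¹ (inv_ne_zero hc) x * y) (mul_left_mem _ hy),
    grade_mul, grade_grade_inv]

theorem extend_grade_mul {h : F0 q →ₗ[ℂ] ℂ} (hv : VanishesOffDiagonal h) (c : ℂ) (hc : c ≠ 0)
    {x : FU q} (y : FU q) (hx : x ∈ F0 q) :
    extend h (FU.grade c hc x * y) = extend h (x * FU.grade c⁻¹ (inv_ne_zero hc) y) := by
  rw [← extend_grade hv c hc (x := x * FU.grade c⁻¹ (inv_ne_zero hc) y) (mul_right_mem hx _),
    grade_mul, grade_grade_inv]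

theorem isInvariant_of {h : F0 q →ₗ[ℂ] ℂ} (hv : VanishesOffDiagonal h) (hs : ScalingCondition h) :
    IsInvariant h := by
  have hq := q.c_ne
  have hK : ∀ (c : ℂ) (hc : c ≠ 0) (x : F0 q), h ⟨FU.grade c hc x.1, grade_mem c hc x.2⟩ = h x := by
    intro c hc x
    rw [← extend_eq, extend_grade hv c hc x.2, extend_coe]
  intro x f
  refine Uq.induction (P := fun f => ∀ x, h (act x f) = Uq.counit f * h x)
    ?_ ?_ ?_ ?_ ?_ ?_ ?_ f x
  · intro r x; rw [act_algebraMap, map_smul, AlgHom.commutes]; rfl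
  · intro x
    have e : Uq.counit (Uq.E : Uq q) = 0 := by simp [Uq.counit]
    rw [e, zero_mul, ← extend_coe]
    show extend h (FU.act x.1 Uq.E) = 0
    rw [FU.act_E, map_smul, map_sub, extend_mul_grade hv _ _ _ x.2, extend_grade_mul hv _ _ _ x.2,
      grade_z, grade_z, smul_mul_assoc, mul_smul_comm, map_smul, map_smul, extend_mul_z hv hs x.2]
    simp only [smul_eq_mul, inv_inv]
    rw [show (2 : ℤ) = 1 + 1 by rfl, zpow_add₀ hq, zpow_one]
    field_simp
    ring
  · intro x
    have e : Uq.counit (Uq.F : Uq q) = 0 := by simp [Uq.counit]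
    rw [e, zero_mul, ← extend_coe]
    show extend h (FU.act x.1 Uq.F) = 0
    rw [FU.act_F, map_smul, map_sub, extend_mul_grade hv _ _ _ x.2, extend_grade_mul hv _ _ _ x.2,
      grade_star_z, grade_star_z, smul_mul_assoc, mul_smul_comm, map_smul, map_smul,
      extend_mul_star_z hv hs x.2]
    simp only [smul_eq_mul, inv_inv]
    rw [show (-2 : ℤ) = -1 + -1 by rfl, zpow_add₀ hq, zpow_neg_one]
    field_simp
    ring
  · intro x
    have e : Uq.counit (Uq.K : Uq q) = 1 := by simp [Uq.counit]
    rw [e, one_mul]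
    refine Eq.trans (congrArg h (Subtype.ext ?_)) (hK q.c⁻¹ (inv_ne_zero hq) x)
    exact FU.datum.act_K x.1
  · intro x
    have e : Uq.counit (Uq.Kinv : Uq q) = 1 := by simp [Uq.counit]
    rw [e, one_mul]
    refine Eq.trans (congrArg h (Subtype.ext ?_)) (hK q.c hq x)
    exact FU.datum.act_Kinv x.1
  · intro a b ha hb x
    rw [act_mul, hb, ha, map_mul]; ring
  · intro a b ha hb x
    rw [map_add, map_add, ha, hb, map_add, add_mul]

theorem vanishesOffDiagonal_of_isInvariant {h : F0 q →ₗ[ℂ] ℂ} (hi : IsInvariant h) :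
    VanishesOffDiagonal h := by
  have hq := q.c_ne
  have e : Uq.counit (Uq.K : Uq q) = 1 := by simp [Uq.counit]
  have key : ∀ (n : ℤ), n ≠ 0 → ∀ (x : F0 q), FU.act x.1 Uq.K = q.c ^ n • x.1 → h x = 0 := by
    intro n hn x hx
    have h1 := hi x Uq.K
    have h2 : act x Uq.K = q.c ^ n • x := Subtype.ext hx
    rw [h2, map_smul, e, one_mul, smul_eq_mul] at h1
    have h3 : q.c ^ n ≠ 1 := by
      intro h4
      have h5 : ((q : ℝ) ^ n : ℝ) = 1 := by
        have : (((q : ℝ) ^ n : ℝ) : ℂ) = 1 := by rw [← h4]; simp [Param.c]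
        exact_mod_cast this
      rw [zpow_eq_one_iff_right₀ q.pos.le q.lt_one.ne] at h5
      exact hn h5
    have h4 : (q.c ^ n - 1) * h x = 0 := by rw [sub_mul, h1]; ring
    exact (mul_eq_zero.1 h4).resolve_left (sub_ne_zero.2 h3)
  rintro n hn f x (hx | hx)
  · refine key (-n) (by omega) x ?_
    rw [hx, FU.z_pow_act_K, zpow_neg, zpow_natCast, inv_pow]
  · refine key n (by omega) x ?_
    rw [hx, FU.star_z_pow_act_K, zpow_natCast]

theorem scalingCondition_of_isInvariant {h : F0 q →ₗ[ℂ] ℂ} (hi : IsInvariant h) :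
    ScalingCondition h := by
  intro f hf
  have hq := q.c_ne
  have e : Uq.counit (Uq.F : Uq q) = 0 := by simp [Uq.counit]
  have h1 := hi ⟨FU.mono 1 f, mono_mem 1 hf⟩ Uq.F
  rw [e, zero_mul, ← extend_coe] at h1
  -- the scaling condition for `f` is invariance under `F`, tested on `z f(y)`
  change extend h (FU.act (FU.mono 1 f) Uq.F) = 0 at h1
  rw [FU.act_F, FU.grade_mono, FU.grade_mono, zpow_one, zpow_one, FU.star_z, smul_mul_assoc,
    mul_smul_comm, FU.mono_mul_mono, FU.mono_mul_mono, FU.coc_neg_one_right le_rfl,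
    FU.coc_neg_one_pos le_rfl, map_smul, map_sub, map_smul, map_smul] at h1
  have e1 : (FU.mono (1 + -1) (lin q (-1) * shift q (-1) f * 1) : FU q)
      = (ofFun (shift q (-1) (f * (1 - coordY))) (hcs_shift (-1) hf.mul_right) : F0 q).1 := by
    show _ = FU.mono 0 _
    rw [map_mul (shift q (-1)), ← lin_zero (q := q), shift_lin, mul_one, mul_comm]
    rfl
  have e2 : (FU.mono (-1 + 1) (lin q (1 - 1) * shift q 1 1 * f) : FU q)
      = (ofFun (f * (1 - coordY)) hf.mul_right : F0 q).1 := by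
    show _ = FU.mono 0 _
    rw [map_one, ← lin_zero (q := q), mul_one, mul_comm]
    rfl
  rw [e1, e2, extend_coe, extend_coe] at h1
  simp only [smul_eq_mul] at h1
  have h2 := (mul_eq_zero.1 h1).resolve_left
    (mul_ne_zero (inv_ne_zero q.sqrt_ne) (inv_ne_zero q.lam_ne))
  rw [sub_eq_zero] at h2
  rw [show (-2 : ℤ) = -1 + -1 by rfl, zpow_add₀ hq, zpow_neg_one, mul_assoc, ← h2, ← mul_assoc,
    inv_mul_cancel₀ hq, one_mul]

theorem isInvariant_iff (h : F0 q →ₗ[ℂ] ℂ) :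
    IsInvariant h ↔ VanishesOffDiagonal h ∧ ScalingCondition h :=
  ⟨fun hi => ⟨vanishesOffDiagonal_of_isInvariant hi, scalingCondition_of_isInvariant hi⟩,
    fun hi => isInvariant_of hi.1 hi.2⟩

end F0

/-! ### The cross product action -/

namespace Uq

variable {q : Param}

theorem antipodeInv_mul (f g : Uq q) : antipodeInv (f * g) = antipodeInv g * antipodeInv f := by
  simp only [antipodeInv, map_mul, MulOpposite.unop_mul]

theorem antipodeInv_algebraMap (r : ℂ) :
    antipodeInv (algebraMap ℂ (Uq q) r) = algebraMap ℂ (Uq q) r := by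
  simp only [antipodeInv, AlgHom.commutes]; rfl

theorem antipodeInv_E : antipodeInv (E : Uq q) = -(q.c⁻¹ • E) := by
  simp [antipodeInv, antipodeInvHom]

theorem antipodeInv_F : antipodeInv (F : Uq q) = -(q.c • F) := by
  simp [antipodeInv, antipodeInvHom]

theorem antipodeInv_K : antipodeInv (K : Uq q) = Kinv := by
  simp [antipodeInv, antipodeInvHom]

theorem antipodeInv_Kinv : antipodeInv (Kinv : Uq q) = K := by
  simp [antipodeInv, antipodeInvHom]

/-- `S⁻¹` as a linear map. -/
noncomputable def antipodeInvLin : Uq q →ₗ[ℂ] Uq q :=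
  (MulOpposite.opLinearEquiv ℂ).symm.toLinearMap ∘ₗ antipodeInvHom.toLinearMap

theorem antipodeInv_add (f g : Uq q) : antipodeInv (f + g) = antipodeInv f + antipodeInv g :=
  map_add antipodeInvLin f g

theorem antipodeInv_smul (c : ℂ) (f : Uq q) : antipodeInv (c • f) = c • antipodeInv f :=
  map_smul antipodeInvLin c f

theorem comul_E : comul (E : Uq q) = E ⊗ₜ K + Kinv ⊗ₜ E := by simp [comul]
theorem comul_F : comul (F : Uq q) = F ⊗ₜ K + Kinv ⊗ₜ F := by simp [comul]
theorem comul_K : comul (K : Uq q) = K ⊗ₜ K := by simp [comul]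
theorem comul_Kinv : comul (Kinv : Uq q) = Kinv ⊗ₜ Kinv := by simp [comul]

theorem star_E : star (E : Uq q) = -F := by simp [star_def, starHom]
theorem star_F : star (F : Uq q) = -E := by simp [star_def, starHom]
theorem star_K : star (K : Uq q) = K := by simp [star_def, starHom]
theorem star_Kinv : star (Kinv : Uq q) = Kinv := by simp [star_def, starHom]

end Uq

namespace DiscDatum

variable {q : Param} {A : Type} [Ring A] [Algebra ℂ A] (D : DiscDatum q A)

/-- The map `g ⊗ f ↦ ((x ◁ f) w) ◁ S⁻¹(g)`. -/
noncomputable def twist (x w : A) : Uq q ⊗[ℂ] Uq q →ₗ[ℂ] A :=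
  TensorProduct.lift (LinearMap.mk₂ ℂ (fun g f => D.act (D.act x f * w) (Uq.antipodeInv g))
    (fun g g' f => by rw [Uq.antipodeInv_add, map_add])
    (fun c g f => by rw [Uq.antipodeInv_smul, map_smul])
    (fun g f f' => by rw [map_add, add_mul, map_add, LinearMap.add_apply])
    (fun c g f => by rw [map_smul, smul_mul_assoc, map_smul, LinearMap.smul_apply]))

theorem twist_tmul (x w : A) (g f : Uq q) :
    D.twist x w (g ⊗ₜ f) = D.act (D.act x f * w) (Uq.antipodeInv g) := rfl

theorem twist_tmul_mul (x w : A) (g f : Uq q) (s : Uq q ⊗[ℂ] Uq q) :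
    D.twist x w ((g ⊗ₜ f) * s) = D.act (D.twist (D.act x f) w s) (Uq.antipodeInv g) := by
  induction s with
  | zero => simp
  | add a b ha hb => rw [mul_add, map_add, ha, hb, map_add, map_add, LinearMap.add_apply]
  | tmul a b =>
    rw [Algebra.TensorProduct.tmul_mul_tmul, twist_tmul, twist_tmul, Uq.antipodeInv_mul, act_mul,
      act_mul]

/-- The identity `x (w ◁ S⁻¹(f)) = ((x ◁ f₍₂₎) w) ◁ S⁻¹(f₍₁₎)` of module algebras. It makes the
Heisenberg action a representation of the cross product algebra. -/
theorem mul_act_antipodeInv (f : Uq q) : ∀ x w : A,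
    x * D.act w (Uq.antipodeInv f) = D.twist x w (Uq.comul f) := by
  have hq := q.c_ne
  refine Uq.induction (P := fun f => ∀ x w : A,
    x * D.act w (Uq.antipodeInv f) = D.twist x w (Uq.comul f)) ?_ ?_ ?_ ?_ ?_ ?_ ?_ f
  · intro r x w
    rw [Uq.antipodeInv_algebraMap, act_algebraMap, AlgHom.commutes,
      Algebra.TensorProduct.algebraMap_apply, twist_tmul, Uq.antipodeInv_algebraMap, act_algebraMap,
      ← map_one (algebraMap ℂ (Uq q)), act_algebraMap, one_smul, mul_smul_comm]
  · intro x w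
    rw [Uq.antipodeInv_E, Uq.comul_E, map_add, twist_tmul, twist_tmul, Uq.antipodeInv_E,
      Uq.antipodeInv_Kinv, map_neg, map_neg, map_smul, map_smul, act_E, act_E, act_K, act_K, act_E,
      opE_apply, opE_apply, opE_apply]
    simp only [map_mul, map_sub, map_smul, D.k_z, D.kinv_k, D.k_kinv, smul_mul_assoc, mul_smul_comm,
      mul_sub, sub_mul, smul_sub, smul_smul, mul_neg, mul_assoc]
    module
  · intro x w
    rw [Uq.antipodeInv_F, Uq.comul_F, map_add, twist_tmul, twist_tmul, Uq.antipodeInv_F,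
      Uq.antipodeInv_Kinv, map_neg, map_neg, map_smul, map_smul, act_F, act_F, act_K, act_K, act_F,
      opF_apply, opF_apply, opF_apply]
    simp only [map_mul, map_sub, map_smul, D.k_zs, D.kinv_k, D.k_kinv, smul_mul_assoc,
      mul_smul_comm, mul_sub, sub_mul, smul_sub, smul_smul, mul_neg, mul_assoc]
    module
  · intro x w
    rw [Uq.antipodeInv_K, Uq.comul_K, twist_tmul, Uq.antipodeInv_K, act_Kinv, act_Kinv, act_K,
      map_mul, D.kinv_k]
  · intro x w
    rw [Uq.antipodeInv_Kinv, Uq.comul_Kinv, twist_tmul, Uq.antipodeInv_Kinv, act_Kinv, act_K, act_K,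
      map_mul, D.k_kinv]
  · intro f g hf hg x w
    rw [Uq.antipodeInv_mul, act_mul, hf, map_mul]
    generalize Uq.comul f = t
    induction t with
    | zero => simp
    | add a b ha hb => rw [add_mul, map_add, map_add, ha, hb]
    | tmul a b => rw [twist_tmul_mul, twist_tmul, ← hg]
  · intro f g hf hg x w
    rw [Uq.antipodeInv_add, map_add, mul_add, hf, hg, map_add, map_add]

end DiscDatum

namespace F0

variable {q : Param}

theorem incl_z : incl (Disc.z : Disc q) = FU.z := Disc.lift_z ..
theorem incl_zs : incl (Disc.zs : Disc q) = star FU.z := Disc.lift_zs ..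

theorem incl_star (a : Disc q) : incl (star a) = star (incl a) := by
  refine Disc.induction (P := fun a => incl (star a) = star (incl a)) ?_ ?_ ?_ ?_ ?_ a
  · intro r
    rw [AlgHom.commutes, Algebra.algebraMap_eq_smul_one, Algebra.algebraMap_eq_smul_one, star_smul,
      star_smul, map_smul, star_one, star_one, map_one]
  · rw [Disc.star_z, incl_zs, incl_z]
  · rw [← Disc.star_z, star_star, incl_z, Disc.star_z, incl_zs, star_star]
  · intro a b ha hb; rw [star_mul, map_mul, ha, hb, map_mul, star_mul]
  · intro a b ha hb; rw [star_add, map_add, ha, hb, map_add, star_add]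

theorem incl_k (a : Disc q) : incl (Disc.datum.k a) = FU.datum.k (incl a) := by
  refine Disc.induction (P := fun a => incl (Disc.datum.k a) = FU.datum.k (incl a)) ?_ ?_ ?_ ?_ ?_ a
  · intro r; simp only [AlgHom.commutes]
  · rw [incl_z]
    refine (congrArg incl Disc.datum.k_z).trans ?_
    rw [map_smul]
    exact (congrArg _ incl_z).trans FU.datum.k_z.symm
  · rw [incl_zs]
    refine (congrArg incl Disc.datum.k_zs).trans ?_
    rw [map_smul]
    exact (congrArg _ incl_zs).trans FU.datum.k_zs.symm
  · intro a b ha hb; simp only [map_mul, ha, hb]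
  · intro a b ha hb; simp only [map_add, ha, hb]

theorem incl_kinv (a : Disc q) : incl (Disc.datum.kinv a) = FU.datum.kinv (incl a) := by
  rw [← FU.datum.kinv_k (incl (Disc.datum.kinv a)), ← incl_k, Disc.datum.k_kinv]

theorem incl_act (a : Disc q) (f : Uq q) : incl (Disc.act a f) = FU.act (incl a) f := by
  refine Uq.induction (P := fun f => ∀ a, incl (Disc.act a f) = FU.act (incl a) f)
    ?_ ?_ ?_ ?_ ?_ ?_ ?_ f a
  · intro r a
    refine (congrArg incl (Disc.datum.act_algebraMap a r)).trans ?_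
    rw [map_smul]
    exact (FU.datum.act_algebraMap _ r).symm
  · intro a
    refine (congrArg incl (Disc.datum.act_E a)).trans ((?_ : _ = _).trans (FU.datum.act_E _).symm)
    rw [DiscDatum.opE_apply, DiscDatum.opE_apply, map_smul, map_sub, map_mul, map_mul, incl_k,
      incl_kinv]
    exact congrArg (fun t => _ • (t * _ - _ * t)) incl_z
  · intro a
    refine (congrArg incl (Disc.datum.act_F a)).trans ((?_ : _ = _).trans (FU.datum.act_F _).symm)
    rw [DiscDatum.opF_apply, DiscDatum.opF_apply, map_smul, map_sub, map_mul, map_mul, incl_k,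
      incl_kinv]
    exact congrArg (fun t => _ • (_ * t - t * _)) incl_zs
  · intro a
    exact (congrArg incl (Disc.datum.act_K a)).trans ((incl_k a).trans (FU.datum.act_K _).symm)
  · intro a
    exact (congrArg incl (Disc.datum.act_Kinv a)).trans
      ((incl_kinv a).trans (FU.datum.act_Kinv _).symm)
  · intro f g hf hg a
    refine (congrArg incl (Disc.datum.act_mul a f g)).trans
      ((?_ : _ = _).trans (FU.datum.act_mul _ f g).symm)
    exact (hg _).trans (congrArg (fun t => FU.act t g) (hf a))
  · intro f g hf hg a
    rw [map_add, map_add, map_add, hf, hg]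

/-- The action `f ↦ (x ↦ x ◁ S⁻¹(f))` of `U_q(su_{1,1})` on `F_0(U_q)`. -/
noncomputable def uqEnd : Uq q →ₗ[ℂ] Module.End ℂ (F0 q) := act.flip ∘ₗ Uq.antipodeInvLin

theorem uqEnd_apply (f : Uq q) (x : F0 q) : uqEnd f x = act x (Uq.antipodeInv f) := rfl

/-- The action of `O(U_q)` on `F_0(U_q)` by left multiplication. -/
noncomputable def discEnd : Disc q →ₗ[ℂ] Module.End ℂ (F0 q) :=
  LinearMap.mk₂ ℂ lmul
    (fun a b x => Subtype.ext (by
      show incl (a + b) * x.1 = incl a * x.1 + incl b * x.1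
      rw [map_add, add_mul]))
    (fun c a x => Subtype.ext (by
      show incl (c • a) * x.1 = c • (incl a * x.1)
      rw [map_smul, smul_mul_assoc]))
    (fun a x y => Subtype.ext (mul_add _ _ _))
    (fun c a x => Subtype.ext (mul_smul_comm _ _ _))

/-- The Heisenberg action `f ⊗ a ↦ (x ↦ (a x) ◁ S⁻¹(f))` on `F_0(U_q)`. -/
noncomputable def cross : CrossSpace q →ₗ[ℂ] Module.End ℂ (F0 q) :=
  TensorProduct.lift (LinearMap.mk₂ ℂ (fun f a => uqEnd f * discEnd a)
    (fun f f' a => by rw [map_add, add_mul])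
    (fun c f a => by rw [map_smul, smul_mul_assoc])
    (fun f a a' => by rw [map_add, mul_add])
    (fun c f a => by rw [map_smul, mul_smul_comm]))

theorem cross_tmul (f : Uq q) (a : Disc q) : cross (f ⊗ₜ a) = uqEnd f * discEnd a := rfl

theorem cross_tmul_apply (f : Uq q) (a : Disc q) (x : F0 q) :
    cross (f ⊗ₜ a) x = act (lmul a x) (Uq.antipodeInv f) := rfl

theorem uqEnd_mul (f g : Uq q) : uqEnd (f * g) = uqEnd f * uqEnd g := by
  ext x : 1
  rw [uqEnd_apply, Uq.antipodeInv_mul, act_mul]; rfl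

theorem uqEnd_algebraMap (r : ℂ) :
    uqEnd (algebraMap ℂ (Uq q) r) = algebraMap ℂ (Module.End ℂ (F0 q)) r := by
  ext x : 1
  rw [uqEnd_apply, Uq.antipodeInv_algebraMap, act_algebraMap]; rfl

theorem discEnd_mul (a b : Disc q) : discEnd (a * b) = discEnd a * discEnd b := by
  ext x : 1
  refine Subtype.ext ?_
  show incl (a * b) * x.1 = incl a * (incl b * x.1)
  rw [map_mul, mul_assoc]

theorem discEnd_algebraMap (r : ℂ) :
    discEnd (algebraMap ℂ (Disc q) r) = algebraMap ℂ (Module.End ℂ (F0 q)) r := by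
  ext x : 1
  refine Subtype.ext ?_
  show incl (algebraMap ℂ _ r) * x.1 = r • x.1
  rw [AlgHom.commutes, Algebra.smul_def]

theorem cross_one : cross ((1 : Uq q) ⊗ₜ (1 : Disc q)) = 1 := by
  rw [cross_tmul, ← map_one (algebraMap ℂ (Uq q)), ← map_one (algebraMap ℂ (Disc q)),
    uqEnd_algebraMap, discEnd_algebraMap, map_one, mul_one]

/-- The commutation rule `a (w ◁ S⁻¹(f)) = ((a ◁ f₍₂₎) w) ◁ S⁻¹(f₍₁₎)` on `F_0(U_q)`, with an
additional factor `a'`. -/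
theorem cross_map_comul (a a' : Disc q) (g f : Uq q) :
    cross (TensorProduct.map (LinearMap.mulLeft ℂ g)
      (LinearMap.mulRight ℂ a' ∘ₗ Disc.act a) (Uq.comul f))
      = uqEnd g * discEnd a * (uqEnd f * discEnd a') := by
  ext x : 1
  have h1 : discEnd a ((uqEnd f * discEnd a') x)
      = ⟨FU.datum.twist (incl a) (incl a' * x.1) (Uq.comul f), by
        rw [← DiscDatum.mul_act_antipodeInv]
        exact mul_left_mem _ (act_mem (mul_left_mem _ x.2) _)⟩ :=
    Subtype.ext (DiscDatum.mul_act_antipodeInv FU.datum f (incl a) (incl a' * x.1))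
  have h2 : ∀ t : Uq q ⊗[ℂ] Uq q, (cross (TensorProduct.map (LinearMap.mulLeft ℂ g)
      (LinearMap.mulRight ℂ a' ∘ₗ Disc.act a) t) x).1
      = FU.act (FU.datum.twist (incl a) (incl a' * x.1) t) (Uq.antipodeInv g) := by
    intro t
    induction t with
    | zero => simp
    | add s t hs ht =>
      rw [map_add, map_add, LinearMap.add_apply, Submodule.coe_add, hs, ht, map_add, map_add,
        LinearMap.add_apply]
    | tmul s t =>
      rw [TensorProduct.map_tmul, cross_tmul_apply, DiscDatum.twist_tmul]
      show FU.act (incl (Disc.act a t * a') * x.1) (Uq.antipodeInv (g * s)) = _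
      rw [Uq.antipodeInv_mul, map_mul incl, incl_act, mul_assoc]
      exact FU.datum.act_mul _ _ _
  refine Subtype.ext ((h2 _).trans ?_)
  rw [mul_assoc]
  show _ = (uqEnd g (discEnd a ((uqEnd f * discEnd a') x))).1
  rw [h1]; rfl

theorem cross_mul (a b : CrossSpace q) : cross (CrossSpace.mul a b) = cross a * cross b := by
  induction a using TensorProduct.induction_on with
  | zero => simp
  | add a a' ha ha' => rw [map_add, LinearMap.add_apply, map_add, ha, ha', map_add, add_mul]
  | tmul g a =>
    induction b using TensorProduct.induction_on with
    | zero => simp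
    | add b b' hb hb' => rw [map_add, map_add, hb, hb', map_add, mul_add]
    | tmul f b => rw [CrossSpace.mul_tmul_tmul, cross_map_comul, cross_tmul, cross_tmul]

theorem cross_conj_tmul (f : Uq q) (a : Disc q) :
    cross (CrossSpace.conj (f ⊗ₜ a)) = discEnd (star a) * uqEnd (star f) := by
  have h := cross_map_comul (star a) 1 1 (star f)
  have e1 : LinearMap.mulLeft ℂ (1 : Uq q) = LinearMap.id := by ext; simp
  have e2 : LinearMap.mulRight ℂ (1 : Disc q) ∘ₗ Disc.act (star a) = Disc.act (star a) := by
    ext; simp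
  have e3 : uqEnd (1 : Uq q) = 1 := by
    rw [← map_one (algebraMap ℂ (Uq q)), uqEnd_algebraMap, map_one]
  have e4 : discEnd (1 : Disc q) = 1 := by
    rw [← map_one (algebraMap ℂ (Disc q)), discEnd_algebraMap, map_one]
  rw [CrossSpace.conj_tmul]
  rwa [e1, e2, e3, e4, one_mul, mul_one] at h

/-- The action of `U_q(su_{1,1})` is a `*`-action for the form `h(x* y)` of an invariant `h`. -/
theorem starMul_uqEnd {h : F0 q →ₗ[ℂ] ℂ} (hv : VanishesOffDiagonal h) (hs : ScalingCondition h)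
    (f : Uq q) : ∀ x y : F0 q, h (starMul (uqEnd f x) y) = h (starMul x (uqEnd (star f) y)) := by
  have hq := q.c_ne
  have e2 : q.c ^ (2 : ℤ) = q.c * q.c := by rw [show (2 : ℤ) = 1 + 1 by rfl, zpow_add₀ hq, zpow_one]
  have e3 : q.c ^ (-2 : ℤ) = q.c⁻¹ * q.c⁻¹ := by
    rw [show (-2 : ℤ) = -1 + -1 by rfl, zpow_add₀ hq, zpow_neg_one]
  have hci : (starRingEnd ℂ) q.c⁻¹ = q.c⁻¹ := by rw [map_inv₀, q.conj_c]
  have hl : ∀ x y : F0 q, h (starMul x y) = extend h (star x.1 * y.1) :=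
    fun x y => (extend_coe h _).symm
  refine Uq.induction (P := fun f => ∀ x y : F0 q,
    h (starMul (uqEnd f x) y) = h (starMul x (uqEnd (star f) y))) ?_ ?_ ?_ ?_ ?_ ?_ ?_ f
  · intro r x y
    have e : star (algebraMap ℂ (Uq q) r) = algebraMap ℂ (Uq q) (starRingEnd ℂ r) := by
      rw [Algebra.algebraMap_eq_smul_one, Algebra.algebraMap_eq_smul_one, star_smul, star_one]; rfl
    rw [e, uqEnd_algebraMap, uqEnd_algebraMap]
    show h (starMul (r • x) y) = h (starMul x ((starRingEnd ℂ r) • y))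
    rw [starMul_smul_left, starMul_smul_right]
  · intro x y
    have hx : (uqEnd Uq.E x).1 = -(q.c⁻¹ • FU.act x.1 Uq.E) := by
      rw [uqEnd_apply, Uq.antipodeInv_E, map_neg, map_smul]; rfl
    have hy : (uqEnd (star Uq.E) y).1 = q.c • FU.act y.1 Uq.F := by
      rw [Uq.star_E, map_neg, LinearMap.neg_apply, uqEnd_apply, Uq.antipodeInv_F, map_neg, neg_neg,
        map_smul]; rfl
    have hmem : ∀ a : FU q, a * y.1 ∈ F0 q := fun a => mul_left_mem a y.2
    rw [hl, hl, hx, hy, FU.act_E, FU.act_F]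
    simp only [star_neg, star_smul, star_sub, star_mul, FU.star_grade _ hq q.conj_c,
      FU.star_grade _ (inv_ne_zero hq) hci, inv_inv]
    simp only [← starRingEnd_apply, map_inv₀, q.conj_c, q.conj_sqrt, q.conj_lam, mul_sub,
      sub_mul, smul_mul_assoc, mul_smul_comm, neg_mul, map_neg, map_smul, map_sub, smul_eq_mul]
    have t1 : extend h (star x.1 * (star FU.z * FU.grade q.c⁻¹ (inv_ne_zero hq) y.1))
        = q.c⁻¹ * extend h (FU.grade q.c hq (star x.1) * (star FU.z * y.1)) := by
      rw [← mul_assoc, extend_mul_grade hv _ _ _ y.2, grade_mul]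
      simp only [inv_inv]
      rw [grade_star_z, mul_smul_comm, smul_mul_assoc, map_smul, smul_eq_mul, mul_assoc]
    have t2 : extend h (star x.1 * (FU.grade q.c hq y.1 * star FU.z))
        = q.c⁻¹ * extend h (star FU.z * FU.grade q.c⁻¹ (inv_ne_zero hq) (star x.1) * y.1) := by
      rw [← mul_assoc, extend_mul_star_z hv hs (mul_left_mem _ (grade_mem _ _ y.2)), ← mul_assoc,
        extend_mul_grade hv _ _ _ y.2, grade_mul, grade_star_z, inv_inv, smul_mul_assoc,
        smul_mul_assoc, map_smul, smul_eq_mul, e3, mul_assoc q.c⁻¹ q.c⁻¹, ← mul_assoc q.c⁻¹ q.c,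
        inv_mul_cancel₀ hq, one_mul]
    rw [t1, t2, mul_assoc (FU.grade q.c hq (star x.1))]
    have hsq := q.sqrt_ne
    have hss : q.sqrt * q.sqrt = q.c := by
      unfold Param.sqrt Param.c
      rw [← Complex.ofReal_mul, Real.mul_self_sqrt q.pos.le]
    field_simp
    rw [show q.sqrt ^ 2 = q.c by rw [pow_two, hss]]
    ring
  · intro x y
    have hx : (uqEnd Uq.F x).1 = -(q.c • FU.act x.1 Uq.F) := by
      rw [uqEnd_apply, Uq.antipodeInv_F, map_neg, map_smul]; rfl
    have hy : (uqEnd (star Uq.F) y).1 = q.c⁻¹ • FU.act y.1 Uq.E := by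
      rw [Uq.star_F, map_neg, LinearMap.neg_apply, uqEnd_apply, Uq.antipodeInv_E, map_neg, neg_neg,
        map_smul]; rfl
    rw [hl, hl, hx, hy, FU.act_E, FU.act_F]
    simp only [star_neg, star_smul, star_sub, star_mul, star_star, FU.star_grade _ hq q.conj_c,
      FU.star_grade _ (inv_ne_zero hq) hci, inv_inv]
    simp only [← starRingEnd_apply, map_inv₀, q.conj_c, q.conj_sqrt, q.conj_lam, mul_sub,
      sub_mul, smul_mul_assoc, mul_smul_comm, neg_mul, map_neg, map_smul, map_sub, smul_eq_mul]
    have t1 : extend h (star x.1 * (FU.z * FU.grade q.c⁻¹ (inv_ne_zero hq) y.1))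
        = q.c * extend h (FU.grade q.c hq (star x.1) * (FU.z * y.1)) := by
      rw [← mul_assoc, extend_mul_grade hv _ _ _ y.2, grade_mul]
      simp only [inv_inv]
      rw [grade_z, mul_smul_comm, smul_mul_assoc, map_smul, smul_eq_mul, mul_assoc]
    have t2 : extend h (star x.1 * (FU.grade q.c hq y.1 * FU.z))
        = q.c * extend h (FU.z * FU.grade q.c⁻¹ (inv_ne_zero hq) (star x.1) * y.1) := by
      rw [← mul_assoc, extend_mul_z hv hs (mul_left_mem _ (grade_mem _ _ y.2)), ← mul_assoc,
        extend_mul_grade hv _ _ _ y.2, grade_mul, grade_z, smul_mul_assoc,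
        smul_mul_assoc, map_smul, smul_eq_mul, e2, mul_assoc q.c q.c, ← mul_assoc q.c q.c⁻¹,
        mul_inv_cancel₀ hq, one_mul]
    rw [t1, t2, mul_assoc (FU.grade q.c hq (star x.1))]
    have hsq := q.sqrt_ne
    have hss : q.sqrt * q.sqrt = q.c := by
      unfold Param.sqrt Param.c
      rw [← Complex.ofReal_mul, Real.mul_self_sqrt q.pos.le]
    field_simp
    rw [show q.sqrt ^ 2 = q.c by rw [pow_two, hss]]
    ring
  · intro x y
    have hx : (uqEnd Uq.K x).1 = FU.grade q.c hq x.1 := by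
      rw [uqEnd_apply, Uq.antipodeInv_K]; exact FU.datum.act_Kinv x.1
    have hy : (uqEnd (star Uq.K) y).1 = FU.grade q.c hq y.1 := by
      rw [Uq.star_K, uqEnd_apply, Uq.antipodeInv_K]; exact FU.datum.act_Kinv y.1
    rw [hl, hl, hx, hy, FU.star_grade _ hq q.conj_c, extend_mul_grade hv _ _ _ y.2]
  · intro x y
    have hx : (uqEnd Uq.Kinv x).1 = FU.grade q.c⁻¹ (inv_ne_zero hq) x.1 := by
      rw [uqEnd_apply, Uq.antipodeInv_Kinv]; exact FU.datum.act_K x.1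
    have hy : (uqEnd (star Uq.Kinv) y).1 = FU.grade q.c⁻¹ (inv_ne_zero hq) y.1 := by
      rw [Uq.star_Kinv, uqEnd_apply, Uq.antipodeInv_Kinv]; exact FU.datum.act_K y.1
    rw [hl, hl, hx, hy, FU.star_grade _ (inv_ne_zero hq) hci, extend_mul_grade hv _ _ _ y.2]
  · intro f g hf hg x y
    rw [star_mul, uqEnd_mul, uqEnd_mul]
    exact (hf _ _).trans (hg _ _)
  · intro f g hf hg x y
    rw [star_add, map_add, map_add]
    show h (starMul (uqEnd f x + uqEnd g x) y)
      = h (starMul x (uqEnd (star f) y + uqEnd (star g) y))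
    rw [starMul_add_left, starMul_add_right, map_add, map_add, hf, hg]

/-- The Heisenberg action is a `*`-action for the form `h(x* y)` of an invariant `h`. -/
theorem starMul_cross {h : F0 q →ₗ[ℂ] ℂ} (hv : VanishesOffDiagonal h) (hs : ScalingCondition h)
    (a : CrossSpace q) (x y : F0 q) :
    h (starMul (cross a x) y) = h (starMul x (cross (CrossSpace.conj a) y)) := by
  induction a using TensorProduct.induction_on with
  | zero =>
    rw [map_zero, map_zero, map_zero]
    congr 1
    refine Subtype.ext ?_
    show star (0 : FU q) * y.1 = star x.1 * 0
    rw [star_zero, zero_mul, mul_zero]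
  | add a b ha hb =>
    rw [map_add, map_add, map_add, LinearMap.add_apply, LinearMap.add_apply, starMul_add_left,
      starMul_add_right, map_add, map_add, ha, hb]
  | tmul f a =>
    rw [cross_conj_tmul, cross_tmul]
    refine (starMul_uqEnd hv hs f (discEnd a x) y).trans ?_
    congr 1
    refine Subtype.ext ?_
    show star (incl a * x.1) * _ = star x.1 * (incl (star a) * _)
    rw [star_mul, incl_star, mul_assoc]

end F0

/-! ### Realizations of the Heisenberg action in a Hilbert space -/

namespace StarRep

open scoped InnerProductSpace
open Filter Topology

variable {q : Param} {H H₁ H₂ : Type} [NormedAddCommGroup H] [InnerProductSpace ℂ H]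
  [NormedAddCommGroup H₁] [InnerProductSpace ℂ H₁] [NormedAddCommGroup H₂]
  [InnerProductSpace ℂ H₂]

/-- `ρ` is the image of the Heisenberg action on `F_0(U_q)` under the linear map `φ`. -/
def IsImage (ρ : StarRep q H) (φ : F0 q →ₗ[ℂ] H) : Prop :=
  ρ.dom = LinearMap.range φ ∧ ∀ (a : CrossSpace q) (x : F0 q) (ξ : ρ.dom), (ξ : H) = φ x →
    ((ρ.op a ξ : ρ.dom) : H) = φ (F0.cross a x)

/-- If `φ` has dense range and carries the form `h(x* y)` of an invariant functional to the inner
product, then the Heisenberg action descends to the range of `φ`. -/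
theorem exists_isImage {h : F0 q →ₗ[ℂ] ℂ} (hv : F0.VanishesOffDiagonal h)
    (hs : F0.ScalingCondition h) (φ : F0 q →ₗ[ℂ] H)
    (hφ : ∀ x y, ⟪φ x, φ y⟫_ℂ = h (F0.starMul x y))
    (hd : Dense (LinearMap.range φ : Set H)) : ∃ ρ : StarRep q H, ρ.IsImage φ := by
  have hstar : ∀ a x y, ⟪φ (F0.cross a x), φ y⟫_ℂ = ⟪φ x, φ (F0.cross (CrossSpace.conj a) y)⟫_ℂ := by
    intro a x y
    rw [hφ, hφ, F0.starMul_cross hv hs]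
  have hker : ∀ a x x', φ x = φ x' → φ (F0.cross a x) = φ (F0.cross a x') := by
    intro a x x' hx
    have h0 : φ (x - x') = 0 := by rw [map_sub, hx, sub_self]
    rw [← sub_eq_zero, ← map_sub, ← map_sub, ← inner_self_eq_zero (𝕜 := ℂ), hstar, h0,
      inner_zero_left]
  have hpre : ∀ ξ : LinearMap.range φ, ∃ x, φ x = ξ := fun ξ => ξ.2
  choose pre hpre using hpre
  have hval : ∀ a x (ξ : LinearMap.range φ), (ξ : H) = φ x →
      φ (F0.cross a (pre ξ)) = φ (F0.cross a x) :=
    fun a x ξ hx => hker a _ _ ((hpre ξ).trans hx)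
  let op : CrossSpace q →ₗ[ℂ] Module.End ℂ (LinearMap.range φ) :=
    { toFun := fun a =>
        { toFun := fun ξ => ⟨φ (F0.cross a (pre ξ)), _, rfl⟩
          map_add' := fun ξ ζ => Subtype.ext (by
            show φ (F0.cross a (pre (ξ + ζ))) = φ (F0.cross a (pre ξ)) + φ (F0.cross a (pre ζ))
            rw [← map_add, ← map_add]
            refine hval a _ _ ?_
            rw [map_add, hpre, hpre]; rfl)
          map_smul' := fun c ξ => Subtype.ext (by
            show φ (F0.cross a (pre (c • ξ))) = c • φ (F0.cross a (pre ξ))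
            rw [← map_smul, ← map_smul]
            refine hval a _ _ ?_
            rw [map_smul, hpre]; rfl) }
      map_add' := fun a b => by
        ext ξ
        show φ (F0.cross (a + b) (pre ξ)) = φ (F0.cross a (pre ξ)) + φ (F0.cross b (pre ξ))
        rw [map_add, LinearMap.add_apply, map_add]
      map_smul' := fun c a => by
        ext ξ
        show φ (F0.cross (c • a) (pre ξ)) = c • φ (F0.cross a (pre ξ))
        rw [map_smul, LinearMap.smul_apply, map_smul] }
  refine ⟨{ dom := LinearMap.range φ, dense := hd, op := op, op_one := ?_, op_mul := ?_,
            op_star := ?_ }, rfl, ?_⟩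
  · ext ξ
    show φ (F0.cross (1 ⊗ₜ 1) (pre ξ)) = (ξ : H)
    rw [F0.cross_one, Module.End.one_apply, hpre]
  · intro a b
    ext ξ
    show φ (F0.cross (CrossSpace.mul a b) (pre ξ)) = φ (F0.cross a (pre (op b ξ)))
    rw [F0.cross_mul, Module.End.mul_apply]
    exact (hval a _ _ rfl).symm
  · intro a ξ ζ
    show ⟪φ (F0.cross a (pre ξ)), (ζ : H)⟫_ℂ = ⟪(ξ : H), φ (F0.cross (CrossSpace.conj a) (pre ζ))⟫_ℂ
    conv_lhs => rw [← hpre ζ]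
    conv_rhs => rw [← hpre ξ]
    exact hstar a _ _
  · intro a x ξ hx
    exact hval a x ξ hx

theorem IsImage.unitarilyEquivalent [CompleteSpace H₁] [CompleteSpace H₂] {π : StarRep q H₁}
    {ρ : StarRep q H₂} {ψ : F0 q →ₗ[ℂ] H₁} {φ : F0 q →ₗ[ℂ] H₂} (hπ : π.IsImage ψ)
    (hρ : ρ.IsImage φ) (h : ∀ x, ⟪ψ x, ψ x⟫_ℂ = ⟪φ x, φ x⟫_ℂ) : π.UnitarilyEquivalent ρ := by
  have hd₁ : DenseRange ψ := by
    have := π.dense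
    rw [hπ.1] at this
    exact this
  have hd₂ : DenseRange φ := by
    have := ρ.dense
    rw [hρ.1] at this
    exact this
  have hn : ∀ x, ‖φ ((LinearEquiv.refl ℂ (F0 q)) x)‖ = ‖ψ x‖ := by
    intro x
    rw [LinearEquiv.refl_apply, norm_eq_sqrt_re_inner (𝕜 := ℂ), norm_eq_sqrt_re_inner (𝕜 := ℂ), h]
  have hW : ∀ x, ((LinearEquiv.refl ℂ (F0 q)).extendOfIsometry ψ φ hd₁ hd₂ hn) (ψ x) = φ x :=
    fun x => LinearEquiv.extendOfIsometry_eq _ _ _ hd₁ hd₂ hn x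
  generalize (LinearEquiv.refl ℂ (F0 q)).extendOfIsometry ψ φ hd₁ hd₂ hn = W at hW
  refine ⟨W, fun ξ => ?_, fun a ξ ζ hζ => ?_⟩
  · rw [hπ.1, hρ.1]
    constructor
    · rintro ⟨x, hx⟩
      exact ⟨x, W.injective (by rw [hW, hx])⟩
    · rintro ⟨x, rfl⟩
      exact ⟨x, (hW x).symm⟩
  · obtain ⟨x, hx⟩ : (ξ : H₁) ∈ LinearMap.range ψ := hπ.1 ▸ ξ.2
    rw [hπ.2 a x ξ hx.symm, hW]
    refine hρ.2 a x ζ ?_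
    rw [hζ, ← hx, hW]

/-- The limits `v` of `ρ.op a ξⱼ` along sequences `ξⱼ → ζ` are determined by `ζ`, since `ρ.op a`
has a densely defined adjoint. -/
theorem tendsto_op_unique (ρ : StarRep q H) (a : CrossSpace q) {ξ ξ' : ℕ → ρ.dom} {ζ v v' : H}
    (hξ : Tendsto (fun j => (ξ j : H)) atTop (𝓝 ζ))
    (hξ' : Tendsto (fun j => (ξ' j : H)) atTop (𝓝 ζ))
    (hv : Tendsto (fun j => ((ρ.op a (ξ j) : ρ.dom) : H)) atTop (𝓝 v))
    (hv' : Tendsto (fun j => ((ρ.op a (ξ' j) : ρ.dom) : H)) atTop (𝓝 v')) : v = v' := by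
  have key : ∀ (ξ : ℕ → ρ.dom) (v : H), Tendsto (fun j => (ξ j : H)) atTop (𝓝 ζ) →
      Tendsto (fun j => ((ρ.op a (ξ j) : ρ.dom) : H)) atTop (𝓝 v) →
      ∀ η : ρ.dom, ⟪v, (η : H)⟫_ℂ = ⟪ζ, ((ρ.op (CrossSpace.conj a) η : ρ.dom) : H)⟫_ℂ := by
    intro ξ v hξ hv η
    refine tendsto_nhds_unique (hv.inner tendsto_const_nhds) ?_
    simp only [ρ.op_star]
    exact hξ.inner tendsto_const_nhds
  refine ρ.dense.eq_of_inner_left (𝕜 := ℂ) fun η hη => ?_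
  exact (key ξ v hξ hv ⟨η, hη⟩).trans (key ξ' v' hξ' hv' ⟨η, hη⟩).symm

/-- A `*`-representation extends to every larger domain `D` whose vectors are limits of sequences
from the given domain along which all operators converge in `D`. -/
theorem exists_extension (ρ : StarRep q H) (D : Submodule ℂ H) (hD : ρ.dom ≤ D)
    (hlim : ∀ ζ ∈ D, ∃ ξ : ℕ → ρ.dom, Tendsto (fun j => (ξ j : H)) atTop (𝓝 ζ) ∧
      ∀ a, ∃ v ∈ D, Tendsto (fun j => ((ρ.op a (ξ j) : ρ.dom) : H)) atTop (𝓝 v)) :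
    ∃ ρ' : StarRep q H, ρ'.dom = D ∧ ρ.HasCoreIn ρ' ∧
      ∀ (a : CrossSpace q) (ξ : ℕ → ρ.dom) (ζ : ρ'.dom) (v : H),
        Tendsto (fun j => (ξ j : H)) atTop (𝓝 ζ) →
        Tendsto (fun j => ((ρ.op a (ξ j) : ρ.dom) : H)) atTop (𝓝 v) →
        ((ρ'.op a ζ : ρ'.dom) : H) = v := by
  have hlim' : ∀ ζ : D, ∃ ξ : ℕ → ρ.dom, Tendsto (fun j => (ξ j : H)) atTop (𝓝 (ζ : H)) ∧
      ∀ a, ∃ v : D, Tendsto (fun j => ((ρ.op a (ξ j) : ρ.dom) : H)) atTop (𝓝 (v : H)) := by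
    intro ζ
    obtain ⟨ξ, h1, h2⟩ := hlim ζ ζ.2
    refine ⟨ξ, h1, fun a => ?_⟩
    obtain ⟨v, hv, h3⟩ := h2 a
    exact ⟨⟨v, hv⟩, h3⟩
  choose s hs v hv using hlim'
  have hU : ∀ (a : CrossSpace q) (ξ : ℕ → ρ.dom) (ζ : D) (w : H),
      Tendsto (fun j => (ξ j : H)) atTop (𝓝 (ζ : H)) →
      Tendsto (fun j => ((ρ.op a (ξ j) : ρ.dom) : H)) atTop (𝓝 w) → (v ζ a : H) = w :=
    fun a ξ ζ w h1 h2 => ρ.tendsto_op_unique a (hs ζ) h1 (hv ζ a) h2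
  let op : CrossSpace q →ₗ[ℂ] Module.End ℂ D :=
    { toFun := fun a =>
        { toFun := fun ζ => v ζ a
          map_add' := fun ζ ζ' => Subtype.ext (by
            refine hU a (fun j => s ζ j + s ζ' j) _ _ ((hs ζ).add (hs ζ')) ?_
            simp only [map_add, Submodule.coe_add]
            exact (hv ζ a).add (hv ζ' a))
          map_smul' := fun c ζ => Subtype.ext (by
            refine hU a (fun j => c • s ζ j) _ _ ((hs ζ).const_smul c) ?_
            simp only [map_smul, Submodule.coe_smul]
            exact (hv ζ a).const_smul c) }
      map_add' := fun a b => by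
        ext ζ
        refine hU (a + b) (s ζ) ζ _ (hs ζ) ?_
        simp only [map_add, LinearMap.add_apply, Submodule.coe_add]
        exact (hv ζ a).add (hv ζ b)
      map_smul' := fun c a => by
        ext ζ
        refine hU (c • a) (s ζ) ζ _ (hs ζ) ?_
        simp only [map_smul, LinearMap.smul_apply, Submodule.coe_smul]
        exact (hv ζ a).const_smul c }
  refine ⟨{ dom := D, dense := ρ.dense.mono hD, op := op, op_one := ?_, op_mul := ?_,
            op_star := ?_ }, rfl, ⟨fun ξ => ⟨⟨ξ, hD ξ.2⟩, rfl, fun a => ?_⟩,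
            fun ζ => ⟨s ζ, fun a => hv ζ a⟩⟩, fun a ξ ζ w h1 h2 => hU a ξ ζ w h1 h2⟩
  · ext ζ
    refine hU (1 ⊗ₜ 1) (s ζ) ζ _ (hs ζ) ?_
    rw [ρ.op_one]
    exact hs ζ
  · intro a b
    ext ζ
    refine (hU a (fun j => ρ.op b (s ζ j)) (v ζ b) _ (hv ζ b) ?_).symm
    have h := hv ζ (CrossSpace.mul a b)
    simp only [ρ.op_mul] at h
    exact h
  · intro a ζ ζ'
    refine tendsto_nhds_unique ((hv ζ a).inner (hs ζ')) ?_
    simp only [ρ.op_star]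
    exact (hs ζ).inner (hv ζ' _)
  · exact hU a (fun _ => ξ) ⟨ξ, hD ξ.2⟩ _ tendsto_const_nhds tendsto_const_nhds

end StarRep

open MeasureTheory

/-! ### Fibres of the scaling action and coordinates of `F_0(U_q)` -/

/-- The algebra of bounded measurable complex functions on `T`. -/
def BddMeas (T : Type) [MeasurableSpace T] : Subalgebra ℂ (T → ℂ) where
  carrier := {f | Measurable f ∧ ∃ M : ℝ, ∀ t, ‖f t‖ ≤ M}
  mul_mem' := by
    rintro f g ⟨hf, M, hM⟩ ⟨hg, N, hN⟩
    refine ⟨hf.mul hg, M * N, fun t => ?_⟩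
    rw [Pi.mul_apply, norm_mul]
    exact mul_le_mul (hM t) (hN t) (norm_nonneg _) ((norm_nonneg _).trans (hM t))
  add_mem' := by
    rintro f g ⟨hf, M, hM⟩ ⟨hg, N, hN⟩
    exact ⟨hf.add hg, M + N, fun t => (norm_add_le _ _).trans (add_le_add (hM t) (hN t))⟩
  algebraMap_mem' := fun c => ⟨measurable_const, ‖c‖, fun _ => le_rfl⟩

theorem BddMeas.ext {T : Type} [MeasurableSpace T] {f g : BddMeas T}
    (h : ∀ t, (f : T → ℂ) t = (g : T → ℂ) t) : f = g := Subtype.ext (funext h)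

theorem isCompact_annulus {a b : ℝ} (ha : 0 < a) :
    IsCompact {y : PLine | a ≤ |(y : ℝ)| ∧ |(y : ℝ)| ≤ b} := by
  rw [Topology.IsEmbedding.subtypeVal.isCompact_iff]
  have h : (Subtype.val '' {y : PLine | a ≤ |(y : ℝ)| ∧ |(y : ℝ)| ≤ b})
      = {y : ℝ | a ≤ |y|} ∩ Metric.closedBall 0 b := by
    ext y
    simp only [Set.mem_image, Set.mem_ofPred_eq, Set.mem_inter_iff, Metric.mem_closedBall,
      dist_zero_right, Real.norm_eq_abs]
    constructor
    · rintro ⟨y, hy, rfl⟩; exact hy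
    · intro hy
      exact ⟨⟨y, fun h0 => by rw [h0, abs_zero] at hy; linarith [hy.1]⟩, hy, rfl⟩
  rw [h]
  exact (isCompact_closedBall 0 b).inter_left (isClosed_le continuous_const continuous_abs)

/-- A measure space `T` of representatives `pt t`, `q² < |pt t| ≤ 1`, of the orbits of the scaling
`y ↦ q² y`, and a set `J` of indices: the functional attached to it integrates over the points
`q^{2(k+1)} pt t` with `k ∈ J`. Either `J = ℤ`, or `J` starts at an index where
`1 - q^{2k} pt t` vanishes. -/
structure Fibre (q : Param) where
  T : Type
  [ms : MeasurableSpace T]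
  m : Measure T
  [fin : IsFiniteMeasure m]
  pt : T → PLine
  emb : MeasurableEmbedding pt
  lower : ∀ t, (q : ℝ) ^ 2 < |(pt t : ℝ)|
  upper : ∀ t, |(pt t : ℝ)| ≤ 1
  J : Set ℤ
  up : ∀ {k}, k ∈ J → k + 1 ∈ J
  nonneg : ∀ {i}, i ∈ J → ∀ t, 0 ≤ 1 - (q : ℝ) ^ (2 * i) * (pt t : ℝ)
  pos : ∀ {i}, i - 1 ∈ J → ∃ δ : ℝ, 0 < δ ∧ ∀ t, δ ≤ 1 - (q : ℝ) ^ (2 * i) * (pt t : ℝ)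
  edge : ∀ {n k}, k ∈ J → n ∉ J →
    ∃ i ∈ Finset.Ioc n k, ∀ t, 1 - (q : ℝ) ^ (2 * i) * (pt t : ℝ) = 0

namespace Fibre

variable {q : Param} (𝔉 : Fibre q)

instance : MeasurableSpace 𝔉.T := 𝔉.ms
instance : IsFiniteMeasure 𝔉.m := 𝔉.fin

/-- Bounded measurable functions on the fibre. -/
abbrev B : Type := BddMeas 𝔉.T

/-- The point `q^{2(k+1)} pt t`. -/
noncomputable def pos_at (k : ℤ) (t : 𝔉.T) : PLine := scale q (k + 1) (𝔉.pt t)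

/-- The number `1 - q^{2i} pt t`. -/
noncomputable def fac (i : ℤ) (t : 𝔉.T) : ℝ := 1 - (q : ℝ) ^ (2 * i) * (𝔉.pt t : ℝ)

theorem measurable_pt : Measurable 𝔉.pt := 𝔉.emb.measurable

theorem measurable_fac (i : ℤ) : Measurable (𝔉.fac i) :=
  measurable_const.sub (measurable_const.mul (measurable_subtype_coe.comp 𝔉.measurable_pt))

theorem fac_le (i : ℤ) (t : 𝔉.T) : 𝔉.fac i t ≤ 1 + (q : ℝ) ^ (2 * i) := by
  have h : 0 < (q : ℝ) ^ (2 * i) := zpow_pos q.pos _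
  have h1 := (abs_le.1 (𝔉.upper t)).1
  unfold fac
  nlinarith

theorem abs_pos_at (k : ℤ) (t : 𝔉.T) :
    (q : ℝ) ^ (2 * (k + 1)) * (q : ℝ) ^ 2 < |(𝔉.pos_at k t : ℝ)| ∧
      |(𝔉.pos_at k t : ℝ)| ≤ (q : ℝ) ^ (2 * (k + 1)) := by
  have h : 0 < (q : ℝ) ^ (2 * (k + 1)) := zpow_pos q.pos _
  rw [pos_at, scale_coe, abs_mul, abs_of_pos h]
  exact ⟨mul_lt_mul_of_pos_left (𝔉.lower t) h, mul_le_of_le_one_right h.le (𝔉.upper t)⟩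

theorem pos_at_injective {k k' : ℤ} {t t' : 𝔉.T} (h : 𝔉.pos_at k t = 𝔉.pos_at k' t') : k = k' := by
  have key : ∀ (k k' : ℤ) (t t' : 𝔉.T), 𝔉.pos_at k t = 𝔉.pos_at k' t' → k' ≤ k := by
    intro k k' t t' h
    by_contra hlt
    have h1 := (𝔉.abs_pos_at k t).1
    have h2 := (𝔉.abs_pos_at k' t').2
    rw [h, ← zpow_natCast, ← zpow_add₀ q.pos.ne'] at h1
    have h3 : (q : ℝ) ^ (2 * (k' + 1)) ≤ (q : ℝ) ^ (2 * (k + 1) + ((2 : ℕ) : ℤ)) :=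
      zpow_le_zpow_right_of_le_one₀ q.pos q.lt_one.le (by push_cast; omega)
    linarith
  exact le_antisymm (key k' k t' t h.symm) (key k k' t t' h)

theorem emb_pos_at (k : ℤ) : MeasurableEmbedding (𝔉.pos_at k) :=
  (scale q (k + 1)).measurableEmbedding.comp 𝔉.emb

/-- The compact set containing the points `q^{2(k+1)} pt t`. -/
def shell (_ : Fibre q) (k : ℤ) : Set PLine :=
  {y | (q : ℝ) ^ (2 * (k + 1)) * (q : ℝ) ^ 2 ≤ |(y : ℝ)| ∧ |(y : ℝ)| ≤ (q : ℝ) ^ (2 * (k + 1))}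

theorem isCompact_shell (k : ℤ) : IsCompact (𝔉.shell k) :=
  isCompact_annulus (mul_pos (zpow_pos q.pos _) (pow_pos q.pos _))

theorem pos_at_mem_shell (k : ℤ) (t : 𝔉.T) : 𝔉.pos_at k t ∈ 𝔉.shell k :=
  ⟨(𝔉.abs_pos_at k t).1.le, (𝔉.abs_pos_at k t).2⟩

/-- Restriction of functions of `y` to the points `q^{2(k+1)} pt t`. -/
noncomputable def ev (k : ℤ) : LBorel →ₐ[ℂ] 𝔉.B where
  toFun f := ⟨fun t => (f : PLine → ℂ) (𝔉.pos_at k t),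
    f.2.1.comp (𝔉.emb_pos_at k).measurable, by
      obtain ⟨M, hM⟩ := f.2.2 _ (𝔉.isCompact_shell k)
      exact ⟨M, fun t => hM _ (𝔉.pos_at_mem_shell k t)⟩⟩
  map_one' := rfl
  map_mul' _ _ := rfl
  map_zero' := rfl
  map_add' _ _ := rfl
  commutes' _ := rfl

theorem ev_apply (k : ℤ) (f : LBorel) (t : 𝔉.T) :
    (𝔉.ev k f : 𝔉.T → ℂ) t = (f : PLine → ℂ) (𝔉.pos_at k t) := rfl

theorem ev_shift (k n : ℤ) (f : LBorel) : 𝔉.ev k (shift q n f) = 𝔉.ev (k + n) f := by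
  refine BddMeas.ext fun t => ?_
  rw [ev_apply, ev_apply, shift_coe, pos_at, pos_at, scale_scale,
    show n + (k + 1) = k + n + 1 by ring]

theorem ev_lin_apply (k j : ℤ) (t : 𝔉.T) :
    (𝔉.ev k (lin q j) : 𝔉.T → ℂ) t = (𝔉.fac (j + k + 1) t : ℂ) := by
  rw [ev_apply, lin_coe, pos_at, scale_coe, fac, show 2 * (j + k + 1) = 2 * j + 2 * (k + 1) by ring,
    zpow_add₀ q.pos.ne', Param.c]
  push_cast
  ring

/-- The function `α_i = (1 - q^{2i} pt t)^{1/2}`. -/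
noncomputable def al (i : ℤ) : 𝔉.B :=
  ⟨fun t => ((Real.sqrt (𝔉.fac i t) : ℝ) : ℂ),
    Complex.measurable_ofReal.comp (Real.continuous_sqrt.measurable.comp (𝔉.measurable_fac i)),
    Real.sqrt (1 + (q : ℝ) ^ (2 * i)), fun t => by
      rw [Complex.norm_real, Real.norm_of_nonneg (Real.sqrt_nonneg _)]
      exact Real.sqrt_le_sqrt (𝔉.fac_le i t)⟩

theorem al_apply (i : ℤ) (t : 𝔉.T) :
    (𝔉.al i : 𝔉.T → ℂ) t = ((Real.sqrt (𝔉.fac i t) : ℝ) : ℂ) := rfl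

theorem al_mul_al {i : ℤ} (hi : i ∈ 𝔉.J) {k j : ℤ} (h : j + k + 1 = i) :
    𝔉.al i * 𝔉.al i = 𝔉.ev k (lin q j) := by
  refine BddMeas.ext fun t => ?_
  rw [ev_lin_apply, h]
  show (𝔉.al i : 𝔉.T → ℂ) t * (𝔉.al i : 𝔉.T → ℂ) t = _
  rw [al_apply, ← Complex.ofReal_mul, Real.mul_self_sqrt (show 0 ≤ 𝔉.fac i t from 𝔉.nonneg hi t)]

theorem al_edge {i : ℤ} (hi : i ∈ 𝔉.J) (h : i - 1 ∉ 𝔉.J) : 𝔉.al i = 0 := by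
  obtain ⟨j, hj, h0⟩ := 𝔉.edge hi h
  obtain rfl : j = i := by
    rw [Finset.mem_Ioc] at hj; omega
  refine BddMeas.ext fun t => ?_
  rw [al_apply, fac, h0, Real.sqrt_zero]; rfl

theorem isUnit_al {i : ℤ} (hi : i - 1 ∈ 𝔉.J) : IsUnit (𝔉.al i) := by
  obtain ⟨δ, hδ, h⟩ := 𝔉.pos hi
  have hpos : ∀ t, 0 < Real.sqrt (𝔉.fac i t) := fun t => Real.sqrt_pos.2 (hδ.trans_le (h t))
  refine IsUnit.of_mul_eq_one ⟨fun t => ((Real.sqrt (𝔉.fac i t) : ℝ) : ℂ)⁻¹,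
    (𝔉.al i).2.1.inv, (Real.sqrt δ)⁻¹, fun t => ?_⟩ (BddMeas.ext fun t => ?_)
  · rw [norm_inv, Complex.norm_real, Real.norm_of_nonneg (Real.sqrt_nonneg _)]
    exact inv_anti₀ (Real.sqrt_pos.2 hδ) (Real.sqrt_le_sqrt (h t))
  · exact mul_inv_cancel₀ (Complex.ofReal_ne_zero.2 (hpos t).ne')

/-- The normalization `∏ α_i` over `min n k < i ≤ max n k`: the norm of the basis vector `η_{nk}`
before normalization, up to a power of `q`. -/
noncomputable def wt (n k : ℤ) : 𝔉.B := ∏ i ∈ Finset.Ioc (min n k) (max n k), 𝔉.al i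

theorem wt_comm (n k : ℤ) : 𝔉.wt n k = 𝔉.wt k n := by rw [wt, wt, min_comm, max_comm]

theorem wt_succ_of_le {n k : ℤ} (h : k ≤ n) : 𝔉.wt (n + 1) k = 𝔉.al (n + 1) * 𝔉.wt n k := by
  have : Finset.Ioc (min (n + 1) k) (max (n + 1) k)
      = insert (n + 1) (Finset.Ioc (min n k) (max n k)) := by
    ext i; simp only [Finset.mem_Ioc, Finset.mem_insert]; omega
  rw [wt, this, Finset.prod_insert (by simp only [Finset.mem_Ioc]; omega), wt]

theorem wt_of_lt {n k : ℤ} (h : n < k) : 𝔉.wt n k = 𝔉.al (n + 1) * 𝔉.wt (n + 1) k := by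
  have : Finset.Ioc (min n k) (max n k)
      = insert (n + 1) (Finset.Ioc (min (n + 1) k) (max (n + 1) k)) := by
    ext i; simp only [Finset.mem_Ioc, Finset.mem_insert]; omega
  rw [wt, this, Finset.prod_insert (by simp only [Finset.mem_Ioc]; omega), wt]

theorem mem_J_of_le {k n : ℤ} (hk : k ∈ 𝔉.J) (h : k ≤ n) : n ∈ 𝔉.J := by
  by_contra hn
  obtain ⟨i, hi, -⟩ := 𝔉.edge hk hn
  rw [Finset.mem_Ioc] at hi
  omega

theorem isUnit_wt {n k : ℤ} (hn : n ∈ 𝔉.J) (hk : k ∈ 𝔉.J) : IsUnit (𝔉.wt n k) := by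
  refine IsUnit.prod_iff.2 fun i hi => 𝔉.isUnit_al ?_
  rw [Finset.mem_Ioc] at hi
  rcases min_choice n k with h | h
  · exact 𝔉.mem_J_of_le hn (by omega)
  · exact 𝔉.mem_J_of_le hk (by omega)

/-! The four identities behind the weighted shift formulas for left and right multiplication by
`z` and `z*`. -/

theorem wt_mul_ev_coc_one {n : ℤ} (hn : n ∈ 𝔉.J) (k : ℤ) :
    𝔉.wt n k * 𝔉.ev k (coc q 1 (n - 1 - k)) = 𝔉.al n * 𝔉.wt (n - 1) k := by
  rcases le_or_gt k (n - 1) with h | h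
  · rw [FU.coc_one_left (by omega), map_one, mul_one]
    have hw := 𝔉.wt_succ_of_le h
    rwa [sub_add_cancel] at hw
  · have : cocSet 1 (n - 1 - k) = {n - 1 - k} := by
      unfold cocSet; rw [if_pos zero_le_one]; ext j
      simp only [Finset.mem_Ico, Finset.mem_singleton]; omega
    rw [coc, this, Finset.prod_singleton, 𝔉.wt_of_lt h, sub_add_cancel, ← mul_assoc,
      𝔉.al_mul_al hn (k := k) (j := n - 1 - k) (by ring), mul_comm]

theorem wt_mul_ev_coc_neg_one {n : ℤ} (hn : n ∈ 𝔉.J) (k : ℤ) :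
    𝔉.wt n k * 𝔉.ev k (coc q (-1) (n + 1 - k)) = 𝔉.al (n + 1) * 𝔉.wt (n + 1) k := by
  rcases lt_or_ge n k with h | h
  · rw [FU.coc_neg_one_left (by omega), map_one, mul_one, 𝔉.wt_of_lt h]
  · rw [FU.coc_neg_one_pos (by omega), 𝔉.wt_succ_of_le h, ← mul_assoc,
      𝔉.al_mul_al (𝔉.up hn) (k := k) (j := n + 1 - k - 1) (by ring), mul_comm]

theorem wt_mul_ev_coc_right_one {k : ℤ} (hk : k ∈ 𝔉.J) (n : ℤ) :
    𝔉.wt n k * 𝔉.ev k (coc q (n - k - 1) 1) = 𝔉.al (k + 1) * 𝔉.wt n (k + 1) := by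
  rw [𝔉.wt_comm n k, 𝔉.wt_comm n (k + 1)]
  rcases lt_or_ge k n with h | h
  · have : cocSet (n - k - 1) 1 = ∅ := by
      unfold cocSet; rw [if_pos (by omega)]; ext j
      simp only [Finset.mem_Ico, Finset.notMem_empty, iff_false]; omega
    rw [coc, this, Finset.prod_empty, map_one, mul_one, 𝔉.wt_of_lt h]
  · have : cocSet (n - k - 1) 1 = {0} := by
      unfold cocSet; rw [if_neg (by omega)]; ext j
      simp only [Finset.mem_Ico, Finset.mem_singleton]; omega
    rw [coc, this, Finset.prod_singleton, 𝔉.wt_succ_of_le h, ← mul_assoc,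
      𝔉.al_mul_al (𝔉.up hk) (k := k) (j := 0) (by ring), mul_comm]

theorem wt_mul_ev_coc_right_neg_one {k : ℤ} (hk : k ∈ 𝔉.J) (n : ℤ) :
    𝔉.wt n k * 𝔉.ev k (coc q (n - k + 1) (-1)) = 𝔉.al k * 𝔉.wt n (k - 1) := by
  rw [𝔉.wt_comm n k, 𝔉.wt_comm n (k - 1)]
  rcases lt_or_ge (k - 1) n with h | h
  · rw [FU.coc_neg_one_right (by omega), 𝔉.wt_of_lt h, sub_add_cancel, ← mul_assoc,
      𝔉.al_mul_al hk (k := k) (j := -1) (by ring), mul_comm]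
  · have : cocSet (n - k + 1) (-1) = ∅ := by
      unfold cocSet
      split_ifs <;> ext j <;> simp only [Finset.mem_Ico, Finset.notMem_empty, iff_false] <;> omega
    rw [coc, this, Finset.prod_empty, map_one, mul_one]
    have hw := 𝔉.wt_succ_of_le h
    rwa [sub_add_cancel] at hw

open Classical in
/-- The coordinate of `x` with respect to `η_{nk}`, a function on the fibre. The sign `(-1)^k` makes
right multiplication by `-z*` a weighted shift with positive weights. -/
noncomputable def coord (n k : ℤ) (x : FU q) : 𝔉.B :=
  if n ∈ 𝔉.J ∧ k ∈ 𝔉.J then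
    ((-1) ^ k * q.c ^ (-(k + 1))) • (𝔉.wt n k * 𝔉.ev k (FU.coeff (n - k) x)) else 0

theorem coord_of_mem {n k : ℤ} (hn : n ∈ 𝔉.J) (hk : k ∈ 𝔉.J) (x : FU q) : 𝔉.coord n k x
    = ((-1) ^ k * q.c ^ (-(k + 1))) • (𝔉.wt n k * 𝔉.ev k (FU.coeff (n - k) x)) :=
  if_pos ⟨hn, hk⟩

theorem coord_of_notMem {n k : ℤ} (h : ¬(n ∈ 𝔉.J ∧ k ∈ 𝔉.J)) (x : FU q) : 𝔉.coord n k x = 0 :=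
  if_neg h

theorem coord_add (n k : ℤ) (x y : FU q) : 𝔉.coord n k (x + y) = 𝔉.coord n k x + 𝔉.coord n k y := by
  unfold coord
  split_ifs
  · rw [map_add, map_add, mul_add, smul_add]
  · rw [add_zero]

theorem coord_smul (n k : ℤ) (c : ℂ) (x : FU q) : 𝔉.coord n k (c • x) = c • 𝔉.coord n k x := by
  unfold coord
  split_ifs
  · rw [map_smul, map_smul, mul_smul_comm, smul_comm]
  · rw [smul_zero]

theorem coord_z_mul (n k : ℤ) (x : FU q) :
    𝔉.coord n k (FU.z * x) = 𝔉.al n * 𝔉.coord (n - 1) k x := by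
  by_cases h : n ∈ 𝔉.J ∧ k ∈ 𝔉.J
  · have h1 : n - k - 1 = n - 1 - k := by ring
    rw [𝔉.coord_of_mem h.1 h.2, FU.z, FU.coeff_mono_mul, map_one, mul_one, map_mul, h1,
      ← mul_assoc, 𝔉.wt_mul_ev_coc_one h.1]
    by_cases h' : n - 1 ∈ 𝔉.J
    · rw [𝔉.coord_of_mem h' h.2, mul_smul_comm, mul_assoc]
    · rw [𝔉.al_edge h.1 h', zero_mul, zero_mul, zero_mul, smul_zero]
  · rw [𝔉.coord_of_notMem h, 𝔉.coord_of_notMem, mul_zero]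
    exact fun h' => h ⟨𝔉.mem_J_of_le h'.1 (by omega), h'.2⟩

theorem coord_star_z_mul (n k : ℤ) (x : FU q) :
    𝔉.coord n k (star FU.z * x) = 𝔉.al (n + 1) * 𝔉.coord (n + 1) k x := by
  by_cases hk : k ∈ 𝔉.J
  swap
  · rw [𝔉.coord_of_notMem fun h => hk h.2, 𝔉.coord_of_notMem fun h => hk h.2, mul_zero]
  by_cases hn : n ∈ 𝔉.J
  · have h1 : n - k - -1 = n + 1 - k := by ring
    rw [𝔉.coord_of_mem hn hk, FU.star_z, FU.coeff_mono_mul, map_one, mul_one, map_mul, h1,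
      ← mul_assoc, 𝔉.wt_mul_ev_coc_neg_one hn, 𝔉.coord_of_mem (𝔉.up hn) hk, mul_smul_comm,
      mul_assoc]
  · rw [𝔉.coord_of_notMem fun h => hn h.1]
    by_cases hn' : n + 1 ∈ 𝔉.J
    · rw [𝔉.al_edge hn' (by rwa [add_sub_cancel_right]), zero_mul]
    · rw [𝔉.coord_of_notMem fun h => hn' h.1, mul_zero]

theorem sign_succ (k : ℤ) : (-1 : ℂ) ^ k * q.c ^ (-(k + 1))
    = -q.c * ((-1) ^ (k + 1) * q.c ^ (-(k + 1 + 1))) := by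
  have hq := q.c_ne
  rw [zpow_add₀ (by norm_num : (-1 : ℂ) ≠ 0), zpow_one, show -(k + 1 + 1) = -(k + 1) + -1 by ring,
    zpow_add₀ hq, zpow_neg_one]
  field_simp

theorem coord_mul_z (n k : ℤ) (x : FU q) :
    𝔉.coord n k (x * FU.z) = (-q.c) • (𝔉.al (k + 1) * 𝔉.coord n (k + 1) x) := by
  by_cases hn : n ∈ 𝔉.J
  swap
  · rw [𝔉.coord_of_notMem fun h => hn h.1, 𝔉.coord_of_notMem fun h => hn h.1, mul_zero, smul_zero]
  by_cases hk : k ∈ 𝔉.J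
  · have h1 : n - k - 1 = n - (k + 1) := by ring
    rw [𝔉.coord_of_mem hn hk, FU.z, FU.coeff_mul_mono, mul_one, map_mul, ev_shift,
      ← mul_assoc, 𝔉.wt_mul_ev_coc_right_one hk, 𝔉.coord_of_mem hn (𝔉.up hk), mul_smul_comm,
      mul_assoc, sign_succ, smul_smul, h1]
  · rw [𝔉.coord_of_notMem fun h => hk h.2]
    by_cases hk' : k + 1 ∈ 𝔉.J
    · rw [𝔉.al_edge hk' (by rwa [add_sub_cancel_right]), zero_mul, smul_zero]
    · rw [𝔉.coord_of_notMem fun h => hk' h.2, mul_zero, smul_zero]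

theorem coord_mul_star_z (n k : ℤ) (x : FU q) :
    𝔉.coord n k (x * star FU.z) = (-q.c⁻¹) • (𝔉.al k * 𝔉.coord n (k - 1) x) := by
  by_cases h : n ∈ 𝔉.J ∧ k ∈ 𝔉.J
  · have h1 : n - k - -1 = n - k + 1 := by ring
    have h2 : n - (k - 1) = n - k + 1 := by ring
    have h3 : k + -1 = k - 1 := by ring
    have hs := sign_succ (q := q) (k - 1)
    rw [sub_add_cancel] at hs
    rw [𝔉.coord_of_mem h.1 h.2, FU.star_z, FU.coeff_mul_mono, mul_one, h1, map_mul, ev_shift,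
      ← mul_assoc, 𝔉.wt_mul_ev_coc_right_neg_one h.2, h3]
    by_cases h' : k - 1 ∈ 𝔉.J
    · rw [𝔉.coord_of_mem h.1 h', mul_smul_comm, mul_assoc, smul_smul, h2, sub_add_cancel, hs]
      congr 1
      have := q.c_ne
      field_simp
    · rw [𝔉.al_edge h.2 h', zero_mul, zero_mul, zero_mul, smul_zero, smul_zero]
  · rw [𝔉.coord_of_notMem h, 𝔉.coord_of_notMem, mul_zero, smul_zero]
    exact fun h' => h ⟨h'.1, 𝔉.mem_J_of_le h'.2 (by omega)⟩

theorem coord_grade (c : ℂ) (hc : c ≠ 0) (n k : ℤ) (x : FU q) :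
    𝔉.coord n k (FU.grade c hc x) = c ^ (n - k) • 𝔉.coord n k x := by
  by_cases h : n ∈ 𝔉.J ∧ k ∈ 𝔉.J
  · rw [𝔉.coord_of_mem h.1 h.2, 𝔉.coord_of_mem h.1 h.2, FU.coeff_grade, map_smul, mul_smul_comm,
      smul_comm]
  · rw [𝔉.coord_of_notMem h, 𝔉.coord_of_notMem h, smul_zero]

theorem coord_mul_ofFun (n k : ℤ) (x : FU q) (f : LBorel) :
    𝔉.coord n k (x * FU.ofFun f) = 𝔉.coord n k x * 𝔉.ev k f := by
  by_cases h : n ∈ 𝔉.J ∧ k ∈ 𝔉.J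
  · rw [𝔉.coord_of_mem h.1 h.2, 𝔉.coord_of_mem h.1 h.2, FU.ofFun, FU.coeff_mul_mono, sub_zero,
      coc_zero_right, shift_zero, one_mul, map_mul, smul_mul_assoc, mul_assoc]
  · rw [𝔉.coord_of_notMem h, 𝔉.coord_of_notMem h, zero_mul]

/-- A function of compact support vanishes at the points `q^{2(k+1)} pt t` for almost all `k`. -/
theorem finite_ev_ne (f : LBorel) (hf : HasCompactSupport (f : PLine → ℂ)) :
    {k : ℤ | 𝔉.ev k f ≠ 0}.Finite := by
  obtain ⟨a, b, ha, hab⟩ := exists_abs_bounds hf.isCompact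
  have hfin := finite_scales q (b := b / (q : ℝ) ^ 2) ha
  have hinj : Function.Injective fun k : ℤ => k + 1 := add_left_injective 1
  refine (hfin.preimage hinj.injOn).subset fun k hk => ?_
  obtain ⟨t, ht⟩ : ∃ t, (𝔉.ev k f : 𝔉.T → ℂ) t ≠ 0 := by
    by_contra hne
    push Not at hne
    exact hk (BddMeas.ext hne)
  obtain ⟨h1, h2⟩ := hab _ (subset_tsupport _ (Function.mem_support.2 ht))
  obtain ⟨h3, h4⟩ := 𝔉.abs_pos_at k t
  have hq2 : 0 < (q : ℝ) ^ 2 := pow_pos q.pos 2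
  refine ⟨h1.trans h4, ?_⟩
  rw [le_div_iff₀ hq2]
  exact h3.le.trans h2

theorem finite_coord_ne (x : F0 q) : {p : ℤ × ℤ | 𝔉.coord p.1 p.2 x.1 ≠ 0}.Finite := by
  let S : Finset ℤ := Finsupp.support (x.1 : ℤ →₀ LBorel)
  have h : (⋃ m ∈ S, (fun k : ℤ => (m + k, k)) '' {k : ℤ | 𝔉.ev k (FU.coeff m x.1) ≠ 0}).Finite :=
    S.finite_toSet.biUnion fun m _ => (𝔉.finite_ev_ne _ (x.2 m)).image _
  refine h.subset fun p hp => ?_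
  have h1 : 𝔉.ev p.2 (FU.coeff (p.1 - p.2) x.1) ≠ 0 := by
    intro h0
    refine hp ?_
    unfold coord
    rw [h0, mul_zero, smul_zero, ite_self]
  have h2 : p.1 - p.2 ∈ S := Finsupp.mem_support_iff.2 fun h0 => h1 (by
    have : FU.coeff (p.1 - p.2) x.1 = 0 := h0
    rw [this, map_zero])
  exact Set.mem_biUnion h2 ⟨p.2, h1, Prod.ext (sub_add_cancel _ _) rfl⟩

/-- All coordinates of an element of `F_0(U_q)`. -/
noncomputable def val : F0 q →ₗ[ℂ] (ℤ × ℤ →₀ 𝔉.B) where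
  toFun x := Finsupp.ofSupportFinite (fun p => 𝔉.coord p.1 p.2 x.1) (𝔉.finite_coord_ne x)
  map_add' x y := Finsupp.ext fun p => 𝔉.coord_add p.1 p.2 x.1 y.1
  map_smul' c x := Finsupp.ext fun p => 𝔉.coord_smul p.1 p.2 c x.1

theorem val_apply (x : F0 q) (p : ℤ × ℤ) : 𝔉.val x p = 𝔉.coord p.1 p.2 x.1 := rfl

/-- Every bounded measurable function is the only nonzero coordinate of some element. -/
theorem exists_val_eq_single {n k : ℤ} (hn : n ∈ 𝔉.J) (hk : k ∈ 𝔉.J) (b : 𝔉.B) :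
    ∃ x : F0 q, 𝔉.val x = Finsupp.single (n, k) b := by
  obtain ⟨u, hu⟩ := (𝔉.isUnit_wt hn hk).exists_right_inv
  have hc : (-1 : ℂ) ^ k * q.c ^ (-(k + 1)) ≠ 0 :=
    mul_ne_zero (zpow_ne_zero _ (by norm_num)) (zpow_ne_zero _ q.c_ne)
  set c : ℂ := (-1 : ℂ) ^ k * q.c ^ (-(k + 1)) with hcdef
  let g : 𝔉.B := c⁻¹ • (u * b)
  let f₀ : PLine → ℂ := Function.extend (𝔉.pos_at k) (g : 𝔉.T → ℂ) 0
  have hf₀ : ∀ t, f₀ (𝔉.pos_at k t) = (g : 𝔉.T → ℂ) t :=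
    fun t => (𝔉.emb_pos_at k).injective.extend_apply _ _ _
  have hf₀' : ∀ y, (∀ t, 𝔉.pos_at k t ≠ y) → f₀ y = 0 := by
    intro y hy
    exact Function.extend_apply' _ _ _ fun ⟨t, ht⟩ => hy t ht
  obtain ⟨M, hM⟩ := g.2.2
  let f : LBorel := ⟨f₀, (𝔉.emb_pos_at k).measurable_extend g.2.1 measurable_const,
    fun C _ => ⟨max M 0, fun y _ => by
      by_cases hy : ∃ t, 𝔉.pos_at k t = y
      · obtain ⟨t, rfl⟩ := hy
        rw [hf₀]
        exact (hM t).trans (le_max_left _ _)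
      · rw [hf₀' y fun t ht => hy ⟨t, ht⟩, norm_zero]
        exact le_max_right _ _⟩⟩
  have hf : HasCompactSupport (f : PLine → ℂ) := by
    refine HasCompactSupport.intro (𝔉.isCompact_shell k) fun y hy => hf₀' y fun t ht => hy ?_
    rw [← ht]
    exact 𝔉.pos_at_mem_shell k t
  refine ⟨⟨FU.mono (n - k) f, F0.mono_mem _ hf⟩, Finsupp.ext fun p => ?_⟩
  obtain ⟨n', k'⟩ := p
  rw [val_apply]
  show 𝔉.coord n' k' (FU.mono (n - k) f) = _
  by_cases hkk : k' = k
  · subst hkk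
    by_cases hnn : n' = n
    · subst hnn
      have hev : 𝔉.ev k' f = g := BddMeas.ext fun t => hf₀ t
      rw [Finsupp.single_eq_same, 𝔉.coord_of_mem hn hk, FU.coeff_mono, if_pos rfl, ← hcdef, hev,
        mul_smul_comm, ← mul_assoc, hu, one_mul, smul_smul, mul_inv_cancel₀ hc, one_smul]
    · have h1 : ((n', k') : ℤ × ℤ) ≠ (n, k') := fun h => hnn (congrArg Prod.fst h)
      have h2 : ¬n - k' = n' - k' := fun h => hnn (by omega)
      rw [Finsupp.single_eq_of_ne h1, coord, FU.coeff_mono, if_neg h2, map_zero, mul_zero,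
        smul_zero, ite_self]
  · have h1 : ((n', k') : ℤ × ℤ) ≠ (n, k) := fun h => hkk (congrArg Prod.snd h)
    rw [Finsupp.single_eq_of_ne h1]
    unfold coord
    rw [FU.coeff_mono]
    split_ifs
    · have hev : 𝔉.ev k' f = 0 := BddMeas.ext fun t =>
        hf₀' _ fun t' ht' => hkk (𝔉.pos_at_injective ht').symm
      rw [hev, mul_zero, smul_zero]
    · rw [map_zero, mul_zero, smul_zero]
    · rfl

end Fibre

/-! ### Functionals given by a fibre -/

namespace Fibre

open scoped InnerProductSpace

variable {q : Param} (𝔉 : Fibre q)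

open Classical in
/-- The contribution `q^{-2(k+1)} ∫ f(q^{2(k+1)} pt t) dm(t)` of the index `k ∈ J`. -/
noncomputable def term (k : ℤ) (f : LBorel) : ℂ :=
  if k ∈ 𝔉.J then q.c ^ (-(2 * (k + 1))) * ∫ t, (𝔉.ev k f : 𝔉.T → ℂ) t ∂𝔉.m else 0

/-- `h` vanishes off the diagonal and is the sum of the contributions of all indices. -/
structure Represents (h : F0 q →ₗ[ℂ] ℂ) : Prop where
  offDiag : F0.VanishesOffDiagonal h
  hasSum : ∀ (f : LBorel) (hf : HasCompactSupport (f : PLine → ℂ)),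
    HasSum (fun k => 𝔉.term k f) (h (F0.ofFun f hf))

variable {𝔉}

theorem Represents.scaling {h : F0 q →ₗ[ℂ] ℂ} (hh : 𝔉.Represents h) : F0.ScalingCondition h := by
  intro f hf
  have h1 := hh.hasSum (shift q (-1) (f * (1 - coordY))) (F0.hcs_shift (q := q) (-1) hf.mul_right)
  have h2 := (hh.hasSum (f * (1 - coordY)) hf.mul_right).mul_left (q.c ^ (-2 : ℤ))
  rw [← (Equiv.subRight (1 : ℤ)).hasSum_iff] at h2
  refine h1.unique (Eq.mp (congrArg (fun g => HasSum g _) (funext fun k => ?_)) h2)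
  symm
  show 𝔉.term k _ = q.c ^ (-2 : ℤ) * 𝔉.term (k - 1) _
  unfold term
  rw [ev_shift, ← sub_eq_add_neg]
  by_cases hk : k ∈ 𝔉.J
  · rw [if_pos hk]
    by_cases hk' : k - 1 ∈ 𝔉.J
    · rw [if_pos hk', ← mul_assoc, ← zpow_add₀ q.c_ne]
      congr 2
      ring
    · -- at the edge of `J` the factor `1 - y` vanishes
      have h0 : 𝔉.ev (k - 1) (f * (1 - coordY)) = 0 := by
        rw [map_mul, ← F0.lin_zero (q := q), ← 𝔉.al_mul_al hk (k := k - 1) (j := 0) (by ring),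
          𝔉.al_edge hk hk', mul_zero, mul_zero]
      rw [if_neg hk', h0, mul_zero]
      show _ * ∫ t, (0 : ℂ) ∂_ = 0
      rw [integral_zero, mul_zero]
  · rw [if_neg hk, if_neg, mul_zero]
    exact fun h' => hk (𝔉.mem_J_of_le h' (by omega))

theorem Represents.invariant {h : F0 q →ₗ[ℂ] ℂ} (hh : 𝔉.Represents h) : F0.IsInvariant h :=
  F0.isInvariant_of hh.offDiag hh.scaling

variable (𝔉)

theorem ev_coc_neg (m k : ℤ) : 𝔉.ev k (coc q (-m) m)
    = ∏ i ∈ Finset.Ioc (min (m + k) k) (max (m + k) k), 𝔉.ev k (lin q (i - k - 1)) := by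
  rw [coc, map_prod]
  refine Finset.prod_bij' (fun j _ => j + k + 1) (fun i _ => i - k - 1) ?_ ?_ ?_ ?_ ?_
  · intro j hj
    unfold cocSet at hj
    split_ifs at hj <;> simp only [Finset.mem_Ico, Finset.mem_Ioc] at hj ⊢ <;> omega
  · intro i hi
    unfold cocSet
    split_ifs <;> simp only [Finset.mem_Ico, Finset.mem_Ioc] at hi ⊢ <;> omega
  · intro j _; ring
  · intro i _; ring
  · intro j _
    rw [show j + k + 1 - k - 1 = j by ring]

theorem wt_mul_wt {m k : ℤ} (hn : m + k ∈ 𝔉.J) (hk : k ∈ 𝔉.J) :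
    𝔉.wt (m + k) k * 𝔉.wt (m + k) k = 𝔉.ev k (coc q (-m) m) := by
  rw [ev_coc_neg, wt, ← Finset.prod_mul_distrib]
  refine Finset.prod_congr rfl fun i hi => 𝔉.al_mul_al ?_ (by ring)
  rw [Finset.mem_Ioc] at hi
  rcases min_choice (m + k) k with h | h
  · exact 𝔉.mem_J_of_le hn (by omega)
  · exact 𝔉.mem_J_of_le hk (by omega)

theorem ev_coc_neg_edge {m k : ℤ} (hn : m + k ∉ 𝔉.J) (hk : k ∈ 𝔉.J) :
    𝔉.ev k (coc q (-m) m) = 0 := by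
  obtain ⟨i, hi, h0⟩ := 𝔉.edge hk hn
  rw [Finset.mem_Ioc] at hi
  rw [ev_coc_neg]
  refine Finset.prod_eq_zero (i := i) ?_ (BddMeas.ext fun t => ?_)
  · rw [Finset.mem_Ioc]
    exact ⟨(min_le_left _ _).trans_lt hi.1, hi.2.trans (le_max_right _ _)⟩
  · rw [ev_lin_apply, show i - k - 1 + k + 1 = i by ring, fac, h0]; rfl

theorem conj_wt (n k : ℤ) (t : 𝔉.T) :
    (starRingEnd ℂ) ((𝔉.wt n k : 𝔉.T → ℂ) t) = (𝔉.wt n k : 𝔉.T → ℂ) t := by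
  have h : (𝔉.wt n k : 𝔉.T → ℂ) t
      = ∏ i ∈ Finset.Ioc (min n k) (max n k), ((Real.sqrt (𝔉.fac i t) : ℝ) : ℂ) := by
    have h1 : (𝔉.wt n k : 𝔉.T → ℂ) = ∏ i ∈ Finset.Ioc (min n k) (max n k), (𝔉.al i : 𝔉.T → ℂ) := by
      rw [wt]; exact map_prod (BddMeas 𝔉.T).val _ _
    rw [h1, Finset.prod_apply]
    rfl
  rw [h, map_prod]
  exact Finset.prod_congr rfl fun i _ => Complex.conj_ofReal _

/-- The inner product of the coordinates at one position. -/
noncomputable def pair (b b' : 𝔉.B) : ℂ :=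
  ∫ t, (starRingEnd ℂ) ((b : 𝔉.T → ℂ) t) * (b' : 𝔉.T → ℂ) t ∂𝔉.m

theorem pair_zero_left (b : 𝔉.B) : 𝔉.pair 0 b = 0 := by
  have : ∀ t, (starRingEnd ℂ) (((0 : 𝔉.B) : 𝔉.T → ℂ) t) * (b : 𝔉.T → ℂ) t = 0 := fun t => by
    show (starRingEnd ℂ) 0 * _ = 0
    rw [map_zero, zero_mul]
  rw [pair, integral_congr_ae (ae_of_all _ this), integral_zero]

/-- The weights and powers of `q` in the coordinates are chosen so that the form `h(x* y)` becomes
the sum of the inner products of the coordinates. -/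
theorem pair_coord (m k : ℤ) (x y : FU q) :
    𝔉.pair (𝔉.coord (m + k) k x) (𝔉.coord (m + k) k y)
      = 𝔉.term k (star (FU.coeff m x) * coc q (-m) m * FU.coeff m y) := by
  unfold term
  by_cases hk : k ∈ 𝔉.J
  swap
  · rw [if_neg hk, 𝔉.coord_of_notMem fun h => hk h.2, pair_zero_left]
  rw [if_pos hk]
  by_cases hn : m + k ∈ 𝔉.J
  swap
  · have h0 : 𝔉.ev k (star (FU.coeff m x) * coc q (-m) m * FU.coeff m y) = 0 := by
      rw [map_mul, map_mul, 𝔉.ev_coc_neg_edge hn hk, mul_zero, zero_mul]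
    rw [𝔉.coord_of_notMem fun h => hn h.1, pair_zero_left, h0]
    show 0 = _ * ∫ t, (0 : ℂ) ∂_
    rw [integral_zero, mul_zero]
  rw [𝔉.coord_of_mem hn hk, 𝔉.coord_of_mem hn hk, pair, ← integral_const_mul]
  refine integral_congr_ae (ae_of_all _ fun t => ?_)
  have hw : (𝔉.wt (m + k) k : 𝔉.T → ℂ) t * (𝔉.wt (m + k) k : 𝔉.T → ℂ) t
      = (coc q (-m) m : PLine → ℂ) (𝔉.pos_at k t) :=
    congrFun (congrArg Subtype.val (𝔉.wt_mul_wt hn hk)) t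
  rw [show m + k - k = m by ring]
  show (starRingEnd ℂ) (((-1) ^ k * q.c ^ (-(k + 1))) * ((𝔉.wt (m + k) k : 𝔉.T → ℂ) t
      * (FU.coeff m x : PLine → ℂ) (𝔉.pos_at k t)))
      * (((-1) ^ k * q.c ^ (-(k + 1))) * ((𝔉.wt (m + k) k : 𝔉.T → ℂ) t
      * (FU.coeff m y : PLine → ℂ) (𝔉.pos_at k t)))
    = q.c ^ (-(2 * (k + 1))) * ((starRingEnd ℂ) ((FU.coeff m x : PLine → ℂ) (𝔉.pos_at k t))
      * (coc q (-m) m : PLine → ℂ) (𝔉.pos_at k t) * (FU.coeff m y : PLine → ℂ) (𝔉.pos_at k t))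
  rw [← hw, map_mul, map_mul, map_mul, map_zpow₀, map_zpow₀, map_neg, map_one, q.conj_c, conj_wt,
    show -(2 * (k + 1)) = -(k + 1) + -(k + 1) by ring, zpow_add₀ q.c_ne]
  have hsign : (-1 : ℂ) ^ k * (-1) ^ k = 1 := by rw [← mul_zpow]; simp
  linear_combination (q.c ^ (-(k + 1)) * q.c ^ (-(k + 1)) * (𝔉.wt (m + k) k : 𝔉.T → ℂ) t
    * (𝔉.wt (m + k) k : 𝔉.T → ℂ) t * (starRingEnd ℂ) ((FU.coeff m x : PLine → ℂ) (𝔉.pos_at k t))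
    * (FU.coeff m y : PLine → ℂ) (𝔉.pos_at k t)) * hsign

end Fibre

theorem FU.coeff_zero_star_mul {q : Param} (x y : FU q) : FU.coeff 0 (star x * y)
    = ∑ m ∈ Finsupp.support (y : ℤ →₀ LBorel),
      star (FU.coeff m x) * coc q (-m) m * FU.coeff m y := by
  conv_lhs => rw [F0.sum_mono y, Finset.mul_sum, map_sum]
  refine Finset.sum_congr rfl fun m _ => ?_
  rw [FU.coeff_mul_mono, zero_sub, FU.coeff_star, neg_neg, shift_shift, add_neg_cancel, shift_zero]
  ring

theorem F0.hasCompactSupport_term {q : Param} (x y : F0 q) (m : ℤ) : HasCompactSupport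
    ((star (FU.coeff m x.1) * coc q (-m) m * FU.coeff m y.1 : LBorel) : PLine → ℂ) :=
  (y.2 m).mul_left (f := ((star (FU.coeff m x.1) * coc q (-m) m : LBorel) : PLine → ℂ))

theorem F0.map_starMul {q : Param} {h : F0 q →ₗ[ℂ] ℂ} (hv : F0.VanishesOffDiagonal h)
    (x y : F0 q) : h (F0.starMul x y) = ∑ m ∈ Finsupp.support (y.1 : ℤ →₀ LBorel),
      h (F0.ofFun _ (F0.hasCompactSupport_term x y m)) := by
  rw [F0.map_diag hv, ← map_sum]
  congr 1
  refine Subtype.ext ?_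
  rw [AddSubmonoidClass.coe_finsetSum]
  show FU.mono 0 (FU.coeff 0 (star x.1 * y.1)) = ∑ m ∈ _, FU.mono 0 _
  rw [FU.coeff_zero_star_mul, map_sum]

namespace Fibre

open scoped InnerProductSpace

variable {q : Param} {𝔉 : Fibre q}

/-- The form `h(x* y)` in coordinates. -/
theorem Represents.hasSum_pair {h : F0 q →ₗ[ℂ] ℂ} (hh : 𝔉.Represents h) (x y : F0 q) :
    HasSum (fun p => 𝔉.pair (𝔉.val x p) (𝔉.val y p)) (h (F0.starMul x y)) := by
  -- the positions `(n, k)` are fibred over the degree `m = n - k`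
  let σ : ℤ × ℤ ≃ ℤ × ℤ :=
    { toFun := fun p => (p.1 + p.2, p.2)
      invFun := fun p => (p.1 - p.2, p.2)
      left_inv := fun p => Prod.ext (add_sub_cancel_right _ _) rfl
      right_inv := fun p => Prod.ext (sub_add_cancel _ _) rfl }
  have hS : Summable (fun p => 𝔉.pair (𝔉.val x p) (𝔉.val y p)) := by
    refine summable_of_hasFiniteSupport ((𝔉.val x).support.finite_toSet.subset fun p hp => ?_)
    refine Finsupp.mem_support_iff.2 fun h0 => hp ?_
    show 𝔉.pair (𝔉.val x p) (𝔉.val y p) = 0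
    rw [h0, pair_zero_left]
  have h1 := hS.hasSum
  rw [← σ.hasSum_iff] at h1
  have h2 : ∀ m : ℤ, HasSum (fun k : ℤ => 𝔉.pair (𝔉.val x (m + k, k)) (𝔉.val y (m + k, k)))
      (h (F0.ofFun _ (F0.hasCompactSupport_term x y m))) := by
    intro m
    convert hh.hasSum _ (F0.hasCompactSupport_term x y m) using 1
    funext k
    exact 𝔉.pair_coord m k x.1 y.1
  have h3 := HasSum.prod_fiberwise h1 h2
  have h4 : HasSum (fun m => h (F0.ofFun _ (F0.hasCompactSupport_term x y m)))
      (∑ m ∈ Finsupp.support (y.1 : ℤ →₀ LBorel),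
        h (F0.ofFun _ (F0.hasCompactSupport_term x y m))) := by
    refine hasSum_sum_of_ne_finset_zero fun m hm => ?_
    refine Eq.trans (congrArg h (Subtype.ext ?_)) (map_zero h)
    have h0 : FU.coeff m y.1 = 0 := Finsupp.notMem_support_iff.1 hm
    show FU.mono 0 _ = 0
    rw [h0, mul_zero, map_zero]
  rw [F0.map_starMul hh.offDiag, h4.unique h3]
  exact hS.hasSum

variable {H : Type} [NormedAddCommGroup H] [InnerProductSpace ℂ H]

variable (𝔉) in
/-- A family of linear maps into a Hilbert space under which the positions are orthogonal and the
inner product at each position is that of `L²(m)`. -/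
def IsRealization (e : ℤ → ℤ → 𝔉.B →ₗ[ℂ] H) : Prop :=
  ∀ (n k n' k' : ℤ), n ∈ 𝔉.J → k ∈ 𝔉.J → n' ∈ 𝔉.J → k' ∈ 𝔉.J → ∀ b b' : 𝔉.B,
    ⟪e n k b, e n' k' b'⟫_ℂ = if n = n' ∧ k = k' then 𝔉.pair b b' else 0

variable (𝔉) in
/-- The map from `F_0(U_q)` to the Hilbert space given by the coordinates. -/
noncomputable def toHilbert (e : ℤ → ℤ → 𝔉.B →ₗ[ℂ] H) : F0 q →ₗ[ℂ] H :=
  (Finsupp.lsum ℂ fun p : ℤ × ℤ => e p.1 p.2) ∘ₗ 𝔉.val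

variable {e : ℤ → ℤ → 𝔉.B →ₗ[ℂ] H}

theorem toHilbert_eq_sum {x : F0 q} {S : Finset (ℤ × ℤ)} (hS : (𝔉.val x).support ⊆ S) :
    𝔉.toHilbert e x = ∑ p ∈ S, e p.1 p.2 (𝔉.val x p) :=
  Finsupp.sum_of_support_subset _ hS _ fun _ _ => map_zero _

theorem toHilbert_of_val {x : F0 q} {n k : ℤ} {b : 𝔉.B} (hx : 𝔉.val x = Finsupp.single (n, k) b) :
    𝔉.toHilbert e x = e n k b := by
  unfold toHilbert
  rw [LinearMap.comp_apply, hx, Finsupp.lsum_single]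

theorem Represents.inner_toHilbert {h : F0 q →ₗ[ℂ] ℂ} (hh : 𝔉.Represents h)
    (he : 𝔉.IsRealization e) (x y : F0 q) :
    ⟪𝔉.toHilbert e x, 𝔉.toHilbert e y⟫_ℂ = h (F0.starMul x y) := by
  classical
  set S := (𝔉.val x).support ∪ (𝔉.val y).support with hSdef
  refine HasSum.unique ?_ (hh.hasSum_pair x y)
  rw [toHilbert_eq_sum (S := S) Finset.subset_union_left,
    toHilbert_eq_sum (S := S) Finset.subset_union_right, sum_inner]
  have h1 : ∀ p ∈ S, ⟪e p.1 p.2 (𝔉.val x p), ∑ p' ∈ S, e p'.1 p'.2 (𝔉.val y p')⟫_ℂ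
      = 𝔉.pair (𝔉.val x p) (𝔉.val y p) := by
    intro p hp
    by_cases hpJ : p.1 ∈ 𝔉.J ∧ p.2 ∈ 𝔉.J
    swap
    · have h0 : 𝔉.val x p = 0 := 𝔉.coord_of_notMem hpJ _
      rw [h0, map_zero, inner_zero_left, pair_zero_left]
    rw [inner_sum, Finset.sum_eq_single p]
    · rw [he _ _ _ _ hpJ.1 hpJ.2 hpJ.1 hpJ.2, if_pos ⟨rfl, rfl⟩]
    · intro p' _ hne
      by_cases hpJ' : p'.1 ∈ 𝔉.J ∧ p'.2 ∈ 𝔉.J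
      swap
      · have h0 : 𝔉.val y p' = 0 := 𝔉.coord_of_notMem hpJ' _
        rw [h0, map_zero, inner_zero_right]
      rw [he _ _ _ _ hpJ.1 hpJ.2 hpJ'.1 hpJ'.2, if_neg]
      exact fun h => hne (Prod.ext h.1.symm h.2.symm)
    · exact fun h => absurd hp h
  rw [Finset.sum_congr rfl h1]
  refine hasSum_sum_of_ne_finset_zero fun p hp => ?_
  have h0 : 𝔉.val x p = 0 := by
    by_contra hne
    exact hp (Finset.mem_union_left _ (Finsupp.mem_support_iff.2 hne))
  rw [h0, pair_zero_left]

theorem Represents.isPositive {h : F0 q →ₗ[ℂ] ℂ} (hh : 𝔉.Represents h)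
    (he : 𝔉.IsRealization e) : F0.IsPositive h := by
  intro x
  refine ⟨‖𝔉.toHilbert e x‖ ^ 2, sq_nonneg _, ?_⟩
  rw [← hh.inner_toHilbert he, inner_self_eq_norm_sq_to_K]
  norm_cast

theorem range_toHilbert : LinearMap.range (𝔉.toHilbert e)
    = Submodule.span ℂ {ξ | ∃ n ∈ 𝔉.J, ∃ k ∈ 𝔉.J, ∃ b, ξ = e n k b} := by
  apply le_antisymm
  · rintro _ ⟨x, rfl⟩
    rw [toHilbert_eq_sum (Finset.Subset.refl _)]
    refine Submodule.sum_mem _ fun p _ => ?_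
    by_cases hpJ : p.1 ∈ 𝔉.J ∧ p.2 ∈ 𝔉.J
    · exact Submodule.subset_span ⟨p.1, hpJ.1, p.2, hpJ.2, _, rfl⟩
    · have h0 : 𝔉.val x p = 0 := 𝔉.coord_of_notMem hpJ _
      rw [h0, map_zero]
      exact Submodule.zero_mem _
  · rw [Submodule.span_le]
    rintro _ ⟨n, hn, k, hk, b, rfl⟩
    obtain ⟨x, hx⟩ := 𝔉.exists_val_eq_single hn hk b
    exact ⟨x, toHilbert_of_val hx⟩

/-! ### Weighted shifts -/

variable (𝔉) in
/-- `T` acts on coordinates as a weighted shift by `d` with weights `g`. -/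
def IsShift (T : Module.End ℂ (F0 q)) (d : ℤ × ℤ) (g : ℤ × ℤ → 𝔉.B) : Prop :=
  ∀ x p, 𝔉.val (T x) p = g p * 𝔉.val x (p + d)

theorem IsShift.mul {T T' : Module.End ℂ (F0 q)} {d d' : ℤ × ℤ} {g g' : ℤ × ℤ → 𝔉.B}
    (h : 𝔉.IsShift T d g) (h' : 𝔉.IsShift T' d' g') :
    𝔉.IsShift (T * T') (d + d') fun p => g p * g' (p + d) := by
  intro x p
  rw [Module.End.mul_apply, h, h', mul_assoc, add_assoc]

theorem IsShift.val_eq_single {T : Module.End ℂ (F0 q)} {d : ℤ × ℤ} {g : ℤ × ℤ → 𝔉.B}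
    (h : 𝔉.IsShift T d g) {x : F0 q} {p : ℤ × ℤ} {b : 𝔉.B} (hx : 𝔉.val x = Finsupp.single p b) :
    𝔉.val (T x) = Finsupp.single (p - d) (g (p - d) * b) := by
  classical
  ext1 p'
  rw [h, hx, Finsupp.single_apply, Finsupp.single_apply]
  by_cases hp : p = p' + d
  · have : p - d = p' := by rw [hp, add_sub_cancel_right]
    rw [if_pos hp, if_pos this, this]
  · rw [if_neg hp, if_neg, mul_zero]
    exact fun h' => hp (by rw [← h', sub_add_cancel])

end Fibre

namespace F0

variable {q : Param}

/-- Right multiplication by an element of `F(U_q)`. -/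
noncomputable def rmulEnd (y : FU q) : Module.End ℂ (F0 q) where
  toFun x := ⟨x.1 * y, mul_right_mem x.2 y⟩
  map_add' _ _ := Subtype.ext (add_mul _ _ _)
  map_smul' _ _ := Subtype.ext (smul_mul_assoc _ _ _)

/-- The automorphism `X_n f(y) ↦ c^n X_n f(y)` on `F_0(U_q)`. -/
noncomputable def gradeEnd (c : ℂ) (hc : c ≠ 0) : Module.End ℂ (F0 q) where
  toFun x := ⟨FU.grade c hc x.1, grade_mem c hc x.2⟩
  map_add' _ _ := Subtype.ext (map_add _ _ _)
  map_smul' _ _ := Subtype.ext (map_smul _ _ _)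

theorem uqEnd_K : uqEnd (Uq.K : Uq q) = gradeEnd q.c q.c_ne := by
  ext x : 1
  refine Subtype.ext ?_
  show FU.act x.1 (Uq.antipodeInv Uq.K) = _
  rw [Uq.antipodeInv_K]
  exact FU.datum.act_Kinv x.1

theorem uqEnd_Kinv : uqEnd (Uq.Kinv : Uq q) = gradeEnd q.c⁻¹ (inv_ne_zero q.c_ne) := by
  ext x : 1
  refine Subtype.ext ?_
  show FU.act x.1 (Uq.antipodeInv Uq.Kinv) = _
  rw [Uq.antipodeInv_Kinv]
  exact FU.datum.act_K x.1

theorem uqEnd_E : uqEnd (Uq.E : Uq q) = (-(q.c⁻¹ * (q.sqrt * q.lam⁻¹))) •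
    (discEnd Disc.z * gradeEnd q.c⁻¹ (inv_ne_zero q.c_ne) - rmulEnd FU.z * gradeEnd q.c q.c_ne) := by
  ext x : 1
  refine Subtype.ext ?_
  show FU.act x.1 (Uq.antipodeInv Uq.E) = (-(q.c⁻¹ * (q.sqrt * q.lam⁻¹))) •
    (incl Disc.z * FU.grade _ _ x.1 - FU.grade _ _ x.1 * FU.z)
  rw [Uq.antipodeInv_E, map_neg, map_smul, FU.act_E, incl_z, neg_smul, smul_smul]

theorem uqEnd_F : uqEnd (Uq.F : Uq q) = (-(q.c * (q.sqrt⁻¹ * q.lam⁻¹))) •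
    (rmulEnd (star FU.z) * gradeEnd q.c q.c_ne
      - discEnd Disc.zs * gradeEnd q.c⁻¹ (inv_ne_zero q.c_ne)) := by
  ext x : 1
  refine Subtype.ext ?_
  show FU.act x.1 (Uq.antipodeInv Uq.F) = (-(q.c * (q.sqrt⁻¹ * q.lam⁻¹))) •
    (FU.grade _ _ x.1 * star FU.z - incl Disc.zs * FU.grade _ _ x.1)
  rw [Uq.antipodeInv_F, map_neg, map_smul, FU.act_F, incl_zs, neg_smul, smul_smul]

end F0

namespace Fibre

open F0

variable {q : Param} (𝔉 : Fibre q)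

theorem isShift_z : 𝔉.IsShift (discEnd Disc.z) (-1, 0) fun p => 𝔉.al p.1 := by
  rintro x ⟨n, k⟩
  show 𝔉.coord n k (incl Disc.z * x.1) = 𝔉.al n * 𝔉.coord (n + -1) (k + 0) x.1
  rw [incl_z, coord_z_mul, add_zero, sub_eq_add_neg]

theorem isShift_zs : 𝔉.IsShift (discEnd Disc.zs) (1, 0) fun p => 𝔉.al (p.1 + 1) := by
  rintro x ⟨n, k⟩
  show 𝔉.coord n k (incl Disc.zs * x.1) = 𝔉.al (n + 1) * 𝔉.coord (n + 1) (k + 0) x.1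
  rw [incl_zs, coord_star_z_mul, add_zero]

theorem isShift_rmul_z : 𝔉.IsShift (rmulEnd FU.z) (0, 1) fun p => (-q.c) • 𝔉.al (p.2 + 1) := by
  rintro x ⟨n, k⟩
  show 𝔉.coord n k (x.1 * FU.z) = (-q.c) • 𝔉.al (k + 1) * 𝔉.coord (n + 0) (k + 1) x.1
  rw [coord_mul_z, add_zero, smul_mul_assoc]

theorem isShift_rmul_star_z :
    𝔉.IsShift (rmulEnd (star FU.z)) (0, -1) fun p => (-q.c⁻¹) • 𝔉.al p.2 := by
  rintro x ⟨n, k⟩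
  show 𝔉.coord n k (x.1 * star FU.z) = (-q.c⁻¹) • 𝔉.al k * 𝔉.coord (n + 0) (k + -1) x.1
  rw [coord_mul_star_z, add_zero, smul_mul_assoc, sub_eq_add_neg]

theorem isShift_grade (c : ℂ) (hc : c ≠ 0) :
    𝔉.IsShift (gradeEnd c hc) 0 fun p => c ^ (p.1 - p.2) • 1 := by
  rintro x ⟨n, k⟩
  show 𝔉.coord n k (FU.grade c hc x.1) = c ^ (n - k) • 1 * 𝔉.coord (n + 0) (k + 0) x.1
  rw [coord_grade, add_zero, add_zero, smul_mul_assoc, one_mul]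

theorem isShift_one : 𝔉.IsShift 1 0 fun _ => 1 := by
  intro x p
  rw [Module.End.one_apply, one_mul, add_zero]

/-- The operators on `F_0(U_q)` which act on coordinates as weighted shifts. -/
def shifts : Submonoid (Module.End ℂ (F0 q)) where
  carrier := {T | ∃ d g, 𝔉.IsShift T d g}
  mul_mem' := by
    rintro T T' ⟨d, g, h⟩ ⟨d', g', h'⟩
    exact ⟨_, _, h.mul h'⟩
  one_mem' := ⟨_, _, 𝔉.isShift_one⟩

/-- Every operator of the Heisenberg action is a linear combination of weighted shifts. -/
theorem cross_mem_span (a : CrossSpace q) :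
    cross a ∈ Submodule.span ℂ (𝔉.shifts : Set (Module.End ℂ (F0 q))) := by
  have hA : Subalgebra.toSubmodule (Algebra.adjoin ℂ (𝔉.shifts : Set (Module.End ℂ (F0 q))))
      = Submodule.span ℂ (𝔉.shifts : Set (Module.End ℂ (F0 q))) := by
    rw [Algebra.adjoin_eq_span, Submonoid.closure_eq]
  rw [← hA, Subalgebra.mem_toSubmodule]
  set 𝒜 := Algebra.adjoin ℂ (𝔉.shifts : Set (Module.End ℂ (F0 q)))
  have hz : discEnd Disc.z ∈ 𝒜 := Algebra.subset_adjoin ⟨_, _, 𝔉.isShift_z⟩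
  have hzs : discEnd Disc.zs ∈ 𝒜 := Algebra.subset_adjoin ⟨_, _, 𝔉.isShift_zs⟩
  have hrz : rmulEnd FU.z ∈ 𝒜 := Algebra.subset_adjoin ⟨_, _, 𝔉.isShift_rmul_z⟩
  have hrzs : rmulEnd (star FU.z) ∈ 𝒜 := Algebra.subset_adjoin ⟨_, _, 𝔉.isShift_rmul_star_z⟩
  have hgr : ∀ c hc, gradeEnd c hc ∈ 𝒜 :=
    fun c hc => Algebra.subset_adjoin ⟨_, _, 𝔉.isShift_grade c hc⟩
  have hd : ∀ b : Disc q, discEnd b ∈ 𝒜 := by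
    intro b
    refine Disc.induction (P := fun b => discEnd b ∈ 𝒜) ?_ hz hzs ?_ ?_ b
    · intro r; rw [discEnd_algebraMap]; exact 𝒜.algebraMap_mem r
    · intro a b ha hb; rw [discEnd_mul]; exact 𝒜.mul_mem ha hb
    · intro a b ha hb; rw [map_add]; exact 𝒜.add_mem ha hb
  have hu : ∀ f : Uq q, uqEnd f ∈ 𝒜 := by
    intro f
    refine Uq.induction (P := fun f => uqEnd f ∈ 𝒜) ?_ ?_ ?_ ?_ ?_ ?_ ?_ f
    · intro r; rw [uqEnd_algebraMap]; exact 𝒜.algebraMap_mem r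
    · rw [uqEnd_E]
      exact 𝒜.smul_mem (𝒜.sub_mem (𝒜.mul_mem hz (hgr _ _)) (𝒜.mul_mem hrz (hgr _ _))) _
    · rw [uqEnd_F]
      exact 𝒜.smul_mem (𝒜.sub_mem (𝒜.mul_mem hrzs (hgr _ _)) (𝒜.mul_mem hzs (hgr _ _))) _
    · rw [uqEnd_K]; exact hgr _ _
    · rw [uqEnd_Kinv]; exact hgr _ _
    · intro a b ha hb; rw [uqEnd_mul]; exact 𝒜.mul_mem ha hb
    · intro a b ha hb; rw [map_add]; exact 𝒜.add_mem ha hb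
  induction a using TensorProduct.induction_on with
  | zero => rw [map_zero]; exact 𝒜.zero_mem
  | add a b ha hb => rw [map_add]; exact 𝒜.add_mem ha hb
  | tmul f b => rw [cross_tmul]; exact 𝒜.mul_mem (hu f) (hd b)

variable {𝔉}

theorem val_z {x : F0 q} {n k : ℤ} {b : 𝔉.B} (hx : 𝔉.val x = Finsupp.single (n, k) b) :
    𝔉.val (discEnd Disc.z x) = Finsupp.single (n + 1, k) (𝔉.al (n + 1) * b) := by
  have h := 𝔉.isShift_z.val_eq_single hx
  have e : ((n, k) : ℤ × ℤ) - (-1, 0) = (n + 1, k) := by ext <;> simp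
  rw [h, e]

theorem val_zs {x : F0 q} {n k : ℤ} {b : 𝔉.B} (hx : 𝔉.val x = Finsupp.single (n, k) b) :
    𝔉.val (discEnd Disc.zs x) = Finsupp.single (n - 1, k) (𝔉.al n * b) := by
  have h := 𝔉.isShift_zs.val_eq_single hx
  have e : ((n, k) : ℤ × ℤ) - (1, 0) = (n - 1, k) := by ext <;> simp
  rw [h, e]
  simp only [sub_add_cancel]

theorem val_rmul_z {x : F0 q} {n k : ℤ} {b : 𝔉.B} (hx : 𝔉.val x = Finsupp.single (n, k) b) :
    𝔉.val (rmulEnd FU.z x) = Finsupp.single (n, k - 1) ((-q.c) • (𝔉.al k * b)) := by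
  have h := 𝔉.isShift_rmul_z.val_eq_single hx
  have e : ((n, k) : ℤ × ℤ) - (0, 1) = (n, k - 1) := by ext <;> simp
  rw [h, e]
  simp only [sub_add_cancel, smul_mul_assoc]

theorem val_rmul_star_z {x : F0 q} {n k : ℤ} {b : 𝔉.B} (hx : 𝔉.val x = Finsupp.single (n, k) b) :
    𝔉.val (rmulEnd (star FU.z) x)
      = Finsupp.single (n, k + 1) ((-q.c⁻¹) • (𝔉.al (k + 1) * b)) := by
  have h := 𝔉.isShift_rmul_star_z.val_eq_single hx
  have e : ((n, k) : ℤ × ℤ) - (0, -1) = (n, k + 1) := by ext <;> simp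
  rw [h, e, smul_mul_assoc]

theorem val_grade {x : F0 q} {n k : ℤ} {b : 𝔉.B} (hx : 𝔉.val x = Finsupp.single (n, k) b) (c : ℂ)
    (hc : c ≠ 0) : 𝔉.val (gradeEnd c hc x) = Finsupp.single (n, k) (c ^ (n - k) • b) := by
  rw [(𝔉.isShift_grade c hc).val_eq_single hx, sub_zero, smul_mul_assoc, one_mul]

variable {H : Type} [NormedAddCommGroup H] [InnerProductSpace ℂ H] {e : ℤ → ℤ → 𝔉.B →ₗ[ℂ] H}

theorem sqrt_mul_sqrt : q.sqrt * q.sqrt = q.c := by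
  unfold Param.sqrt Param.c
  rw [← Complex.ofReal_mul, Real.mul_self_sqrt q.pos.le]

theorem toHilbert_F {x : F0 q} {n k : ℤ} {b : 𝔉.B} (hx : 𝔉.val x = Finsupp.single (n, k) b) :
    𝔉.toHilbert e (uqEnd Uq.F x)
      = (q.lam⁻¹ * q.c ^ (n - k) * q.sqrt⁻¹) • e n (k + 1) (𝔉.al (k + 1) * b)
        + (q.lam⁻¹ * q.c ^ (-(n - k)) * q.sqrt) • e (n - 1) k (𝔉.al n * b) := by
  have hs := q.sqrt_ne
  have h1 := toHilbert_of_val (e := e) (val_rmul_star_z (val_grade hx q.c q.c_ne))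
  have h2 := toHilbert_of_val (e := e) (val_zs (val_grade hx q.c⁻¹ (inv_ne_zero q.c_ne)))
  rw [uqEnd_F, LinearMap.smul_apply, LinearMap.sub_apply, Module.End.mul_apply,
    Module.End.mul_apply, map_smul, map_sub, h1, h2, mul_smul_comm, mul_smul_comm, map_smul,
    map_smul, map_smul, smul_sub, smul_smul, smul_smul, smul_smul, sub_eq_add_neg, ← neg_smul,
    inv_zpow', ← sqrt_mul_sqrt]
  congr 2 <;> field_simp

theorem toHilbert_E {x : F0 q} {n k : ℤ} {b : 𝔉.B} (hx : 𝔉.val x = Finsupp.single (n, k) b) :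
    𝔉.toHilbert e (uqEnd Uq.E x)
      = -(q.lam⁻¹ * q.c ^ (n - k) * q.sqrt) • e n (k - 1) (𝔉.al k * b)
        - (q.lam⁻¹ * q.c ^ (-(n - k)) * q.sqrt⁻¹) • e (n + 1) k (𝔉.al (n + 1) * b) := by
  have hs := q.sqrt_ne
  have h1 := toHilbert_of_val (e := e) (val_rmul_z (val_grade hx q.c q.c_ne))
  have h2 := toHilbert_of_val (e := e) (val_z (val_grade hx q.c⁻¹ (inv_ne_zero q.c_ne)))
  have c1 : -(q.c⁻¹ * (q.sqrt * q.lam⁻¹)) * q.c⁻¹ ^ (n - k)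
      = -(q.lam⁻¹ * q.c ^ (-(n - k)) * q.sqrt⁻¹) := by
    rw [inv_zpow', ← sqrt_mul_sqrt]; field_simp
  have c2 : -(q.c⁻¹ * (q.sqrt * q.lam⁻¹)) * -q.c * q.c ^ (n - k)
      = q.lam⁻¹ * q.c ^ (n - k) * q.sqrt := by
    have := q.c_ne
    field_simp
  rw [uqEnd_E, LinearMap.smul_apply, LinearMap.sub_apply, Module.End.mul_apply,
    Module.End.mul_apply, map_smul, map_sub, h1, h2, mul_smul_comm, mul_smul_comm, map_smul,
    map_smul, map_smul, smul_sub, smul_smul, smul_smul, smul_smul, c1, c2]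
  module

theorem cross_one_tmul (a : Disc q) : cross ((1 : Uq q) ⊗ₜ a) = discEnd a := by
  rw [cross_tmul, ← map_one (algebraMap ℂ (Uq q)), uqEnd_algebraMap, map_one, one_mul]

theorem cross_tmul_one (f : Uq q) : cross (f ⊗ₜ (1 : Disc q)) = uqEnd f := by
  rw [cross_tmul, ← map_one (algebraMap ℂ (Disc q)), discEnd_algebraMap, map_one, mul_one]

/-- The action of the generators on the vectors `e n k b`. -/
theorem action_of_isImage {ρ : StarRep q H} (hρ : ρ.IsImage (𝔉.toHilbert e)) {n k : ℤ}
    (hn : n ∈ 𝔉.J) (hk : k ∈ 𝔉.J) (b : 𝔉.B) (ξ : ρ.dom) (hξ : (ξ : H) = e n k b) :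
    ((ρ.disc Disc.z ξ : ρ.dom) : H) = e (n + 1) k (𝔉.al (n + 1) * b) ∧
    ((ρ.disc Disc.zs ξ : ρ.dom) : H) = e (n - 1) k (𝔉.al n * b) ∧
    ((ρ.uq Uq.K ξ : ρ.dom) : H) = q.c ^ (n - k) • e n k b ∧
    ((ρ.uq Uq.F ξ : ρ.dom) : H)
      = (q.lam⁻¹ * q.c ^ (n - k) * q.sqrt⁻¹) • e n (k + 1) (𝔉.al (k + 1) * b)
        + (q.lam⁻¹ * q.c ^ (-(n - k)) * q.sqrt) • e (n - 1) k (𝔉.al n * b) ∧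
    ((ρ.uq Uq.E ξ : ρ.dom) : H)
      = -(q.lam⁻¹ * q.c ^ (n - k) * q.sqrt) • e n (k - 1) (𝔉.al k * b)
        - (q.lam⁻¹ * q.c ^ (-(n - k)) * q.sqrt⁻¹) • e (n + 1) k (𝔉.al (n + 1) * b) := by
  obtain ⟨x, hx⟩ := 𝔉.exists_val_eq_single hn hk b
  have hξ' : (ξ : H) = 𝔉.toHilbert e x := hξ.trans (toHilbert_of_val hx).symm
  refine ⟨?_, ?_, ?_, ?_, ?_⟩
  · rw [StarRep.disc, hρ.2 _ x ξ hξ', cross_one_tmul, toHilbert_of_val (val_z hx)]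
  · rw [StarRep.disc, hρ.2 _ x ξ hξ', cross_one_tmul, toHilbert_of_val (val_zs hx)]
  · rw [StarRep.uq, hρ.2 _ x ξ hξ', cross_tmul_one, uqEnd_K, toHilbert_of_val (val_grade hx _ _),
      map_smul]
  · rw [StarRep.uq, hρ.2 _ x ξ hξ', cross_tmul_one, toHilbert_F hx]
  · rw [StarRep.uq, hρ.2 _ x ξ hξ', cross_tmul_one, toHilbert_E hx]

theorem val_mul_ofFun_of_one (x : F0 q) {f : LBorel} (hf : ∀ k, 𝔉.ev k f = 1) :
    𝔉.val (rmulEnd (FU.ofFun f) x) = 𝔉.val x := by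
  ext1 p
  show 𝔉.coord p.1 p.2 (x.1 * FU.ofFun f) = _
  rw [coord_mul_ofFun, hf, mul_one]; rfl

theorem val_mul_ofFun_of_zero (x : F0 q) {f : LBorel} (hf : ∀ k, 𝔉.ev k f = 0) :
    𝔉.val (rmulEnd (FU.ofFun f) x) = 0 := by
  ext1 p
  show 𝔉.coord p.1 p.2 (x.1 * FU.ofFun f) = _
  rw [coord_mul_ofFun, hf, mul_zero]; rfl

end Fibre

/-! ### The representation `(I.1)` -/

section seriesI

open scoped InnerProductSpace

variable (q : Param)

/-- The one-point fibre `{1}` with `J = {0, 1, …}`. -/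
noncomputable def fibreI : Fibre q where
  T := Unit
  m := Measure.dirac ()
  pt := fun _ => ⟨1, one_ne_zero⟩
  emb :=
    { injective := fun _ _ _ => rfl
      measurable := measurable_const
      measurableSet_image' := fun _ _ => (Set.subsingleton_of_subsingleton.image _).measurableSet }
  lower := fun _ => by
    show (q : ℝ) ^ 2 < |(1 : ℝ)|
    rw [abs_one]
    exact pow_lt_one₀ q.pos.le q.lt_one two_ne_zero
  upper := fun _ => abs_one.le
  J := {k | 0 ≤ k}
  up := fun {k} (hk : 0 ≤ k) => show 0 ≤ k + 1 by omega
  nonneg := fun {i} (hi : 0 ≤ i) _ => by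
    show 0 ≤ 1 - (q : ℝ) ^ (2 * i) * 1
    rw [mul_one, sub_nonneg]
    exact zpow_le_one₀ q.pos q.lt_one.le (by omega)
  pos := fun {i} (hi : 0 ≤ i - 1) => by
    refine ⟨1 - (q : ℝ) ^ (2 * i), ?_, fun _ => ?_⟩
    · rw [sub_pos]
      exact zpow_lt_one₀ q.pos q.lt_one (by omega)
    · show _ ≤ 1 - (q : ℝ) ^ (2 * i) * 1
      rw [mul_one]
  edge := fun {n k} (hk : 0 ≤ k) (hn : ¬0 ≤ n) => by
    refine ⟨0, Finset.mem_Ioc.2 ⟨not_le.1 hn, hk⟩, fun _ => ?_⟩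
    show 1 - (q : ℝ) ^ (2 * 0 : ℤ) * 1 = 0
    simp

theorem fibreI_pos_at (k : ℕ) (t : (fibreI q).T) : (fibreI q).pos_at k t = qPoint q (k + 1) := by
  refine Subtype.ext ?_
  show (q : ℝ) ^ (2 * ((k : ℤ) + 1)) * 1 = (q : ℝ) ^ (2 * (k + 1))
  rw [mul_one, ← zpow_natCast]
  push_cast
  rfl

theorem vanishesOffDiagonal_hI : F0.VanishesOffDiagonal (hI q) := by
  rw [F0.vanishesOffDiagonal_iff]
  intro x hx
  show ∑' k : ℕ, (FU.coeff 0 x.1 : PLine → ℂ) (qPoint q (k + 1)) * q.c⁻¹ ^ (2 * (k + 1)) = 0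
  rw [hx]
  refine (tsum_congr fun k => ?_).trans tsum_zero
  exact zero_mul _

theorem represents_hI : (fibreI q).Represents (hI q) where
  offDiag := vanishesOffDiagonal_hI q
  hasSum f hf := by
    have h1 : hI q (F0.ofFun f hf)
        = ∑' k : ℕ, (f : PLine → ℂ) (qPoint q (k + 1)) * q.c⁻¹ ^ (2 * (k + 1)) := by
      show ∑' k : ℕ, (FU.coeff 0 (F0.ofFun f hf).1 : PLine → ℂ) (qPoint q (k + 1))
        * q.c⁻¹ ^ (2 * (k + 1)) = _
      rw [F0.coeff_ofFun]
    have h2 := (summable_qPoint (q := q) f hf).hasSum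
    rw [← h1] at h2
    refine (Function.Injective.hasSum_iff (Nat.cast_injective (R := ℤ)) fun k hk => ?_).1
      (Eq.mp (congrArg (fun g => HasSum g _) (funext fun k => ?_)) h2)
    · refine if_neg fun h : 0 ≤ k => hk ⟨k.toNat, Int.toNat_of_nonneg h⟩
    · have h3 : (k : ℤ) ∈ (fibreI q).J := Int.natCast_nonneg k
      have h4 : (∫ t, ((fibreI q).ev k f : (fibreI q).T → ℂ) t ∂(fibreI q).m)
          = (f : PLine → ℂ) (qPoint q (k + 1)) := by
        rw [← fibreI_pos_at q k ()]
        exact integral_dirac _ ()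
      rw [Function.comp_apply, Fibre.term, if_pos h3, h4, mul_comm, zpow_neg, ← inv_zpow,
        ← zpow_natCast]
      push_cast
      rfl

variable {q}

theorem etaI_natCast (n k : ℕ) : etaI n k = lp.single 2 (n, k) (1 : ℂ) := by
  rw [etaI, if_pos ⟨Int.natCast_nonneg n, Int.natCast_nonneg k⟩, Int.toNat_natCast,
    Int.toNat_natCast]

theorem inner_etaI (n k : ℕ) (f : SpaceI) : ⟪etaI n k, f⟫_ℂ = f (n, k) := by
  rw [etaI_natCast, lp.inner_single_left]
  simp

theorem etaI_apply (n k n' k' : ℕ) :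
    (etaI n k : SpaceI) (n', k') = if n = n' ∧ k = k' then 1 else 0 := by
  rw [etaI_natCast, lp.single_apply, Pi.single_apply]
  exact if_congr (by rw [Prod.mk.injEq, eq_comm, eq_comm (a := k')]) rfl rfl

variable (q) in
/-- The base vectors `η_{nk}`, as linear maps from functions on the one-point fibre. -/
noncomputable def realI (n k : ℤ) : (fibreI q).B →ₗ[ℂ] SpaceI where
  toFun b := (b : (fibreI q).T → ℂ) () • etaI n k
  map_add' _ _ := add_smul _ _ _
  map_smul' _ _ := mul_smul _ _ _

theorem realI_apply (n k : ℤ) (b : (fibreI q).B) :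
    realI q n k b = (b : (fibreI q).T → ℂ) () • etaI n k := rfl

theorem realI_one (n k : ℤ) : realI q n k 1 = etaI n k := one_smul _ _

theorem isRealization_realI : (fibreI q).IsRealization (realI q) := by
  intro n k n' k' hn hk hn' hk' b b'
  obtain ⟨n, rfl⟩ := Int.eq_ofNat_of_zero_le hn
  obtain ⟨k, rfl⟩ := Int.eq_ofNat_of_zero_le hk
  obtain ⟨n', rfl⟩ := Int.eq_ofNat_of_zero_le hn'
  obtain ⟨k', rfl⟩ := Int.eq_ofNat_of_zero_le hk'
  have h : (fibreI q).pair b b' = (starRingEnd ℂ) ((b : (fibreI q).T → ℂ) ())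
      * (b' : (fibreI q).T → ℂ) () := integral_dirac _ ()
  rw [realI_apply, realI_apply, inner_smul_left, inner_smul_right, inner_etaI, etaI_apply, h]
  by_cases he : n = n' ∧ k = k'
  · rw [if_pos ⟨he.1.symm, he.2.symm⟩, if_pos ⟨by rw [he.1], by rw [he.2]⟩, mul_one]
  · rw [if_neg fun h => he ⟨h.1.symm, h.2.symm⟩, if_neg, mul_zero, mul_zero]
    exact fun h => he ⟨Int.natCast_inj.1 h.1, Int.natCast_inj.1 h.2⟩

theorem range_toHilbert_realI : LinearMap.range ((fibreI q).toHilbert (realI q))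
    = Submodule.span ℂ (Set.range fun p : ℕ × ℕ => etaI p.1 p.2) := by
  rw [Fibre.range_toHilbert]
  apply le_antisymm <;> rw [Submodule.span_le]
  · rintro _ ⟨n, hn, k, hk, b, rfl⟩
    obtain ⟨n, rfl⟩ := Int.eq_ofNat_of_zero_le hn
    obtain ⟨k, rfl⟩ := Int.eq_ofNat_of_zero_le hk
    exact Submodule.smul_mem _ _ (Submodule.subset_span ⟨(n, k), rfl⟩)
  · rintro _ ⟨⟨n, k⟩, rfl⟩
    exact Submodule.subset_span ⟨n, Int.natCast_nonneg n, k, Int.natCast_nonneg k, 1,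
      (realI_one _ _).symm⟩

theorem dense_span_etaI :
    Dense (Submodule.span ℂ (Set.range fun p : ℕ × ℕ => etaI p.1 p.2) : Set SpaceI) := by
  rw [Submodule.dense_iff_topologicalClosure_eq_top, Submodule.topologicalClosure_eq_top_iff,
    Submodule.eq_bot_iff]
  intro f hf
  refine lp.ext (funext fun p => ?_)
  rw [← inner_etaI]
  exact hf _ (Submodule.subset_span ⟨p, rfl⟩)

theorem fac_fibreI (i : ℤ) : (fibreI q).fac i () = 1 - (q : ℝ) ^ (2 * i) := by
  show 1 - (q : ℝ) ^ (2 * i) * 1 = _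
  rw [mul_one]

theorem al_fibreI (n : ℕ) : ((fibreI q).al n : (fibreI q).T → ℂ) () = lamN q n := by
  show ((Real.sqrt ((fibreI q).fac n ()) : ℝ) : ℂ) = _
  have h : (fibreI q).fac n () = 1 - (q : ℝ) ^ (2 * n) := by
    rw [fac_fibreI]
    norm_cast
  rw [h, lamN]

theorem lamN_ne_zero {n : ℕ} (hn : n ≠ 0) : lamN q n ≠ 0 := by
  refine Complex.ofReal_ne_zero.2 (Real.sqrt_pos.2 (sub_pos.2 ?_)).ne'
  exact pow_lt_one₀ q.pos.le q.lt_one (by omega)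

theorem isSeriesI1_of_isImage {ρ : StarRep q SpaceI}
    (hρ : ρ.IsImage ((fibreI q).toHilbert (realI q))) : IsSeriesI1 ρ := by
  refine ⟨hρ.1.trans range_toHilbert_realI, fun n k ξ hξ => ?_⟩
  have hJ : ∀ n : ℕ, (n : ℤ) ∈ (fibreI q).J := fun n => Int.natCast_nonneg n
  obtain ⟨h1, h2, h3, h4, h5⟩ := Fibre.action_of_isImage hρ (hJ n) (hJ k) 1 ξ
    (hξ.trans (realI_one _ _).symm)
  have hal : ∀ i : ℕ, ∀ n k : ℤ, realI q n k ((fibreI q).al i * 1) = lamN q i • etaI n k := by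
    intro i n k
    rw [mul_one, realI_apply, al_fibreI]
  have hn1 := hal (n + 1)
  have hk1 := hal (k + 1)
  push_cast at hn1 hk1
  rw [hn1] at h1
  rw [hal] at h2
  rw [realI_one] at h3
  rw [hk1, hal, smul_smul, smul_smul] at h4
  rw [hn1, hal, smul_smul, smul_smul] at h5
  refine ⟨h1, h2, h3, h4.trans ?_, h5.trans ?_⟩
  · congr 2 <;> ring
  · congr 2 <;> ring

end seriesI

namespace StarRep

open scoped InnerProductSpace

variable {q : Param} {H : Type} [NormedAddCommGroup H] [InnerProductSpace ℂ H] (π : StarRep q H)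

theorem inner_disc_left (a : Disc q) (ξ ζ : π.dom) :
    ⟪((π.disc a ξ : π.dom) : H), (ζ : H)⟫_ℂ = ⟪(ξ : H), ((π.disc (star a) ζ : π.dom) : H)⟫_ℂ := by
  have h : CrossSpace.conj ((1 : Uq q) ⊗ₜ a) = 1 ⊗ₜ star a := by
    have h1 : Disc.act (star a) 1 = star a := by
      rw [← map_one (algebraMap ℂ (Uq q))]
      exact (Disc.datum.act_algebraMap _ _).trans (one_smul _ _)
    rw [CrossSpace.conj_tmul, star_one, map_one, Algebra.TensorProduct.one_def,
      TensorProduct.map_tmul, h1]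
    rfl
  rw [disc, disc, π.op_star, h]

theorem inner_K_left (ξ ζ : π.dom) :
    ⟪((π.uq Uq.K ξ : π.dom) : H), (ζ : H)⟫_ℂ = ⟪(ξ : H), ((π.uq Uq.K ζ : π.dom) : H)⟫_ℂ := by
  have h : CrossSpace.conj ((Uq.K : Uq q) ⊗ₜ[ℂ] (1 : Disc q)) = Uq.K ⊗ₜ 1 := by
    have h1 : Disc.act (1 : Disc q) Uq.K = 1 :=
      (Disc.datum.act_K 1).trans (map_one Disc.datum.k)
    rw [CrossSpace.conj_tmul, Uq.star_K, Uq.comul_K, TensorProduct.map_tmul, star_one, h1]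
    rfl
  rw [uq, π.op_star, h]

end StarRep

section irreducible

open scoped InnerProductSpace

variable {q : Param}

theorem etaI_mem_dom {ρ : StarRep q SpaceI} (hρ : IsSeriesI1 ρ) (n k : ℕ) : etaI n k ∈ ρ.dom := by
  rw [hρ.1]
  exact Submodule.subset_span ⟨(n, k), rfl⟩

theorem etaI_of_neg (k : ℤ) : etaI (-1) k = 0 := if_neg fun h => absurd h.1 (by norm_num)

/-- `(I.1)` is irreducible: `η_{00}` is the only vector, up to scalars, with `z* ξ = 0` and
`K ξ = ξ`, and it is cyclic. -/
theorem IsSeriesI1.isIrreducible {ρ : StarRep q SpaceI} (hρ : IsSeriesI1 ρ) :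
    ρ.IsIrreducible := by
  have hne : etaI 0 0 ≠ 0 := by
    intro h
    have h1 := etaI_apply 0 0 0 0
    simp only [and_self, if_true, Nat.cast_zero] at h1
    rw [h] at h1
    exact zero_ne_one h1
  refine ⟨⟨etaI 0 0, 0, hne⟩, fun P hP hcomm => ?_⟩
  have mem := etaI_mem_dom hρ
  let e : ℕ → ℕ → ρ.dom := fun n k => ⟨etaI n k, mem n k⟩
  obtain ⟨ζ, hζ, hζop⟩ := hcomm (e 0 0)
  have hzs : ((ρ.disc Disc.zs ζ : ρ.dom) : SpaceI) = 0 := by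
    rw [StarRep.disc, hζop]
    have h := (hρ.2 0 0 (e 0 0) rfl).2.1
    rw [Nat.cast_zero, zero_sub, etaI_of_neg, smul_zero] at h
    exact (congrArg P h).trans (map_zero P)
  have hK : ((ρ.uq Uq.K ζ : ρ.dom) : SpaceI) = ζ := by
    rw [StarRep.uq, hζop, hζ]
    have h := (hρ.2 0 0 (e 0 0) rfl).2.2.1
    rw [sub_self, zpow_zero, one_smul] at h
    exact congrArg P h
  have hcoord : ∀ n k : ℕ, (n, k) ≠ (0, 0) → (ζ : SpaceI) (n, k) = 0 := by
    intro n k hnk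
    rcases Nat.eq_zero_or_pos n with rfl | hn
    · have hk : k ≠ 0 := fun h => hnk (by rw [h])
      have h1 := ρ.inner_K_left (e 0 k) ζ
      rw [hK, (hρ.2 0 k (e 0 k) rfl).2.2.1] at h1
      change ⟪_ • etaI ((0 : ℕ) : ℤ) k, _⟫_ℂ = ⟪etaI ((0 : ℕ) : ℤ) k, _⟫_ℂ at h1
      rw [inner_smul_left, inner_etaI, map_zpow₀, q.conj_c] at h1
      have h2 : q.c ^ (((0 : ℕ) : ℤ) - k) ≠ 1 := by
        have h3 : 1 < (q : ℝ) ^ (((0 : ℕ) : ℤ) - k) :=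
          one_lt_zpow_of_neg₀ q.pos q.lt_one (by omega)
        intro h
        refine h3.ne' ?_
        rw [Param.c] at h
        exact_mod_cast h
      have h4 : (q.c ^ (((0 : ℕ) : ℤ) - k) - 1) * (ζ : SpaceI) (0, k) = 0 := by
        rw [sub_mul, h1, one_mul, sub_self]
      exact (mul_eq_zero.1 h4).resolve_left (sub_ne_zero.2 h2)
    · obtain ⟨n, rfl⟩ := Nat.exists_eq_succ_of_ne_zero hn.ne'
      have h1 := ρ.inner_disc_left Disc.z (e n k) ζ
      rw [Disc.star_z, hzs, inner_zero_right, (hρ.2 n k (e n k) rfl).1, inner_smul_left] at h1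
      have h2 := inner_etaI (n + 1) k ζ
      push_cast at h2
      rw [h2] at h1
      refine (mul_eq_zero.1 h1).resolve_left ?_
      exact (map_ne_zero _).2 (lamN_ne_zero n.succ_ne_zero)
  set c : ℂ := (ζ : SpaceI) (0, 0) with hc
  have hPe : P (etaI 0 0) = c • etaI 0 0 := by
    refine hζ.symm.trans (lp.ext (funext fun p => ?_))
    obtain ⟨n, k⟩ := p
    have h := etaI_apply 0 0 n k
    simp only [Nat.cast_zero] at h
    rw [lp.coeFn_smul, Pi.smul_apply, h]
    by_cases hnk : (n, k) = (0, 0)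
    · obtain ⟨rfl, rfl⟩ := Prod.mk.inj hnk
      rw [if_pos ⟨rfl, rfl⟩, smul_eq_mul, mul_one]
    · rw [hcoord n k hnk, if_neg, smul_zero]
      rintro ⟨rfl, rfl⟩
      exact hnk rfl
  -- the vectors on which `P` acts as `c` are mapped to such vectors
  have hinv : ∀ (a : CrossSpace q) (ξ : ρ.dom), P ξ = c • (ξ : SpaceI) →
      P (ρ.op a ξ : ρ.dom) = c • ((ρ.op a ξ : ρ.dom) : SpaceI) := by
    intro a ξ hξ
    obtain ⟨ζ', hζ', hop⟩ := hcomm ξ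
    have : ζ' = c • ξ := Subtype.ext (hζ'.trans hξ)
    rw [← hop, this, map_smul, Submodule.coe_smul]
  have hn : ∀ n : ℕ, P (etaI n 0) = c • etaI n 0 := by
    intro n
    induction n with
    | zero => exact hPe
    | succ n ih =>
      have h := hinv (1 ⊗ₜ Disc.z) (e n 0) ih
      rw [← StarRep.disc, (hρ.2 n 0 (e n 0) rfl).1, map_smul, smul_comm] at h
      have h' := smul_right_injective SpaceI (lamN_ne_zero (q := q) n.succ_ne_zero) h
      push_cast at h' ⊢
      exact h'
  have hnk : ∀ k n : ℕ, P (etaI n k) = c • etaI n k := by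
    intro k
    induction k with
    | zero => exact hn
    | succ k ih =>
      intro n
      have h := hinv (Uq.F ⊗ₜ 1) (e n k) (ih n)
      have h0 : P (etaI (n - 1) k) = c • etaI (n - 1) k := by
        rcases n with _ | n
        · rw [Nat.cast_zero, zero_sub, etaI_of_neg, map_zero, smul_zero]
        · push_cast
          rw [add_sub_cancel_right]
          exact ih n
      rw [← StarRep.uq, (hρ.2 n k (e n k) rfl).2.2.2.1, map_add, map_smul, map_smul, h0, smul_add,
        smul_comm c, smul_comm c, add_left_inj] at h
      have hA : q.c ^ ((n : ℤ) - k) * q.sqrt⁻¹ * q.lam⁻¹ * lamN q (k + 1) ≠ 0 :=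
        mul_ne_zero (mul_ne_zero (mul_ne_zero (zpow_ne_zero _ q.c_ne) (inv_ne_zero q.sqrt_ne))
          (inv_ne_zero q.lam_ne)) (lamN_ne_zero k.succ_ne_zero)
      have h' := smul_right_injective SpaceI hA h
      push_cast
      exact h'
  have hP1 : P = c • 1 := by
    refine ContinuousLinearMap.ext_on dense_span_etaI ?_
    rintro _ ⟨⟨n, k⟩, rfl⟩
    exact hnk k n
  have hcc : c * c = c := by
    have h := hP.isIdempotentElem.eq
    have h1 := congrArg (fun T : SpaceI →L[ℂ] SpaceI => T (etaI 0 0)) h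
    change P (P (etaI 0 0)) = P (etaI 0 0) at h1
    rw [hPe, map_smul, hPe, smul_smul] at h1
    exact smul_left_injective ℂ hne h1
  rcases (IsIdempotentElem.iff_eq_zero_or_one (p := c)).1 hcc with h | h
  · left; rw [hP1, h, zero_smul]
  · right; rw [hP1, h, one_smul]

end irreducible

/-! ### Square roots of multiplication operators -/

section sqrt

variable {𝒦 : Type} [NormedAddCommGroup 𝒦] [InnerProductSpace ℂ 𝒦] [CompleteSpace 𝒦]

theorem sqrtOp_eq_of_mul_self {A B : 𝒦 →L[ℂ] 𝒦} (hB : 0 ≤ B) (h : B * B = A) : sqrtOp A = B := by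
  have hA : 0 ≤ A := by
    rw [← h]
    exact (commute_iff_mul_nonneg hB hB).1 rfl
  have hc : cfcₙ Real.sqrt A = cfc Real.sqrt A :=
    cfcₙ_eq_cfc (hf := Real.continuous_sqrt.continuousOn) (hf0 := Real.sqrt_zero)
  rw [sqrtOp, ← hc, ← CFC.sqrt_eq_real_sqrt A hA]
  exact CFC.sqrt_unique h

theorem alpha_eq_of_mul_self (q : Param) (k : ℤ) {A B : 𝒦 →L[ℂ] 𝒦} (hA : IsSelfAdjoint A)
    (hB : 0 ≤ B) (h : B * B = 1 + ((q : ℝ) ^ (2 * k)) • (A * A)) : alpha q k A = B := by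
  set c : ℝ := (q : ℝ) ^ (2 * k) with hc
  have hc0 : 0 ≤ c := (zpow_pos q.pos _).le
  have h1 : cfc (fun t : ℝ => 1 + c * t ^ 2) A = 1 + c • (A * A) := by
    rw [cfc_add (a := A) (fun _ : ℝ => (1 : ℝ)) (fun t : ℝ => c * t ^ 2), cfc_const_one ℝ A,
      cfc_const_mul c (fun t : ℝ => t ^ 2) A, cfc_pow_id A 2, pow_two]
  have h2 : alpha q k A = sqrtOp (cfc (fun t : ℝ => 1 + c * t ^ 2) A) := by
    have hf : Continuous fun t : ℝ => 1 + c * t ^ 2 := by fun_prop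
    rw [sqrtOp, ← cfc_comp Real.sqrt (fun t : ℝ => 1 + c * t ^ 2) A hA
      Real.continuous_sqrt.continuousOn hf.continuousOn]
    rfl
  rw [h2, h1]
  exact sqrtOp_eq_of_mul_self hB h

end sqrt

/-! ### Bounded functions in `L²` -/

namespace BddMeas

open scoped InnerProductSpace

variable {T : Type} [MeasurableSpace T] (m : Measure T)

theorem memLp_mul (g : BddMeas T) (ζ : Lp ℂ 2 m) : MemLp (fun t => (g : T → ℂ) t * ζ t) 2 m := by
  obtain ⟨M, hM⟩ := g.2.2
  refine (Lp.memLp ζ).of_le_mul (c := M)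
    (g.2.1.aestronglyMeasurable.mul (Lp.aestronglyMeasurable ζ)) (ae_of_all _ fun t => ?_)
  rw [norm_mul]
  exact mul_le_mul_of_nonneg_right (hM t) (norm_nonneg _)

/-- The operator of multiplication by a bounded measurable function. -/
noncomputable def mulOp (g : BddMeas T) : Lp ℂ 2 m →L[ℂ] Lp ℂ 2 m :=
  LinearMap.mkContinuous
    { toFun := fun ζ => (memLp_mul m g ζ).toLp _
      map_add' := fun ζ ζ' => by
        rw [← MemLp.toLp_add]
        refine MemLp.toLp_congr _ _ ?_
        filter_upwards [Lp.coeFn_add ζ ζ'] with t ht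
        rw [ht, Pi.add_apply, Pi.add_apply, mul_add]
      map_smul' := fun c ζ => by
        rw [RingHom.id_apply, ← MemLp.toLp_const_smul]
        refine MemLp.toLp_congr _ _ ?_
        filter_upwards [Lp.coeFn_smul c ζ] with t ht
        rw [ht, Pi.smul_apply, Pi.smul_apply, mul_smul_comm] }
    g.2.2.choose
    (fun ζ => by
      refine Lp.norm_le_mul_norm_of_ae_le_mul ?_
      filter_upwards [MemLp.coeFn_toLp (memLp_mul m g ζ)] with t ht
      show ‖(MemLp.toLp _ (memLp_mul m g ζ)) t‖ ≤ _
      rw [ht, norm_mul]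
      exact mul_le_mul_of_nonneg_right (g.2.2.choose_spec t) (norm_nonneg _))

theorem coeFn_mulOp (g : BddMeas T) (ζ : Lp ℂ 2 m) :
    mulOp m g ζ =ᵐ[m] fun t => (g : T → ℂ) t * ζ t := (memLp_mul m g ζ).coeFn_toLp

theorem isSelfAdjoint_mulOp {g : BddMeas T}
    (hg : ∀ t, (starRingEnd ℂ) ((g : T → ℂ) t) = (g : T → ℂ) t) : IsSelfAdjoint (mulOp m g) := by
  rw [ContinuousLinearMap.isSelfAdjoint_iff', eq_comm, ContinuousLinearMap.eq_adjoint_iff]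
  intro ζ ζ'
  rw [L2.inner_def, L2.inner_def]
  refine integral_congr_ae ?_
  filter_upwards [coeFn_mulOp m g ζ, coeFn_mulOp m g ζ'] with t h1 h2
  rw [h1, h2, RCLike.inner_apply', RCLike.inner_apply', map_mul, hg]
  ring

variable [IsFiniteMeasure m]

theorem memLp (b : BddMeas T) : MemLp (b : T → ℂ) 2 m := by
  obtain ⟨M, hM⟩ := b.2.2
  exact MemLp.of_bound b.2.1.aestronglyMeasurable M (ae_of_all _ hM)

/-- The class in `L²` of a bounded measurable function. -/
noncomputable def toL2 : BddMeas T →ₗ[ℂ] Lp ℂ 2 m where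
  toFun b := (memLp m b).toLp
  map_add' _ _ := rfl
  map_smul' _ _ := rfl

theorem coeFn_toL2 (b : BddMeas T) : toL2 m b =ᵐ[m] (b : T → ℂ) := (memLp m b).coeFn_toLp

theorem inner_toL2 (b b' : BddMeas T) :
    ⟪toL2 m b, toL2 m b'⟫_ℂ = ∫ t, (starRingEnd ℂ) ((b : T → ℂ) t) * (b' : T → ℂ) t ∂m := by
  rw [L2.inner_def]
  refine integral_congr_ae ?_
  filter_upwards [coeFn_toL2 m b, coeFn_toL2 m b'] with t h h'
  rw [h, h', RCLike.inner_apply']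

theorem denseRange_toL2 : DenseRange (toL2 m : BddMeas T → Lp ℂ 2 m) := by
  refine (Lp.simpleFunc.denseRange (E := ℂ) (p := 2) (μ := m) (by norm_num)).mono ?_
  rintro _ ⟨f, rfl⟩
  obtain ⟨C, hC⟩ := (Lp.simpleFunc.toSimpleFunc f).exists_forall_norm_le
  let b : BddMeas T := ⟨Lp.simpleFunc.toSimpleFunc f,
    (Lp.simpleFunc.toSimpleFunc f).measurable, C, hC⟩
  refine ⟨b, Lp.ext ?_⟩
  exact (coeFn_toL2 m b).trans (Lp.simpleFunc.toSimpleFunc_eq_toFun f)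

theorem mulOp_toL2 (g b : BddMeas T) : mulOp m g (toL2 m b) = toL2 m (g * b) := by
  refine Lp.ext ?_
  filter_upwards [coeFn_mulOp m g (toL2 m b), coeFn_toL2 m b, coeFn_toL2 m (g * b)] with t h1 h2 h3
  rw [h1, h2, h3]
  rfl

theorem ext_of_toL2 {A B : Lp ℂ 2 m →L[ℂ] Lp ℂ 2 m} (h : ∀ b, A (toL2 m b) = B (toL2 m b)) :
    A = B := by
  have h1 := (denseRange_toL2 m).equalizer A.continuous B.continuous (funext h)
  exact ContinuousLinearMap.ext fun ζ => congrFun h1 ζ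

theorem mulOp_mul (g g' : BddMeas T) : mulOp m (g * g') = mulOp m g * mulOp m g' := by
  refine ext_of_toL2 m fun b => ?_
  rw [mul_apply_eq_comp, mulOp_toL2, mulOp_toL2, mulOp_toL2, mul_assoc]

/-- Multiplication by a nonnegative function is a positive operator. -/
theorem mulOp_nonneg {g : BddMeas T} {f : T → ℝ} (hf : ∀ t, 0 ≤ f t)
    (hg : ∀ t, (g : T → ℂ) t = f t) : 0 ≤ mulOp m g := by
  obtain ⟨M, hM⟩ := g.2.2
  have hfre : ∀ t, ((g : T → ℂ) t).re = f t := fun t => by rw [hg, Complex.ofReal_re]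
  have hfm : Measurable f := by
    have h := Complex.measurable_re.comp g.2.1
    exact (funext hfre : (fun t => ((g : T → ℂ) t).re) = f) ▸ h
  let s : BddMeas T := ⟨fun t => ((Real.sqrt (f t) : ℝ) : ℂ),
    Complex.measurable_ofReal.comp (Real.continuous_sqrt.measurable.comp hfm),
    Real.sqrt M, fun t => by
      rw [Complex.norm_real, Real.norm_of_nonneg (Real.sqrt_nonneg _)]
      refine Real.sqrt_le_sqrt ?_
      have h := hM t
      rwa [hg, Complex.norm_real, Real.norm_of_nonneg (hf t)] at h⟩
  have hs : g = s * s := BddMeas.ext fun t => by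
    show _ = ((Real.sqrt (f t) : ℝ) : ℂ) * ((Real.sqrt (f t) : ℝ) : ℂ)
    rw [hg, ← Complex.ofReal_mul, Real.mul_self_sqrt (hf t)]
  have hsa : IsSelfAdjoint (mulOp m s) := isSelfAdjoint_mulOp m fun t => Complex.conj_ofReal _
  rw [hs, mulOp_mul]
  nth_rewrite 1 [← hsa.star_eq]
  exact star_mul_self_nonneg _

end BddMeas

/-! ### The functionals `h_{μ₀}` -/

section cell

open scoped InnerProductSpace

variable {q : Param}

theorem NegCell.measurable_reflect : Measurable (NegCell.reflect (q := q)) :=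
  measurable_subtype_coe.neg.subtype_mk

theorem PosCell.coe_pos (y : PosCell q) : (0 : ℝ) < y := (pow_pos q.pos 2).trans y.2.1

instance (μ₀ : Measure (NegCell q)) [IsFiniteMeasure μ₀] : IsFiniteMeasure (cellMeasure μ₀) := by
  refine isFiniteMeasure_withDensity (ne_of_lt ?_)
  have hle : ∀ y : PosCell q, ENNReal.ofReal ((y : ℝ) ^ (-2 : ℤ))
      ≤ ENNReal.ofReal ((((q : ℝ) ^ 2) ^ 2)⁻¹) := fun y => by
    refine ENNReal.ofReal_le_ofReal ?_
    rw [zpow_neg]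
    exact inv_anti₀ (pow_pos (pow_pos q.pos 2) 2)
      (pow_le_pow_left₀ (sq_nonneg _) y.2.1.le 2)
  refine (lintegral_mono hle).trans_lt ?_
  rw [lintegral_const]
  exact ENNReal.mul_lt_top ENNReal.ofReal_lt_top (measure_lt_top _ _)

/-- The point `-y` for `y ∈ (q², 1]`. -/
def PosCell.neg (y : PosCell q) : PLine := ⟨-(y : ℝ), neg_ne_zero.2 (PosCell.coe_pos y).ne'⟩

theorem PosCell.measurableEmbedding_neg : MeasurableEmbedding (PosCell.neg (q := q)) := by
  have : StandardBorelSpace (PosCell q) := measurableSet_Ioc.standardBorel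
  refine Measurable.measurableEmbedding (measurable_subtype_coe.neg.subtype_mk) fun y y' h => ?_
  exact Subtype.ext (neg_injective (congrArg Subtype.val h))

theorem NegCell.neg_reflect (y : NegCell q) : PosCell.neg y.reflect = y.toPLine :=
  Subtype.ext (neg_neg (y : ℝ))

/-- The fibre `[-1, -q²)`, parametrized by `(q², 1]`, with `J = ℤ`. -/
noncomputable def fibreII (μ₀ : Measure (NegCell q)) [IsFiniteMeasure μ₀] : Fibre q where
  T := PosCell q
  m := cellMeasure μ₀
  pt := PosCell.neg
  emb := PosCell.measurableEmbedding_neg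
  lower := fun y => by
    show (q : ℝ) ^ 2 < |-(y : ℝ)|
    rw [abs_neg, abs_of_pos (PosCell.coe_pos y)]
    exact y.2.1
  upper := fun y => by
    show |-(y : ℝ)| ≤ 1
    rw [abs_neg, abs_of_pos (PosCell.coe_pos y)]
    exact y.2.2
  J := Set.univ
  up := fun _ => trivial
  nonneg := fun {i} _ y => by
    show 0 ≤ 1 - (q : ℝ) ^ (2 * i) * -(y : ℝ)
    have := mul_pos (zpow_pos q.pos (2 * i)) (PosCell.coe_pos y)
    linarith
  pos := fun {i} _ => ⟨1, one_pos, fun y => by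
    show 1 ≤ 1 - (q : ℝ) ^ (2 * i) * -(y : ℝ)
    have := mul_pos (zpow_pos q.pos (2 * i)) (PosCell.coe_pos y)
    linarith⟩
  edge := fun _ hn => absurd trivial hn

theorem integral_cellMeasure (μ₀ : Measure (NegCell q)) {g : PosCell q → ℂ} (hg : Measurable g) :
    ∫ t, g t ∂(cellMeasure μ₀) = ∫ y, (((y : ℝ) : ℂ) ^ (-2 : ℤ)) * g (NegCell.reflect y) ∂μ₀ := by
  have hd : Measurable fun y : PosCell q => ENNReal.ofReal ((y : ℝ) ^ (-2 : ℤ)) :=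
    ENNReal.measurable_ofReal.comp (measurable_subtype_coe.pow_const _)
  rw [cellMeasure, integral_withDensity_eq_integral_toReal_smul hd
    (ae_of_all _ fun _ => ENNReal.ofReal_lt_top)]
  refine (integral_map NegCell.measurable_reflect.aemeasurable
    (hd.ennreal_toReal.smul hg).aestronglyMeasurable).trans ?_
  refine integral_congr_ae (ae_of_all _ fun y => ?_)
  show (ENNReal.ofReal ((-(y : ℝ)) ^ (-2 : ℤ))).toReal • g y.reflect = _
  rw [ENNReal.toReal_ofReal (Even.zpow_nonneg (by decide) _), Complex.real_smul,
    Even.neg_zpow (by decide)]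
  push_cast
  rfl

variable (μ₀ : Measure (NegCell q)) [IsFiniteMeasure μ₀]

theorem vanishesOffDiagonal_hMu : F0.VanishesOffDiagonal (hMu μ₀) := by
  rw [F0.vanishesOffDiagonal_iff]
  intro x hx
  show ∫ y, (FU.coeff 0 x.1 : PLine → ℂ) y * ((y : ℝ) : ℂ) ^ (-2 : ℤ) ∂(extMeasure μ₀) = 0
  rw [hx]
  refine (integral_congr_ae (ae_of_all _ fun y => ?_)).trans (integral_zero PLine ℂ)
  exact zero_mul _

theorem hMu_ofFun (f : LBorel) (hf : HasCompactSupport (f : PLine → ℂ)) :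
    hMu μ₀ (F0.ofFun f hf)
      = ∫ y, (f : PLine → ℂ) y * ((y : ℝ) : ℂ) ^ (-2 : ℤ) ∂(extMeasure μ₀) := by
  show ∫ y, (FU.coeff 0 (F0.ofFun f hf).1 : PLine → ℂ) y * _ ∂_ = _
  rw [F0.coeff_ofFun]

theorem represents_hMu : (fibreII μ₀).Represents (hMu μ₀) where
  offDiag := vanishesOffDiagonal_hMu μ₀
  hasSum f hf := by
    have hint := LBorel.integrable (f * invSq) hf.mul_right (extMeasure μ₀)
    have h1 := hasSum_integral_measure hint
    have h2 : (∫ y, ((f * invSq : LBorel) : PLine → ℂ) y ∂(extMeasure μ₀))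
      = hMu μ₀ (F0.ofFun f hf) := (hMu_ofFun μ₀ f hf).symm
    change HasSum _ (∫ y, ((f * invSq : LBorel) : PLine → ℂ) y ∂(extMeasure μ₀)) at h1
    rw [h2, ← (Equiv.addRight (1 : ℤ)).hasSum_iff] at h1
    refine Eq.mp (congrArg (fun g => HasSum g _) (funext fun k => ?_)) h1
    show ∫ y, ((f * invSq : LBorel) : PLine → ℂ) y ∂(ENNReal.ofReal ((q : ℝ) ^ (2 * (k + 1))) •
      μ₀.map fun y => scale q (k + 1) y.toPLine) = _
    have hq := q.c_ne
    have hpos : 0 ≤ (q : ℝ) ^ (2 * (k + 1)) := (zpow_pos q.pos _).le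
    have hc : (((q : ℝ) ^ (2 * (k + 1)) : ℝ) : ℂ) = q.c ^ (2 * (k + 1)) := by
      rw [Param.c]; push_cast; rfl
    have hev : Measurable ((fibreII μ₀).ev k f : (fibreII μ₀).T → ℂ) :=
      ((fibreII μ₀).ev k f).2.1
    have hk : k ∈ (fibreII μ₀).J := trivial
    rw [integral_smul_measure, ENNReal.toReal_ofReal hpos, integral_map
      (measurable_cell (k + 1)).aemeasurable (f * invSq).2.1.aestronglyMeasurable, Fibre.term,
      if_pos hk, Complex.real_smul, hc]
    refine Eq.trans ?_ (congrArg (_ * ·) (integral_cellMeasure μ₀ hev).symm)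
    rw [← integral_const_mul, ← integral_const_mul]
    refine integral_congr_ae (ae_of_all _ fun y => ?_)
    show q.c ^ (2 * (k + 1)) * ((f : PLine → ℂ) (scale q (k + 1) y.toPLine)
        * (((q : ℝ) ^ (2 * (k + 1)) * (y : ℝ) : ℝ) : ℂ) ^ (-2 : ℤ))
      = q.c ^ (-(2 * (k + 1))) * (((y : ℝ) : ℂ) ^ (-2 : ℤ)
        * (f : PLine → ℂ) (scale q (k + 1) (PosCell.neg y.reflect)))
    rw [NegCell.neg_reflect, Complex.ofReal_mul, hc, mul_zpow, ← zpow_mul,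
      show 2 * (k + 1) * -2 = -(2 * (k + 1)) + -(2 * (k + 1)) by ring, zpow_add₀ hq]
    have h3 : q.c ^ (2 * (k + 1)) * q.c ^ (-(2 * (k + 1))) = 1 := by
      rw [← zpow_add₀ hq, add_neg_cancel, zpow_zero]
    linear_combination (q.c ^ (-(2 * (k + 1))) * ((y : ℝ) : ℂ) ^ (-2 : ℤ)
      * (f : PLine → ℂ) (scale q (k + 1) y.toPLine)) * h3

end cell

/-! ### The representation `(II.2)` -/

section seriesII

open scoped InnerProductSpace
open Filter Topology

variable {q : Param}

section eta

variable {𝒦 : Type} [NormedAddCommGroup 𝒦] [InnerProductSpace ℂ 𝒦]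

/-- The isometric embedding `η ↦ η_{nk}`. -/
noncomputable def etaIIL (n k : ℤ) : 𝒦 →L[ℂ] SpaceII 𝒦 :=
  lp.singleContinuousLinearMap ℂ (fun _ => 𝒦) 2 (n, k)

theorem continuous_etaII (n k : ℤ) : Continuous (etaII n k : 𝒦 → SpaceII 𝒦) :=
  (etaIIL n k).continuous

theorem etaII_apply (n k : ℤ) (η : 𝒦) (p : ℤ × ℤ) :
    (etaII n k η : SpaceII 𝒦) p = if p = (n, k) then η else 0 := by
  rw [etaII, lp.single_apply, Pi.single_apply]

theorem inner_etaII (n k : ℤ) (η : 𝒦) (f : SpaceII 𝒦) : ⟪etaII n k η, f⟫_ℂ = ⟪η, f (n, k)⟫_ℂ :=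
  lp.inner_single_left _ _ _

end eta

variable (μ₀ : Measure (NegCell q)) [IsFiniteMeasure μ₀]

/-- The vectors `b_{nk}` for bounded measurable functions `b`. -/
noncomputable def realII (n k : ℤ) : (fibreII μ₀).B →ₗ[ℂ] SpaceII (CellL2 μ₀) :=
  (etaIIL n k).toLinearMap ∘ₗ BddMeas.toL2 (cellMeasure μ₀)

theorem realII_apply (n k : ℤ) (b : (fibreII μ₀).B) :
    realII μ₀ n k b = etaII n k (BddMeas.toL2 (cellMeasure μ₀) b) := rfl

theorem isRealization_realII : (fibreII μ₀).IsRealization (realII μ₀) := by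
  intro n k n' k' _ _ _ _ b b'
  rw [realII_apply, realII_apply, inner_etaII, etaII_apply]
  by_cases h : n = n' ∧ k = k'
  · rw [if_pos h, if_pos (Prod.ext h.1 h.2)]
    exact BddMeas.inner_toL2 (cellMeasure μ₀) b b'
  · rw [if_neg h, if_neg fun h' => h ⟨congrArg Prod.fst h', congrArg Prod.snd h'⟩,
      inner_zero_right]

theorem mem_bddFunctions_iff (η : CellL2 μ₀) : η ∈ bddFunctions (cellMeasure μ₀) ↔
    ∃ b : (fibreII μ₀).B, BddMeas.toL2 (cellMeasure μ₀) b = η := by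
  constructor
  · rintro ⟨C, hC⟩
    have hsm := Lp.aestronglyMeasurable η
    set g := hsm.mk η with hg
    have hgm : Measurable g := hsm.stronglyMeasurable_mk.measurable
    have hS : MeasurableSet {t | ‖g t‖ ≤ C} := hgm.norm measurableSet_Iic
    let b : BddMeas (PosCell q) := ⟨{t | ‖g t‖ ≤ C}.indicator g, hgm.indicator hS, max C 0,
      fun t => by
        by_cases ht : t ∈ {t | ‖g t‖ ≤ C}
        · rw [Set.indicator_of_mem ht]
          exact le_max_of_le_left ht
        · rw [Set.indicator_of_notMem ht, norm_zero]
          exact le_max_right _ _⟩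
    refine ⟨b, Lp.ext ?_⟩
    filter_upwards [BddMeas.coeFn_toL2 (cellMeasure μ₀) b, hsm.ae_eq_mk, hC] with t h1 h2 h3
    rw [h1, h2]
    have h4 : t ∈ {t | ‖g t‖ ≤ C} := by
      rw [Set.mem_ofPred_eq, hg, ← h2]
      exact h3
    exact Set.indicator_of_mem h4 g
  · rintro ⟨b, rfl⟩
    obtain ⟨M, hM⟩ := b.2.2
    refine ⟨M, ?_⟩
    filter_upwards [BddMeas.coeFn_toL2 (cellMeasure μ₀) b] with t ht
    rw [ht]
    exact hM t

theorem range_toHilbert_realII : LinearMap.range ((fibreII μ₀).toHilbert (realII μ₀))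
    = Submodule.span ℂ {ξ | ∃ (n k : ℤ) (η : CellL2 μ₀),
        η ∈ bddFunctions (cellMeasure μ₀) ∧ ξ = etaII n k η} := by
  rw [Fibre.range_toHilbert]
  congr 1
  ext ξ
  constructor
  · rintro ⟨n, -, k, -, b, rfl⟩
    exact ⟨n, k, _, (mem_bddFunctions_iff μ₀ _).2 ⟨b, rfl⟩, rfl⟩
  · rintro ⟨n, k, η, hη, rfl⟩
    obtain ⟨b, rfl⟩ := (mem_bddFunctions_iff μ₀ η).1 hη
    exact ⟨n, trivial, k, trivial, b, rfl⟩

theorem dense_range_toHilbert_realII :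
    Dense (LinearMap.range ((fibreII μ₀).toHilbert (realII μ₀)) : Set (SpaceII (CellL2 μ₀))) := by
  rw [Submodule.dense_iff_topologicalClosure_eq_top, Submodule.topologicalClosure_eq_top_iff,
    Submodule.eq_bot_iff, range_toHilbert_realII]
  intro f hf
  refine lp.ext (funext fun p => ?_)
  refine (BddMeas.denseRange_toL2 (cellMeasure μ₀)).eq_zero_of_inner_right ℂ ?_
  intro b
  rw [← inner_etaII]
  exact hf _ (Submodule.subset_span ⟨p.1, p.2, _, (mem_bddFunctions_iff μ₀ _).2 ⟨b, rfl⟩, rfl⟩)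

/-! The operators `Q^{1/2}` and `α_k(Q^{1/2})` are multiplication operators. -/

/-- The function `t^{1/2}`. -/
noncomputable def sqrtFun : BddMeas (PosCell q) :=
  ⟨fun t => ((Real.sqrt (t : ℝ) : ℝ) : ℂ), Complex.measurable_ofReal.comp
    (Real.continuous_sqrt.measurable.comp measurable_subtype_coe), 1, fun t => by
      rw [Complex.norm_real, Real.norm_of_nonneg (Real.sqrt_nonneg _)]
      exact Real.sqrt_le_one.2 t.2.2⟩

theorem sqrtQ_eq : sqrtQ μ₀ = BddMeas.mulOp (cellMeasure μ₀) sqrtFun := by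
  refine sqrtOp_eq_of_mul_self
    (BddMeas.mulOp_nonneg _ (fun _ => Real.sqrt_nonneg _) fun _ => rfl) ?_
  rw [← BddMeas.mulOp_mul]
  refine ContinuousLinearMap.ext fun ζ => Lp.ext ?_
  filter_upwards [BddMeas.coeFn_mulOp (cellMeasure μ₀) (sqrtFun * sqrtFun) ζ,
    MemLp.coeFn_toLp (memLp_mul_coord (cellMeasure μ₀) ζ)] with t h1 h2
  refine h1.trans (Eq.trans ?_ h2.symm)
  show ((Real.sqrt (t : ℝ) : ℝ) : ℂ) * ((Real.sqrt (t : ℝ) : ℝ) : ℂ) * ζ t = ((t : ℝ) : ℂ) * ζ t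
  rw [← Complex.ofReal_mul, Real.mul_self_sqrt (PosCell.coe_pos t).le]

theorem alpha_sqrtQ (k : ℤ) :
    alpha q k (sqrtQ μ₀) = BddMeas.mulOp (cellMeasure μ₀) ((fibreII μ₀).al k) := by
  have hA : IsSelfAdjoint (sqrtQ μ₀) := by
    rw [sqrtQ_eq]
    exact BddMeas.isSelfAdjoint_mulOp _ fun t => Complex.conj_ofReal _
  refine alpha_eq_of_mul_self q k hA
    (BddMeas.mulOp_nonneg _ (fun _ => Real.sqrt_nonneg _) fun _ => rfl) ?_
  let g : BddMeas (PosCell q) := (fibreII μ₀).al k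
  show BddMeas.mulOp (cellMeasure μ₀) g * BddMeas.mulOp (cellMeasure μ₀) g = _
  rw [sqrtQ_eq, ← BddMeas.mulOp_mul, ← BddMeas.mulOp_mul]
  refine BddMeas.ext_of_toL2 _ fun b => ?_
  rw [BddMeas.mulOp_toL2, add_apply, smul_apply,
    BddMeas.mulOp_toL2, one_apply_eq_self, ← Complex.coe_smul, ← map_smul, ← map_add]
  congr 1
  refine BddMeas.ext fun t => ?_
  have h0 : 0 ≤ (fibreII μ₀).fac k t := (fibreII μ₀).nonneg trivial t
  show ((Real.sqrt ((fibreII μ₀).fac k t) : ℝ) : ℂ) * ((Real.sqrt ((fibreII μ₀).fac k t) : ℝ) : ℂ)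
      * (b : PosCell q → ℂ) t
    = (b : PosCell q → ℂ) t + (((q : ℝ) ^ (2 * k) : ℝ) : ℂ)
      * (((Real.sqrt (t : ℝ) : ℝ) : ℂ) * ((Real.sqrt (t : ℝ) : ℝ) : ℂ) * (b : PosCell q → ℂ) t)
  rw [← Complex.ofReal_mul, ← Complex.ofReal_mul, Real.mul_self_sqrt (PosCell.coe_pos t).le,
    Real.mul_self_sqrt h0]
  show ((1 - (q : ℝ) ^ (2 * k) * -(t : ℝ) : ℝ) : ℂ) * _ = _
  push_cast
  ring

theorem alpha_toL2 (k : ℤ) (b : (fibreII μ₀).B) :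
    alpha q k (sqrtQ μ₀) (BddMeas.toL2 (cellMeasure μ₀) b)
      = BddMeas.toL2 (cellMeasure μ₀) ((fibreII μ₀).al k * b) := by
  rw [alpha_sqrtQ]
  exact BddMeas.mulOp_toL2 _ _ _

variable {μ₀} {ρ : StarRep q (SpaceII (CellL2 μ₀))}

theorem isSeriesII2_of_isImage (hρ : ρ.IsImage ((fibreII μ₀).toHilbert (realII μ₀))) :
    IsSeriesII2 (sqrtQ μ₀) (sqrtQ μ₀) (bddFunctions (cellMeasure μ₀)) ρ := by
  have hdom := hρ.1.trans (range_toHilbert_realII μ₀)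
  refine ⟨hdom, fun n k η ξ hξ => ?_⟩
  -- the components of the vectors in the domain are bounded
  have hη : η ∈ bddFunctions (cellMeasure μ₀) := by
    have hle : ρ.dom ≤ (bddFunctions (cellMeasure μ₀)).comap
        (lp.evalCLM ℂ (fun _ => CellL2 μ₀) 2 (n, k)).toLinearMap := by
      rw [hdom, Submodule.span_le]
      rintro _ ⟨n', k', η', hη', rfl⟩
      show (etaII n' k' η' : SpaceII (CellL2 μ₀)) (n, k) ∈ bddFunctions (cellMeasure μ₀)
      rw [etaII_apply]
      split_ifs
      · exact hη'
      · exact Submodule.zero_mem _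
    have h := hle ξ.2
    rw [hξ] at h
    change (etaII n k η : SpaceII (CellL2 μ₀)) (n, k) ∈ bddFunctions (cellMeasure μ₀) at h
    rwa [etaII_apply, if_pos rfl] at h
  obtain ⟨b, rfl⟩ := (mem_bddFunctions_iff μ₀ η).1 hη
  have h := Fibre.action_of_isImage hρ (n := n) (k := k) trivial trivial b ξ hξ
  simp only [realII_apply, ← alpha_toL2] at h
  exact h

/-- Every vector `η_{nk}` is the limit of vectors `(b_j)_{nk}` with bounded `b_j`, along which every
weighted shift converges. -/
theorem exists_tendsto_of_isImage (hρ : ρ.IsImage ((fibreII μ₀).toHilbert (realII μ₀)))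
    {D : Submodule ℂ (SpaceII (CellL2 μ₀))}
    (hD : D = Submodule.span ℂ {ξ | ∃ (n k : ℤ) (η : CellL2 μ₀), η ∈ (⊤ : Submodule ℂ (CellL2 μ₀)) ∧
      ξ = etaII n k η}) {ζ : SpaceII (CellL2 μ₀)} (hζ : ζ ∈ D) :
    ∃ ξ : ℕ → ρ.dom, Tendsto (fun j => (ξ j : SpaceII (CellL2 μ₀))) atTop (𝓝 ζ) ∧
      ∀ a, ∃ v ∈ D, Tendsto (fun j => ((ρ.op a (ξ j) : ρ.dom) : SpaceII (CellL2 μ₀))) atTop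
        (𝓝 v) := by
  rw [hD] at hζ
  induction hζ using Submodule.span_induction with
  | mem ζ h =>
    obtain ⟨n, k, η, -, rfl⟩ := h
    obtain ⟨s, hs, hlim⟩ :=
      mem_closure_iff_seq_limit.1 (BddMeas.denseRange_toL2 (cellMeasure μ₀) η)
    choose b hb using hs
    have hx : ∀ j, ∃ x : F0 q, (fibreII μ₀).val x = Finsupp.single (n, k) (b j : (fibreII μ₀).B) :=
      fun j => (fibreII μ₀).exists_val_eq_single trivial trivial (b j)
    choose x hx using hx
    have hmem : ∀ j, (fibreII μ₀).toHilbert (realII μ₀) (x j) ∈ ρ.dom := fun j => by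
      rw [hρ.1]
      exact ⟨x j, rfl⟩
    refine ⟨fun j => ⟨_, hmem j⟩, ?_, fun a => ?_⟩
    · refine ((continuous_etaII n k).tendsto η |>.comp hlim).congr fun j => ?_
      rw [Function.comp_apply, ← hb]
      exact (Fibre.toHilbert_of_val (e := realII μ₀) (hx j)).symm
    · have key : ∀ T ∈ Submodule.span ℂ ((fibreII μ₀).shifts : Set (Module.End ℂ (F0 q))),
          ∃ v ∈ D, Tendsto (fun j => (fibreII μ₀).toHilbert (realII μ₀) (T (x j))) atTop (𝓝 v) := by
        intro T hT
        induction hT using Submodule.span_induction with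
        | mem T h =>
          obtain ⟨d, g, hg⟩ := h
          set p := (n, k) - d with hp
          refine ⟨etaII p.1 p.2 (BddMeas.mulOp (cellMeasure μ₀) (g p) η), ?_, ?_⟩
          · rw [hD]
            exact Submodule.subset_span ⟨_, _, _, trivial, rfl⟩
          · have hc := (continuous_etaII p.1 p.2).comp
              (BddMeas.mulOp (cellMeasure μ₀) (g p)).continuous
            refine ((hc.tendsto η).comp hlim).congr fun j => ?_
            rw [Fibre.toHilbert_of_val (hg.val_eq_single (hx j)), Function.comp_apply,
              Function.comp_apply, ← hb]
            exact congrArg (etaII p.1 p.2) (BddMeas.mulOp_toL2 (cellMeasure μ₀) (g p) (b j))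
        | zero => exact ⟨0, D.zero_mem, by simp⟩
        | add T T' _ _ h h' =>
          obtain ⟨v, hv, hl⟩ := h
          obtain ⟨v', hv', hl'⟩ := h'
          refine ⟨v + v', D.add_mem hv hv', ?_⟩
          simp only [LinearMap.add_apply, map_add]
          exact hl.add hl'
        | smul c T _ h =>
          obtain ⟨v, hv, hl⟩ := h
          refine ⟨c • v, D.smul_mem c hv, ?_⟩
          simp only [LinearMap.smul_apply, map_smul]
          exact hl.const_smul c
      obtain ⟨v, hv, hl⟩ := key _ ((fibreII μ₀).cross_mem_span a)
      refine ⟨v, hv, hl.congr fun j => ?_⟩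
      exact (hρ.2 a (x j) ⟨_, hmem j⟩ rfl).symm
  | zero => exact ⟨fun _ => 0, by simp, fun a => ⟨0, D.zero_mem, by simp⟩⟩
  | add ζ ζ' _ _ h h' =>
    obtain ⟨ξ, h1, h2⟩ := h
    obtain ⟨ξ', h1', h2'⟩ := h'
    refine ⟨fun j => ξ j + ξ' j, h1.add h1', fun a => ?_⟩
    obtain ⟨v, hv, hl⟩ := h2 a
    obtain ⟨v', hv', hl'⟩ := h2' a
    refine ⟨v + v', D.add_mem hv hv', ?_⟩
    simp only [map_add, Submodule.coe_add]
    exact hl.add hl'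
  | smul c ζ _ h =>
    obtain ⟨ξ, h1, h2⟩ := h
    refine ⟨fun j => c • ξ j, h1.const_smul c, fun a => ?_⟩
    obtain ⟨v, hv, hl⟩ := h2 a
    refine ⟨c • v, D.smul_mem c hv, ?_⟩
    simp only [map_smul, Submodule.coe_smul]
    exact hl.const_smul c

theorem exists_isSeriesII2_top (hρ : ρ.IsImage ((fibreII μ₀).toHilbert (realII μ₀))) :
    ∃ ρ' : StarRep q (SpaceII (CellL2 μ₀)),
      IsSeriesII2 (sqrtQ μ₀) (sqrtQ μ₀) ⊤ ρ' ∧ ρ.HasCoreIn ρ' := by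
  have hII := isSeriesII2_of_isImage hρ
  set D : Submodule ℂ (SpaceII (CellL2 μ₀)) := Submodule.span ℂ {ξ | ∃ (n k : ℤ) (η : CellL2 μ₀),
    η ∈ (⊤ : Submodule ℂ (CellL2 μ₀)) ∧ ξ = etaII n k η} with hD
  have hle : ρ.dom ≤ D := by
    rw [hII.1]
    refine Submodule.span_mono ?_
    rintro _ ⟨n, k, η, -, rfl⟩
    exact ⟨n, k, η, trivial, rfl⟩
  obtain ⟨ρ', hdom, hcore, hlim⟩ := ρ.exists_extension D hle fun ζ hζ =>
    exists_tendsto_of_isImage hρ hD hζ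
  refine ⟨ρ', ⟨hdom, fun n k η ζ hζ => ?_⟩, hcore⟩
  -- formulas for bounded functions extend by continuity
  have ext : ∀ (a : CrossSpace q) (g : CellL2 μ₀ → SpaceII (CellL2 μ₀)), Continuous g →
      (∀ (η : CellL2 μ₀) (ξ : ρ.dom), (ξ : SpaceII (CellL2 μ₀)) = etaII n k η →
        ((ρ.op a ξ : ρ.dom) : SpaceII (CellL2 μ₀)) = g η) →
      ((ρ'.op a ζ : ρ'.dom) : SpaceII (CellL2 μ₀)) = g η := by
    intro a g hg hform
    obtain ⟨s, hs, hl⟩ :=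
      mem_closure_iff_seq_limit.1 (BddMeas.denseRange_toL2 (cellMeasure μ₀) η)
    have hmem : ∀ j, etaII n k (s j) ∈ ρ.dom := fun j => by
      rw [hII.1]
      exact Submodule.subset_span ⟨n, k, _, (mem_bddFunctions_iff μ₀ _).2 (hs j), rfl⟩
    refine hlim a (fun j => ⟨_, hmem j⟩) ζ _ ?_ ?_
    · rw [hζ]
      exact ((continuous_etaII n k).tendsto η).comp hl
    · refine ((hg.tendsto η).comp hl).congr fun j => ?_
      exact (hform (s j) ⟨_, hmem j⟩ rfl).symm
  have hc : ∀ n k i : ℤ, Continuous fun η : CellL2 μ₀ => etaII n k (alpha q i (sqrtQ μ₀) η) :=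
    fun n k i => (continuous_etaII n k).comp (alpha q i (sqrtQ μ₀)).continuous
  have hcs : ∀ (c : ℂ) (n k i : ℤ),
      Continuous fun η : CellL2 μ₀ => c • etaII n k (alpha q i (sqrtQ μ₀) η) :=
    fun c n k i => (continuous_const_smul c).comp (hc n k i)
  refine ⟨?_, ?_, ?_, ?_, ?_⟩
  · exact ext _ _ (hc _ _ _) fun η ξ hξ => (hII.2 n k η ξ hξ).1
  · exact ext _ _ (hc _ _ _) fun η ξ hξ => (hII.2 n k η ξ hξ).2.1
  · exact ext _ (fun η => q.c ^ (n - k) • etaII n k η) ((continuous_const_smul _).comp (continuous_etaII n k))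
      fun η ξ hξ => (hII.2 n k η ξ hξ).2.2.1
  · exact ext _ (fun η => (q.lam⁻¹ * q.c ^ (n - k) * q.sqrt⁻¹)
          • etaII n (k + 1) (alpha q (k + 1) (sqrtQ μ₀) η)
        + (q.lam⁻¹ * q.c ^ (-(n - k)) * q.sqrt) • etaII (n - 1) k (alpha q n (sqrtQ μ₀) η))
      (continuous_add.comp ((hcs _ _ _ _).prodMk (hcs _ _ _ _)))
      fun η ξ hξ => (hII.2 n k η ξ hξ).2.2.2.1
  · exact ext _ (fun η => -(q.lam⁻¹ * q.c ^ (n - k) * q.sqrt)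
          • etaII n (k - 1) (alpha q k (sqrtQ μ₀) η)
        - (q.lam⁻¹ * q.c ^ (-(n - k)) * q.sqrt⁻¹)
          • etaII (n + 1) k (alpha q (n + 1) (sqrtQ μ₀) η))
      (continuous_sub.comp ((hcs _ _ _ _).prodMk (hcs _ _ _ _)))
      fun η ξ hξ => (hII.2 n k η ξ hξ).2.2.2.2

end seriesII

/-! ### Functionals given by a measure -/

section measureFunctionals

variable {q : Param}

theorem lin_ofReal (j : ℤ) (y : PLine) :
    (lin q j : PLine → ℂ) y = ((1 - (q : ℝ) ^ (2 * j) * (y : ℝ) : ℝ) : ℂ) := by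
  rw [lin_coe, Param.c]
  push_cast
  rfl

/-- On `(-∞, 0) ∪ {q^{2n} ; n ≥ 1}` the values of `(z*)^m z^m` and `z^m (z*)^m` are nonnegative. -/
theorem coc_nonneg_of_mem_posSupport {y : PLine} (hy : y ∈ posSupport q) (m : ℤ) :
    ∃ r : ℝ, 0 ≤ r ∧ (coc q (-m) m : PLine → ℂ) y = r := by
  have hprod : (coc q (-m) m : PLine → ℂ) y
      = ((∏ j ∈ cocSet (-m) m, (1 - (q : ℝ) ^ (2 * j) * (y : ℝ)) : ℝ) : ℂ) := by
    have h1 : (coc q (-m) m : PLine → ℂ) = ∏ j ∈ cocSet (-m) m, (lin q j : PLine → ℂ) :=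
      map_prod LBorel.subtype _ _
    rw [h1, Finset.prod_apply, Complex.ofReal_prod]
    exact Finset.prod_congr rfl fun j _ => lin_ofReal j y
  refine ⟨_, ?_, hprod⟩
  rcases hy with hy | ⟨n, hn, hy⟩
  · refine Finset.prod_nonneg fun j _ => ?_
    have := mul_pos (zpow_pos q.pos (2 * j)) (neg_pos.2 hy)
    linarith
  · have hfac : ∀ j : ℤ, 1 - (q : ℝ) ^ (2 * j) * (y : ℝ) = 1 - (q : ℝ) ^ (2 * (j + n)) := by
      intro j
      rw [hy, ← zpow_natCast, ← zpow_add₀ q.pos.ne']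
      push_cast
      ring_nf
    by_cases h0 : ∃ j ∈ cocSet (-m) m, j + n = 0
    · obtain ⟨j, hj, hjn⟩ := h0
      refine (Finset.prod_eq_zero hj ?_).ge
      rw [hfac, hjn, mul_zero, zpow_zero, sub_self]
    · refine Finset.prod_nonneg fun j hj => ?_
      have hpos : 0 ≤ j + n := by
        by_contra hneg
        refine h0 ⟨-n, ?_, neg_add_cancel _⟩
        unfold cocSet at hj ⊢
        split_ifs at hj ⊢ <;> rw [Finset.mem_Ico] at hj ⊢ <;> omega
      rw [hfac, sub_nonneg]
      exact zpow_le_one₀ q.pos q.lt_one.le (by omega)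

theorem isPositive_of_isGivenBy {ν : Measure PLine} {h : F0 q →ₗ[ℂ] ℂ} (hν : F0.IsGivenBy h ν)
    (hv : F0.VanishesOffDiagonal h) (hs : ν (posSupport q)ᶜ = 0) : F0.IsPositive h := by
  intro x
  have hterm : ∀ m : ℤ, ∃ r : ℝ, 0 ≤ r ∧
      h (F0.ofFun _ (F0.hasCompactSupport_term x x m)) = r := by
    intro m
    rw [hν]
    have h1 : ∀ᵐ y ∂ν, ((star (FU.coeff m x.1) * coc q (-m) m * FU.coeff m x.1 : LBorel) :
        PLine → ℂ) y = ((‖(FU.coeff m x.1 : PLine → ℂ) y‖ ^ 2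
          * ((coc q (-m) m : PLine → ℂ) y).re : ℝ) : ℂ) ∧
        0 ≤ ((coc q (-m) m : PLine → ℂ) y).re := by
      have hae : ∀ᵐ y ∂ν, y ∈ posSupport q := hs
      filter_upwards [hae] with y hy
      obtain ⟨r, hr, hc⟩ := coc_nonneg_of_mem_posSupport hy m
      rw [hc, Complex.ofReal_re]
      refine ⟨?_, hr⟩
      show (starRingEnd ℂ) ((FU.coeff m x.1 : PLine → ℂ) y) * (coc q (-m) m : PLine → ℂ) y
        * (FU.coeff m x.1 : PLine → ℂ) y = _
      rw [hc, mul_right_comm, ← Complex.normSq_eq_conj_mul_self, Complex.normSq_eq_norm_sq]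
      push_cast
      rfl
    refine ⟨∫ y, ‖(FU.coeff m x.1 : PLine → ℂ) y‖ ^ 2
          * ((coc q (-m) m : PLine → ℂ) y).re ∂ν, integral_nonneg_of_ae ?_, ?_⟩
    · filter_upwards [h1] with y hy
      exact mul_nonneg (sq_nonneg _) hy.2
    · exact (integral_congr_ae (h1.mono fun y hy => hy.1)).trans integral_ofReal
  choose r hr hr' using hterm
  refine ⟨∑ m ∈ Finsupp.support (x.1 : ℤ →₀ LBorel), r m, Finset.sum_nonneg fun m _ => hr m, ?_⟩
  rw [F0.map_starMul hv, Complex.ofReal_sum]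
  exact Finset.sum_congr rfl fun m _ => hr' m

/-- The scaling condition without the factor `1 - y`, for functions supported away from `1`. -/
theorem F0.ScalingCondition.map_shift {h : F0 q →ₗ[ℂ] ℂ} (hs : F0.ScalingCondition h)
    {g : LBorel} (hg : HasCompactSupport (g : PLine → ℂ)) {δ : ℝ} (hδ : 0 < δ)
    (h1 : ∀ y, (g : PLine → ℂ) y ≠ 0 → δ ≤ |1 - (y : ℝ)|) :
    h (F0.ofFun (shift q (-1) g) (F0.hcs_shift (-1) hg)) = q.c ^ (-2 : ℤ) * h (F0.ofFun g hg) := by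
  let f : LBorel := ⟨fun y => (g : PLine → ℂ) y * ((1 - (y : ℝ) : ℝ) : ℂ)⁻¹,
    g.2.1.mul (Complex.measurable_ofReal.comp
      (measurable_const.sub measurable_subtype_coe)).inv, fun C hC => by
    obtain ⟨M, hM⟩ := g.2.2 C hC
    refine ⟨M * δ⁻¹, fun y hy => ?_⟩
    have hM0 : 0 ≤ M := (norm_nonneg _).trans (hM y hy)
    show ‖(g : PLine → ℂ) y * ((1 - (y : ℝ) : ℝ) : ℂ)⁻¹‖ ≤ _
    by_cases hgy : (g : PLine → ℂ) y = 0
    · rw [hgy, zero_mul, norm_zero]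
      exact mul_nonneg hM0 (inv_nonneg.2 hδ.le)
    · rw [norm_mul, norm_inv, Complex.norm_real, Real.norm_eq_abs]
      exact mul_le_mul (hM y hy) (inv_anti₀ hδ (h1 y hgy)) (inv_nonneg.2 (abs_nonneg _)) hM0⟩
  have hf : HasCompactSupport (f : PLine → ℂ) :=
    hg.mul_right (f' := fun y : PLine => ((1 - (y : ℝ) : ℝ) : ℂ)⁻¹)
  have hfg : f * (1 - coordY) = g := by
    refine LBorel.ext fun y => ?_
    show (g : PLine → ℂ) y * ((1 - (y : ℝ) : ℝ) : ℂ)⁻¹ * (1 - ((y : ℝ) : ℂ)) = _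
    by_cases hgy : (g : PLine → ℂ) y = 0
    · rw [hgy, zero_mul, zero_mul]
    · have h0 : (1 - ((y : ℝ) : ℂ)) ≠ 0 := by
        have := abs_pos.1 (hδ.trans_le (h1 y hgy))
        exact_mod_cast this
      push_cast
      rw [mul_assoc, inv_mul_cancel₀ h0, mul_one]
  have h2 := hs f hf
  have e1 := F0.ofFun_congr (q := q) (congrArg (shift q (-1)) hfg) (F0.hcs_shift (-1) hf.mul_right)
  have e2 := F0.ofFun_congr (q := q) hfg hf.mul_right
  rw [e1, e2] at h2
  exact h2

theorem F0.ScalingCondition.map_shift_of_neg {h : F0 q →ₗ[ℂ] ℂ} (hs : F0.ScalingCondition h)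
    (n : ℤ) : ∀ {g : LBorel} (hg : HasCompactSupport (g : PLine → ℂ)),
    (∀ y, (g : PLine → ℂ) y ≠ 0 → (y : ℝ) < 0) →
    h (F0.ofFun (shift q n g) (F0.hcs_shift n hg)) = q.c ^ (2 * n) * h (F0.ofFun g hg) := by
  have hneg : ∀ {g : LBorel} (n : ℤ), (∀ y, (g : PLine → ℂ) y ≠ 0 → (y : ℝ) < 0) →
      ∀ y, (shift q n g : PLine → ℂ) y ≠ 0 → (y : ℝ) < 0 := by
    intro g n h0 y hy
    have h1 := h0 _ hy
    rw [scale_coe] at h1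
    exact not_le.1 fun h' => absurd (mul_nonneg (zpow_pos q.pos (2 * n)).le h') (not_le.2 h1)
  have hstep : ∀ {g : LBorel} (hg : HasCompactSupport (g : PLine → ℂ)),
      (∀ y, (g : PLine → ℂ) y ≠ 0 → (y : ℝ) < 0) →
      h (F0.ofFun (shift q (-1) g) (F0.hcs_shift (-1) hg))
        = q.c ^ (-2 : ℤ) * h (F0.ofFun g hg) := by
    intro g hg h0
    refine hs.map_shift hg one_pos fun y hy => ?_
    have := h0 y hy
    rw [abs_of_pos (by linarith)]
    linarith
  have hcongr : ∀ (i j : ℤ) {g : LBorel} (hg : HasCompactSupport (g : PLine → ℂ)),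
      F0.ofFun (q := q) (shift q i (shift q j g)) (F0.hcs_shift i (F0.hcs_shift j hg))
        = F0.ofFun (shift q (i + j) g) (F0.hcs_shift (i + j) hg) :=
    fun i j g hg => Subtype.ext (congrArg FU.ofFun (by rw [shift_shift, add_comm]))
  induction n using Int.induction_on with
  | zero =>
    intro g hg _
    rw [mul_zero, zpow_zero, one_mul]
    exact congrArg h (Subtype.ext (congrArg FU.ofFun (shift_zero q g)))
  | succ n ih =>
    intro g hg h0
    have h1 := hstep (F0.hcs_shift (q := q) (n + 1) hg) (hneg (n + 1) h0)
    rw [hcongr _ _ hg] at h1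
    have h2 := ih hg h0
    have h3 : F0.ofFun (q := q) (shift q (-1 + (n + 1)) g) (F0.hcs_shift (-1 + (n + 1)) hg)
        = F0.ofFun (shift q n g) (F0.hcs_shift n hg) :=
      Subtype.ext (congrArg (fun i => FU.ofFun (shift q i g)) (by ring))
    rw [h3, h2] at h1
    rw [show 2 * ((n : ℤ) + 1) = 2 * n + 2 by ring, zpow_add₀ q.c_ne, mul_right_comm, h1]
    rw [mul_right_comm, ← zpow_add₀ q.c_ne]
    norm_num
  | pred n ih =>
    intro g hg h0
    have h1 := hstep (F0.hcs_shift (q := q) (-n) hg) (hneg (-n) h0)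
    rw [hcongr _ _ hg, ih hg h0] at h1
    have h3 : F0.ofFun (q := q) (shift q (-1 + -n) g) (F0.hcs_shift (-1 + -n) hg)
        = F0.ofFun (shift q (-n - 1) g) (F0.hcs_shift (-n - 1) hg) :=
      Subtype.ext (congrArg (fun i => FU.ofFun (shift q i g)) (by ring))
    rw [h3] at h1
    rw [h1, ← mul_assoc, ← zpow_add₀ q.c_ne]
    congr 2
    ring

end measureFunctionals

/-! ### The decomposition of an invariant measure -/

section decomposition

variable {q : Param}

/-- The function `χ_S f`. -/
noncomputable def LBorel.indicator {S : Set PLine} (hS : MeasurableSet S) (f : LBorel) : LBorel :=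
  ⟨S.indicator (f : PLine → ℂ), f.2.1.indicator hS, fun C hC => by
    obtain ⟨M, hM⟩ := f.2.2 C hC
    exact ⟨M, fun y hy => (norm_indicator_le_norm_self _ _).trans (hM y hy)⟩⟩

theorem LBorel.hasCompactSupport_indicator {S : Set PLine} (hS : MeasurableSet S) {f : LBorel}
    (hf : HasCompactSupport (f : PLine → ℂ)) :
    HasCompactSupport (LBorel.indicator hS f : PLine → ℂ) :=
  hf.mono fun _ hy h0 => hy ((Set.indicator_apply_eq_zero).2 fun _ => h0)

theorem NegCell.coe_neg (y : NegCell q) : (y : ℝ) < 0 :=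
  y.2.2.trans_le (neg_nonpos.2 (sq_nonneg _))

theorem NegCell.measurableEmbedding_toPLine :
    MeasurableEmbedding (NegCell.toPLine (q := q)) := by
  have : StandardBorelSpace (NegCell q) := measurableSet_Ico.standardBorel
  refine NegCell.continuous_toPLine.measurable.measurableEmbedding fun y y' h => ?_
  exact Subtype.ext (congrArg (fun z : PLine => (z : ℝ)) h)

/-- The measure `y² dν(y)` on `[-1, -q²)`. -/
noncomputable def restrictCell (q : Param) (ν : Measure PLine) : Measure (NegCell q) :=
  (ν.comap NegCell.toPLine).withDensity fun y => ENNReal.ofReal ((y : ℝ) ^ 2)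

variable {ν : Measure PLine}

instance [IsFiniteMeasureOnCompacts ν] : IsFiniteMeasure (restrictCell q ν) := by
  refine isFiniteMeasure_withDensity (ne_of_lt ?_)
  have hle : ∀ y : NegCell q, ENNReal.ofReal ((y : ℝ) ^ 2) ≤ 1 := fun y => by
    rw [ENNReal.ofReal_le_one]
    have h1 := y.2.1
    have h2 := NegCell.coe_neg y
    nlinarith
  refine (lintegral_mono hle).trans_lt ?_
  rw [lintegral_one, NegCell.measurableEmbedding_toPLine.comap_apply]
  refine (measure_mono ?_).trans_lt
    (isCompact_annulus (b := 1) (pow_pos q.pos 2)).measure_lt_top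
  rintro _ ⟨y, -, rfl⟩
  show (q : ℝ) ^ 2 ≤ |(y : ℝ)| ∧ |(y : ℝ)| ≤ 1
  rw [abs_of_neg (NegCell.coe_neg y)]
  exact ⟨by linarith [y.2.2], by linarith [y.2.1]⟩

theorem integral_cellMeasure_restrictCell {g : PLine → ℂ} (hg : Measurable g) :
    ∫ t : PosCell q, g t.neg ∂(cellMeasure (restrictCell q ν))
      = ∫ y in Set.range (NegCell.toPLine (q := q)), g y ∂ν := by
  have hd : Measurable fun y : NegCell q => ENNReal.ofReal ((y : ℝ) ^ 2) :=
    ENNReal.measurable_ofReal.comp (measurable_subtype_coe.pow_const _)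
  refine (integral_cellMeasure _
    (hg.comp PosCell.measurableEmbedding_neg.measurable)).trans ?_
  rw [restrictCell, integral_withDensity_eq_integral_toReal_smul hd (ae_of_all _ fun _ => ENNReal.ofReal_lt_top),
    ← NegCell.measurableEmbedding_toPLine.map_comap,
    NegCell.measurableEmbedding_toPLine.integral_map]
  refine integral_congr_ae (ae_of_all _ fun y => ?_)
  have h0 : ((y : ℝ) : ℂ) ≠ 0 := Complex.ofReal_ne_zero.2 (NegCell.coe_neg y).ne
  show (ENNReal.ofReal ((y : ℝ) ^ 2)).toReal • (((y : ℝ) : ℂ) ^ (-2 : ℤ) * g (PosCell.neg y.reflect))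
    = g y.toPLine
  rw [ENNReal.toReal_ofReal (sq_nonneg _), Complex.real_smul, NegCell.neg_reflect, ← mul_assoc]
  push_cast
  rw [zpow_neg, zpow_ofNat, mul_inv_cancel₀ (pow_ne_zero 2 h0), one_mul]

variable (q) in
/-- The set `q^{2(k+1)} [-1, -q²)`. -/
def cellAt (k : ℤ) : Set PLine := scale q (-(k + 1)) ⁻¹' Set.range (NegCell.toPLine (q := q))

theorem measurableSet_cellAt (k : ℤ) : MeasurableSet (cellAt q k) :=
  (scale q (-(k + 1))).measurable NegCell.measurableEmbedding_toPLine.measurableSet_range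

theorem scale_mem_cellAt (k : ℤ) (y : PLine) :
    scale q (k + 1) y ∈ cellAt q k ↔ y ∈ Set.range (NegCell.toPLine (q := q)) := by
  rw [cellAt, Set.mem_preimage, scale_scale, neg_add_cancel, scale_zero]

theorem mem_cellAt {k : ℤ} {y : PLine} : y ∈ cellAt q k ↔
    (y : ℝ) < 0 ∧ (q : ℝ) ^ (2 * (k + 1)) * (q : ℝ) ^ 2 < -(y : ℝ) ∧
      -(y : ℝ) ≤ (q : ℝ) ^ (2 * (k + 1)) := by
  have hpos : 0 < (q : ℝ) ^ (2 * (k + 1)) := zpow_pos q.pos _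
  obtain ⟨x, rfl⟩ : ∃ x, scale q (k + 1) x = y := (scale q (k + 1)).surjective y
  rw [scale_mem_cellAt, scale_coe, ← mul_neg]
  constructor
  · rintro ⟨z, rfl⟩
    exact ⟨mul_neg_of_pos_of_neg hpos (NegCell.coe_neg z),
      mul_lt_mul_of_pos_left (lt_neg.1 z.2.2) hpos,
      mul_le_of_le_one_right hpos.le (neg_le.1 z.2.1)⟩
  · rintro ⟨-, h2, h3⟩
    have h2' := lt_of_mul_lt_mul_left h2 hpos.le
    have h3' : -(x : ℝ) ≤ 1 := by
      rwa [mul_le_iff_le_one_right hpos] at h3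
    exact ⟨⟨x, neg_le.1 h3', lt_neg.1 h2'⟩, Subtype.ext rfl⟩

theorem iUnion_cellAt : ⋃ k, cellAt q k = {y : PLine | (y : ℝ) < 0} := by
  ext y
  rw [Set.mem_iUnion, Set.mem_ofPred_eq]
  constructor
  · rintro ⟨k, hk⟩
    exact (mem_cellAt.1 hk).1
  · intro hy
    have h1 : 1 < ((q : ℝ) ^ 2)⁻¹ :=
      (one_lt_inv₀ (pow_pos q.pos 2)).2 (pow_lt_one₀ q.pos.le q.lt_one two_ne_zero)
    obtain ⟨n, hn⟩ := exists_mem_Ioc_zpow (neg_pos.2 hy) h1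
    have e : ∀ i : ℤ, (((q : ℝ) ^ 2)⁻¹) ^ i = (q : ℝ) ^ (2 * -i) := fun i => by
      rw [inv_zpow', ← zpow_natCast, ← zpow_mul]
      rfl
    rw [e, e] at hn
    refine ⟨-(n + 1) - 1, mem_cellAt.2 ⟨hy, ?_, ?_⟩⟩
    · rw [← zpow_natCast, ← zpow_add₀ q.pos.ne']
      refine (le_of_eq ?_).trans_lt hn.1
      congr 1
      push_cast
      ring
    · rw [sub_add_cancel]
      exact hn.2

theorem pairwise_disjoint_cellAt : Pairwise (Function.onFun Disjoint (cellAt q)) := by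
  have key : ∀ (k k' : ℤ) (y : PLine), y ∈ cellAt q k → y ∈ cellAt q k' → k' ≤ k := by
    intro k k' y hk hk'
    by_contra hlt
    have h1 := (mem_cellAt.1 hk).2.1
    have h2 := (mem_cellAt.1 hk').2.2
    rw [← zpow_natCast, ← zpow_add₀ q.pos.ne'] at h1
    have h3 : (q : ℝ) ^ (2 * (k' + 1)) ≤ (q : ℝ) ^ (2 * (k + 1) + ((2 : ℕ) : ℤ)) :=
      zpow_le_zpow_right_of_le_one₀ q.pos q.lt_one.le (by push_cast; omega)
    linarith
  intro k k' hne
  refine Set.disjoint_left.2 fun y hk hk' => hne ?_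
  exact le_antisymm (key k' k y hk' hk) (key k k' y hk hk')

variable {h : F0 q →ₗ[ℂ] ℂ}

/-- By scaling, all cells contribute as the cell `[-1, -q²)`. -/
theorem term_restrictCell [IsFiniteMeasureOnCompacts ν] (hν : F0.IsGivenBy h ν)
    (hs : F0.ScalingCondition h) (k : ℤ) {f : LBorel} (hf : HasCompactSupport (f : PLine → ℂ)) :
    (fibreII (restrictCell q ν)).term k f = ∫ y in cellAt q k, (f : PLine → ℂ) y ∂ν := by
  have hS := measurableSet_cellAt (q := q) k
  have hR := (NegCell.measurableEmbedding_toPLine (q := q)).measurableSet_range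
  have hk : k ∈ (fibreII (restrictCell q ν)).J := trivial
  have hg := LBorel.hasCompactSupport_indicator hS hf
  have h1 := hs.map_shift_of_neg (k + 1) hg fun y hy =>
    (mem_cellAt.1 (Set.mem_of_indicator_ne_zero hy)).1
  have h2 : (∫ y in cellAt q k, (f : PLine → ℂ) y ∂ν) = h (F0.ofFun _ hg) := by
    rw [hν, ← integral_indicator hS]
    rfl
  have h3 : (shift q (k + 1) (LBorel.indicator hS f) : PLine → ℂ)
      = (Set.range (NegCell.toPLine (q := q))).indicator (shift q (k + 1) f : PLine → ℂ) := by
    funext y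
    show (cellAt q k).indicator (f : PLine → ℂ) (scale q (k + 1) y) = _
    by_cases hy : y ∈ Set.range (NegCell.toPLine (q := q))
    · rw [Set.indicator_of_mem hy, Set.indicator_of_mem ((scale_mem_cellAt k y).2 hy)]
      rfl
    · rw [Set.indicator_of_notMem hy, Set.indicator_of_notMem fun h' =>
        hy ((scale_mem_cellAt k y).1 h')]
  rw [hν, h3, integral_indicator hR,
    ← integral_cellMeasure_restrictCell (shift q (k + 1) f).2.1] at h1
  rw [h2, Fibre.term, if_pos hk]
  have h4 : (∫ t, ((fibreII (restrictCell q ν)).ev k f : (fibreII (restrictCell q ν)).T → ℂ) t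
      ∂(fibreII (restrictCell q ν)).m) = q.c ^ (2 * (k + 1)) * h (F0.ofFun _ hg) := h1
  rw [h4, ← mul_assoc, ← zpow_add₀ q.c_ne, neg_add_cancel, zpow_zero, one_mul]

theorem setIntegral_neg [IsFiniteMeasureOnCompacts ν] (hν : F0.IsGivenBy h ν)
    (hs : F0.ScalingCondition h) {f : LBorel} (hf : HasCompactSupport (f : PLine → ℂ)) :
    ∫ y in {y : PLine | (y : ℝ) < 0}, (f : PLine → ℂ) y ∂ν
      = hMu (restrictCell q ν) (F0.ofFun f hf) := by
  have h1 := hasSum_integral_iUnion (f := (f : PLine → ℂ)) (μ := ν)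
    (measurableSet_cellAt (q := q)) pairwise_disjoint_cellAt (LBorel.integrable f hf ν).integrableOn
  have h2 := (represents_hMu (restrictCell q ν)).hasSum f hf
  rw [← iUnion_cellAt]
  refine h1.unique (Eq.mp (congrArg (fun g => HasSum g _) (funext fun k => ?_)) h2)
  exact term_restrictCell hν hs k hf

theorem measureReal_qPoint [IsFiniteMeasureOnCompacts ν] (hν : F0.IsGivenBy h ν)
    (hs : F0.ScalingCondition h) (k : ℕ) : (ν.real {qPoint q (k + 1)} : ℂ)
      = ((q : ℝ) ^ 2 * ν.real {qPoint q 1} : ℝ) * q.c⁻¹ ^ (2 * (k + 1)) := by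
  have hpt : ∀ y : PLine, HasCompactSupport
      (LBorel.indicator (measurableSet_singleton y) 1 : PLine → ℂ) := fun y =>
    HasCompactSupport.intro isCompact_singleton fun z hz => Set.indicator_of_notMem hz _
  have hval : ∀ y : PLine, h (F0.ofFun _ (hpt y)) = ν.real {y} := by
    intro y
    rw [hν]
    show ∫ z, ({y} : Set PLine).indicator (fun _ => (1 : ℂ)) z ∂ν = _
    rw [integral_indicator (measurableSet_singleton y), integral_const, measureReal_restrict_apply
      MeasurableSet.univ, Set.univ_inter, Complex.real_smul, mul_one]
  have hq := q.c_ne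
  induction k with
  | zero =>
    rw [zero_add, mul_one, Complex.ofReal_mul, mul_right_comm, Complex.ofReal_pow]
    show _ = q.c ^ 2 * q.c⁻¹ ^ 2 * _
    rw [← mul_pow, mul_inv_cancel₀ hq, one_pow, one_mul]
  | succ k ih =>
    have hlt : (q : ℝ) ^ (2 * (k + 1)) < 1 := pow_lt_one₀ q.pos.le q.lt_one (by omega)
    have h1 := hs.map_shift (hpt (qPoint q (k + 1))) (sub_pos.2 hlt) fun y hy => by
      obtain rfl := Set.mem_singleton_iff.1 (Set.mem_of_indicator_ne_zero hy)
      exact le_abs_self _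
    have h2 : shift q (-1) (LBorel.indicator (measurableSet_singleton (qPoint q (k + 1))) 1)
        = LBorel.indicator (measurableSet_singleton (qPoint q (k + 1 + 1))) 1 := by
      refine LBorel.ext fun y => ?_
      have hiff : scale q (-1) y ∈ ({qPoint q (k + 1)} : Set PLine)
          ↔ y ∈ ({qPoint q (k + 1 + 1)} : Set PLine) := by
        rw [Set.mem_singleton_iff, Set.mem_singleton_iff]
        have hq1 : scale q 1 (qPoint q (k + 1)) = qPoint q (k + 1 + 1) := by
          refine Subtype.ext ?_
          show (q : ℝ) ^ (2 * 1 : ℤ) * (q : ℝ) ^ (2 * (k + 1)) = (q : ℝ) ^ (2 * (k + 1 + 1))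
          rw [← zpow_natCast, ← zpow_natCast, ← zpow_add₀ q.pos.ne']
          congr 1
          push_cast
          ring
        constructor
        · intro hy
          rw [← hq1, ← hy, scale_scale, add_neg_cancel, scale_zero]
        · rintro rfl
          rw [← hq1, scale_scale, neg_add_cancel, scale_zero]
      show ({qPoint q (k + 1)} : Set PLine).indicator (fun _ => (1 : ℂ)) (scale q (-1) y)
        = ({qPoint q (k + 1 + 1)} : Set PLine).indicator (fun _ => (1 : ℂ)) y
      by_cases hy : y ∈ ({qPoint q (k + 1 + 1)} : Set PLine)
      · rw [Set.indicator_of_mem hy, Set.indicator_of_mem (hiff.2 hy)]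
      · rw [Set.indicator_of_notMem hy, Set.indicator_of_notMem fun h' => hy (hiff.1 h')]
    have h3 := (congrArg h (F0.ofFun_congr h2 (F0.hcs_shift (-1) (hpt _)))).symm.trans h1
    have h4 := (hval (qPoint q (k + 1 + 1))).symm.trans h3
    rw [h4, hval, ih, zpow_neg, zpow_ofNat, ← inv_pow]
    ring

theorem setIntegral_qPoints [IsFiniteMeasureOnCompacts ν] (hν : F0.IsGivenBy h ν)
    (hs : F0.ScalingCondition h) {f : LBorel} (hf : HasCompactSupport (f : PLine → ℂ)) :
    ∫ y in ⋃ k : ℕ, {qPoint q (k + 1)}, (f : PLine → ℂ) y ∂ν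
      = ((q : ℝ) ^ 2 * ν.real {qPoint q 1} : ℝ) * hI q (F0.ofFun f hf) := by
  have hinj : ∀ k k' : ℕ, qPoint q (k + 1) = qPoint q (k' + 1) → k = k' := by
    intro k k' hkk
    have h1 : (q : ℝ) ^ (2 * (k + 1)) = (q : ℝ) ^ (2 * (k' + 1)) := congrArg Subtype.val hkk
    have h2 := pow_right_injective₀ q.pos q.lt_one.ne h1
    change 2 * (k + 1) = 2 * (k' + 1) at h2
    omega
  have h1 := hasSum_integral_iUnion (f := (f : PLine → ℂ)) (μ := ν)
    (s := fun k : ℕ => {qPoint q (k + 1)}) (fun k => measurableSet_singleton _)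
    (fun k k' hne => Set.disjoint_singleton.2 fun h' => hne (hinj k k' h'))
    (LBorel.integrable f hf ν).integrableOn
  have h2 : hI q (F0.ofFun f hf)
      = ∑' k : ℕ, (f : PLine → ℂ) (qPoint q (k + 1)) * q.c⁻¹ ^ (2 * (k + 1)) := by
    show ∑' k : ℕ, (FU.coeff 0 (F0.ofFun f hf).1 : PLine → ℂ) (qPoint q (k + 1))
      * q.c⁻¹ ^ (2 * (k + 1)) = _
    rw [F0.coeff_ofFun]
  have h3 := (summable_qPoint (q := q) f hf).hasSum.mul_left
    (((q : ℝ) ^ 2 * ν.real {qPoint q 1} : ℝ) : ℂ)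
  rw [← h2] at h3
  refine h1.unique (Eq.mp (congrArg (fun g => HasSum g _) (funext fun k => ?_)) h3)
  rw [integral_singleton, Complex.real_smul, measureReal_qPoint hν hs k]
  ring

theorem posSupport_eq :
    posSupport q = {y : PLine | (y : ℝ) < 0} ∪ ⋃ k : ℕ, {qPoint q (k + 1)} := by
  ext y
  rw [Set.mem_union, Set.mem_iUnion]
  refine or_congr Iff.rfl ⟨?_, ?_⟩
  · rintro ⟨n, hn, hy⟩
    obtain ⟨k, rfl⟩ := Nat.exists_eq_succ_of_ne_zero (by omega : n ≠ 0)
    exact ⟨k, Subtype.ext hy⟩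
  · rintro ⟨k, rfl⟩
    exact ⟨k + 1, by omega, rfl⟩

theorem eq_smul_hI_add_hMu [IsFiniteMeasureOnCompacts ν] (hν : F0.IsGivenBy h ν)
    (hv : F0.VanishesOffDiagonal h) (hsupp : ν (posSupport q)ᶜ = 0) (hs : F0.ScalingCondition h) :
    h = (((q : ℝ) ^ 2 * ν.real {qPoint q 1} : ℝ) : ℂ) • hI q + hMu (restrictCell q ν) := by
  refine LinearMap.ext fun x => ?_
  rw [LinearMap.add_apply, LinearMap.smul_apply, F0.map_diag hv,
    F0.map_diag (vanishesOffDiagonal_hI q), F0.map_diag (vanishesOffDiagonal_hMu _)]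
  have hint := LBorel.integrable (FU.coeff 0 x.1) (x.2 0) ν
  have hdisj : Disjoint {y : PLine | (y : ℝ) < 0} (⋃ k : ℕ, {qPoint q (k + 1)}) := by
    refine Set.disjoint_left.2 fun y hy hy' => ?_
    obtain ⟨k, rfl⟩ := Set.mem_iUnion.1 hy'
    exact absurd hy (not_lt.2 (pow_pos q.pos _).le)
  have hsplit : ∫ y, (FU.coeff 0 x.1 : PLine → ℂ) y ∂ν
      = ∫ y in {y : PLine | (y : ℝ) < 0}, (FU.coeff 0 x.1 : PLine → ℂ) y ∂ν
        + ∫ y in ⋃ k : ℕ, {qPoint q (k + 1)}, (FU.coeff 0 x.1 : PLine → ℂ) y ∂ν := by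
    rw [← setIntegral_union hdisj (MeasurableSet.iUnion fun k => measurableSet_singleton _)
      hint.integrableOn hint.integrableOn, ← posSupport_eq,
      Measure.restrict_eq_self_of_ae_mem (s := posSupport q) hsupp]
  rw [F0.diag, hν, hsplit, setIntegral_neg hν hs (x.2 0), setIntegral_qPoints hν hs (x.2 0),
    smul_eq_mul, add_comm]

end decomposition

/-! ### The Heisenberg representation of `h_I + h_{μ₀}` -/

section heisenberg

open scoped InnerProductSpace

variable {q : Param}

theorem F0.VanishesOffDiagonal.add {h h' : F0 q →ₗ[ℂ] ℂ} (hv : F0.VanishesOffDiagonal h)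
    (hv' : F0.VanishesOffDiagonal h') : F0.VanishesOffDiagonal (h + h') := fun n hn f x hx => by
  rw [LinearMap.add_apply, hv n hn f x hx, hv' n hn f x hx, add_zero]

theorem F0.ScalingCondition.add {h h' : F0 q →ₗ[ℂ] ℂ} (hs : F0.ScalingCondition h)
    (hs' : F0.ScalingCondition h') : F0.ScalingCondition (h + h') := fun f hf => by
  rw [LinearMap.add_apply, hs f hf, hs' f hf, LinearMap.add_apply, mul_add]

theorem F0.IsPositive.add {h h' : F0 q →ₗ[ℂ] ℂ} (hp : F0.IsPositive h) (hp' : F0.IsPositive h') :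
    F0.IsPositive (h + h') := fun x => by
  obtain ⟨r, hr, e⟩ := hp x
  obtain ⟨r', hr', e'⟩ := hp' x
  exact ⟨r + r', add_nonneg hr hr', by rw [LinearMap.add_apply, e, e', Complex.ofReal_add]⟩

theorem exists_isHeisenberg {h : F0 q →ₗ[ℂ] ℂ} (hp : F0.IsPositive h)
    (hv : F0.VanishesOffDiagonal h) (hs : F0.ScalingCondition h) :
    ∃ π : StarRep q (HeisSpace h hp), π.IsImage (heisClass h hp) ∧ IsHeisenberg π := by
  have hd : Dense (LinearMap.range (heisClass h hp) : Set (HeisSpace h hp)) :=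
    UniformSpace.Completion.denseRange_coe (α := PreHeis h hp)
  obtain ⟨π, hπ⟩ := StarRep.exists_isImage hv hs (heisClass h hp) (inner_heisClass h hp) hd
  exact ⟨π, hπ, hπ.1, fun f a x ξ hξ => hπ.2 (f ⊗ₜ a) x ξ hξ⟩

/-- The characteristic function of `(0, ∞)`. -/
noncomputable def chiPos : LBorel :=
  LBorel.indicator (measurableSet_lt measurable_const measurable_subtype_coe :
    MeasurableSet {y : PLine | (0 : ℝ) < y}) 1

theorem chiPos_of_pos {y : PLine} (hy : (0 : ℝ) < y) : (chiPos : PLine → ℂ) y = 1 :=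
  Set.indicator_of_mem (s := {y : PLine | (0 : ℝ) < y}) hy _

theorem chiPos_of_neg {y : PLine} (hy : (y : ℝ) < 0) : (chiPos : PLine → ℂ) y = 0 :=
  Set.indicator_of_notMem (s := {y : PLine | (0 : ℝ) < y}) (not_lt.2 hy.le) _

theorem ev_fibreI_chiPos (k : ℤ) : (fibreI q).ev k chiPos = 1 :=
  BddMeas.ext fun _ => chiPos_of_pos (mul_pos (zpow_pos q.pos _) one_pos)

theorem ev_fibreII_chiPos (μ₀ : Measure (NegCell q)) [IsFiniteMeasure μ₀] (k : ℤ) :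
    (fibreII μ₀).ev k chiPos = 0 :=
  BddMeas.ext fun t => chiPos_of_neg
    (mul_neg_of_pos_of_neg (zpow_pos q.pos _) (neg_neg_of_pos (PosCell.coe_pos t)))

variable (μ₀ : Measure (NegCell q)) [IsFiniteMeasure μ₀]

/-- The pair of the two realizations of `x`. -/
noncomputable def toSum : F0 q →ₗ[ℂ] WithLp 2 (SpaceI × SpaceII (CellL2 μ₀)) where
  toFun x := WithLp.toLp 2 ((fibreI q).toHilbert (realI q) x,
    (fibreII μ₀).toHilbert (realII μ₀) x)
  map_add' x y := by rw [map_add, map_add]; rfl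
  map_smul' c x := by rw [map_smul, map_smul]; rfl

/-- The two realizations are independent, since the fibres lie in `(0, ∞)` and `(-∞, 0)`. -/
theorem exists_toHilbert_eq (x₁ x₂ : F0 q) : ∃ x : F0 q,
    (fibreI q).toHilbert (realI q) x = (fibreI q).toHilbert (realI q) x₁ ∧
    (fibreII μ₀).toHilbert (realII μ₀) x = (fibreII μ₀).toHilbert (realII μ₀) x₂ := by
  have hI1 : ∀ x, (fibreI q).toHilbert (realI q) (F0.rmulEnd (FU.ofFun chiPos) x)
      = (fibreI q).toHilbert (realI q) x := fun x => by
    unfold Fibre.toHilbert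
    rw [LinearMap.comp_apply, LinearMap.comp_apply,
      Fibre.val_mul_ofFun_of_one x ev_fibreI_chiPos]
  have hII0 : ∀ x, (fibreII μ₀).toHilbert (realII μ₀) (F0.rmulEnd (FU.ofFun chiPos) x) = 0 :=
    fun x => by
      unfold Fibre.toHilbert
      rw [LinearMap.comp_apply, Fibre.val_mul_ofFun_of_zero x (ev_fibreII_chiPos μ₀), map_zero]
  refine ⟨x₂ + F0.rmulEnd (FU.ofFun chiPos) (x₁ - x₂), ?_, ?_⟩
  · rw [map_add, hI1, map_sub, add_sub_cancel]
  · rw [map_add, hII0, add_zero]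

variable {μ₀}

theorem isImage_directSum {ρ₁ : StarRep q SpaceI} {ρ₂ : StarRep q (SpaceII (CellL2 μ₀))}
    (h₁ : ρ₁.IsImage ((fibreI q).toHilbert (realI q)))
    (h₂ : ρ₂.IsImage ((fibreII μ₀).toHilbert (realII μ₀))) :
    (ρ₁.directSum ρ₂).IsImage (toSum μ₀) := by
  refine ⟨le_antisymm ?_ ?_, fun a x ξ hξ => ?_⟩
  · rintro ξ ⟨hξ₁, hξ₂⟩
    rw [h₁.1] at hξ₁
    rw [h₂.1] at hξ₂
    obtain ⟨x₁, e₁⟩ := hξ₁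
    obtain ⟨x₂, e₂⟩ := hξ₂
    obtain ⟨x, hx₁, hx₂⟩ := exists_toHilbert_eq μ₀ x₁ x₂
    refine ⟨x, ?_⟩
    show WithLp.toLp 2 (_, _) = ξ
    rw [hx₁, hx₂, e₁, e₂]
    rfl
  · rintro _ ⟨x, rfl⟩
    refine ⟨?_, ?_⟩
    · rw [h₁.1]
      exact ⟨x, rfl⟩
    · rw [h₂.1]
      exact ⟨x, rfl⟩
  · show WithLp.toLp 2 (_, _) = WithLp.toLp 2 (_, _)
    rw [h₁.2 a x ⟨ξ.1.fst, ξ.2.1⟩ (congrArg WithLp.fst hξ),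
      h₂.2 a x ⟨ξ.1.snd, ξ.2.2⟩ (congrArg WithLp.snd hξ)]

theorem isPositive_hI : F0.IsPositive (hI q) :=
  (represents_hI q).isPositive isRealization_realI

variable (μ₀)

theorem isPositive_hMu : F0.IsPositive (hMu μ₀) :=
  (represents_hMu μ₀).isPositive (isRealization_realII μ₀)

theorem vanishesOffDiagonal_hI_add_hMu : F0.VanishesOffDiagonal (hI q + hMu μ₀) :=
  (vanishesOffDiagonal_hI q).add (vanishesOffDiagonal_hMu μ₀)

theorem scalingCondition_hI_add_hMu : F0.ScalingCondition (hI q + hMu μ₀) :=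
  (represents_hI q).scaling.add (represents_hMu μ₀).scaling

theorem exists_heisenberg_decomposition : ∃ (hp : F0.IsPositive (hI q + hMu μ₀))
    (π : StarRep q (HeisSpace (hI q + hMu μ₀) hp))
    (ρ₁ : StarRep q SpaceI) (ρ₂ ρ₂' : StarRep q (SpaceII (CellL2 μ₀))),
    IsHeisenberg π ∧ IsSeriesI1 ρ₁ ∧ ρ₁.IsIrreducible ∧
    IsSeriesII2 (sqrtQ μ₀) (sqrtQ μ₀) (bddFunctions (cellMeasure μ₀)) ρ₂ ∧
    IsSeriesII2 (sqrtQ μ₀) (sqrtQ μ₀) ⊤ ρ₂' ∧ ρ₂.HasCoreIn ρ₂' ∧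
    π.UnitarilyEquivalent (ρ₁.directSum ρ₂) := by
  have hp : F0.IsPositive (hI q + hMu μ₀) := isPositive_hI.add (isPositive_hMu μ₀)
  obtain ⟨π, hπ, hH⟩ := exists_isHeisenberg hp (vanishesOffDiagonal_hI_add_hMu μ₀)
    (scalingCondition_hI_add_hMu μ₀)
  have hd₁ : Dense (LinearMap.range ((fibreI q).toHilbert (realI q)) : Set SpaceI) := by
    rw [range_toHilbert_realI]
    exact dense_span_etaI
  obtain ⟨ρ₁, h₁⟩ := StarRep.exists_isImage (vanishesOffDiagonal_hI q) (represents_hI q).scaling _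
    ((represents_hI q).inner_toHilbert isRealization_realI) hd₁
  obtain ⟨ρ₂, h₂⟩ := StarRep.exists_isImage (vanishesOffDiagonal_hMu μ₀)
    (represents_hMu μ₀).scaling _ ((represents_hMu μ₀).inner_toHilbert (isRealization_realII μ₀))
    (dense_range_toHilbert_realII μ₀)
  obtain ⟨ρ₂', h₂', hcore⟩ := exists_isSeriesII2_top h₂
  have hI1 := isSeriesI1_of_isImage h₁
  refine ⟨hp, π, ρ₁, ρ₂, ρ₂', hH, hI1, hI1.isIrreducible, isSeriesII2_of_isImage h₂, h₂', hcore,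
    hπ.unitarilyEquivalent (isImage_directSum h₁ h₂) fun x => ?_⟩
  rw [inner_heisClass, WithLp.prod_inner_apply, LinearMap.add_apply,
    ← (represents_hI q).inner_toHilbert isRealization_realI x x,
    ← (represents_hMu μ₀).inner_toHilbert (isRealization_realII μ₀) x x]
  rfl

end heisenberg

end QDisc

theorem mainTheorem8 (q : Param) :
    -- invariance is equivalent to the two conditions
    (∀ h : F0 q →ₗ[ℂ] ℂ,
      F0.IsInvariant h ↔ F0.VanishesOffDiagonal h ∧ F0.ScalingCondition h) ∧
    -- functionals given by a measure with support in `(-∞,0) ∪ {q^{2n} ; n ≥ 1}`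
    (∀ (ν : MeasureTheory.Measure PLine) [MeasureTheory.IsFiniteMeasureOnCompacts ν]
      (h : F0 q →ₗ[ℂ] ℂ), F0.IsGivenBy h ν → F0.VanishesOffDiagonal h → ν (posSupport q)ᶜ = 0 →
      F0.IsPositive h ∧
      (F0.ScalingCondition h → F0.IsInvariant h ∧
        ∃ (r : ℝ) (μ₀ : MeasureTheory.Measure (NegCell q))
          (_ : MeasureTheory.IsFiniteMeasure μ₀), 0 ≤ r ∧ h = (r : ℂ) • hI q + hMu μ₀)) ∧
    -- the functionals `h_I` and `h_{μ₀}`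
    (F0.IsPositive (hI q) ∧ F0.IsInvariant (hI q)) ∧
    ∀ (μ₀ : MeasureTheory.Measure (NegCell q)) [MeasureTheory.IsFiniteMeasure μ₀],
      F0.IsPositive (hMu μ₀) ∧ F0.IsInvariant (hMu μ₀) ∧ F0.IsInvariant (hI q + hMu μ₀) ∧
      -- the Heisenberg representation associated with `h = h_I + h_{μ₀}`
      ∃ (hp : F0.IsPositive (hI q + hMu μ₀)) (π : StarRep q (HeisSpace (hI q + hMu μ₀) hp))
        (ρ₁ : StarRep q SpaceI) (ρ₂ ρ₂' : StarRep q (SpaceII (CellL2 μ₀))),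
        IsHeisenberg π ∧
        IsSeriesI1 ρ₁ ∧ ρ₁.IsIrreducible ∧
        IsSeriesII2 (sqrtQ μ₀) (sqrtQ μ₀) (bddFunctions (cellMeasure μ₀)) ρ₂ ∧
        IsSeriesII2 (sqrtQ μ₀) (sqrtQ μ₀) ⊤ ρ₂' ∧ ρ₂.HasCoreIn ρ₂' ∧
        π.UnitarilyEquivalent (ρ₁.directSum ρ₂) := by
  refine ⟨F0.isInvariant_iff, fun ν _ h hν hv hsupp => ⟨isPositive_of_isGivenBy hν hv hsupp,
    fun hs => ⟨F0.isInvariant_of hv hs, _, restrictCell q ν, inferInstance,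
      mul_nonneg (sq_nonneg _) MeasureTheory.measureReal_nonneg, eq_smul_hI_add_hMu hν hv hsupp hs⟩⟩,
    ⟨isPositive_hI, (represents_hI q).invariant⟩, fun μ₀ _ => ⟨isPositive_hMu μ₀,
      (represents_hMu μ₀).invariant, F0.isInvariant_of (vanishesOffDiagonal_hI_add_hMu μ₀)
        (scalingCondition_hI_add_hMu μ₀), exists_heisenberg_decomposition μ₀⟩⟩
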